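/- Let $n\ge 3$, $X=\{x_1,\dots,x_n\}$ and $Y=\{y_1,\dots,y_n\}$. All graphs are finite; a node of a graph is labelled exactly when it belongs to $X\cup Y$, each label is used at most once, and graphs are identified when they are isomorphic by an isomorphism that preserves labels. For a node $a$ of a directed graph $G$, let $E(a,G)$ be the subgraph of all nodes from which $a$ is reachable, with all edges $(b',b'')$ of $G$ such that $a$ is reachable from $b''$. A directed binary tree (DBT) is a rooted tree, in which each node has zero or two children, with all edges directed from child to parent. A structure is a directed acyclic graph $S$ such that a node is in $X$ if and only if it has no incoming edge; $E(a,S)$ is a DBT for every node $a$; and $E(a,S)\ne E(b,S)$ for any two different nodes $a,b$. A node of $S$ outside $X$ is a computation node, and a computation node without outgoing edge is an output node. Let $\mathcal S_n$ be the set of all structures whose output nodes are exactly $y_1,\dots,y_n$ and in which, for each $j$, $E(y_j,S)$ is a DBT with leaves $X\setminus\{x_j\}$. The complexity $c(S)$ is the number of computation nodes of $S$, and $\mathcal S_n^{\mathrm{co}}$ is the set of all $S\in\mathcal S_n$ with $c(S)=\min_{S'\in\mathcal S_n}c(S')$. The union $\bigvee_i S_i$ of structures is the disjoint union of the $S_i$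 in which nodes $a\in S_i$, $b\in S_j$ with $E(a,S_i)=E(b,S_j)$ are identified. A T-tree is an undirected tree whose leaves are exactly $x_1,\dots,x_n$, whose internal nodes are unlabelled, and each of whose internal nodes has degree $3$; let $\mathcal T_n$ be the set of all T-trees. For an edge $(a,b)$ of a T-tree $T$, let $D(a,b,T)=E(a,T_b)$, where $T_b$ is $T$ rooted at $b$ with all edges directed from child to parent. Theorem. The map $$h(T)=\bigvee_{j\in\{1,\dots,n\},\ (a,x_j)\in T} D(a,x_j,T),$$ where the root $a$ of $D(a,x_j,T)$ is labelled $y_j$, is a bijection from $\mathcal T_n$ onto $\mathcal S_n^{\mathrm{co}}$. Moreover $|\mathcal T_n|=|\mathcal S_n^{\mathrm{co}}|=(2n-5)!!$. -/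

import Mathlib

open scoped Nat

/-- The labels of nodes: the input nodes `x_1, …, x_n` and the output nodes `y_1, …, y_n`
(indexed by `Fin n`). -/
inductive IOLabel (n : ℕ) : Type where
  | x : Fin n → IOLabel n
  | y : Fin n → IOLabel n

/-- A finite directed graph some of whose nodes carry a label from `X ∪ Y`;
all other nodes (those with `label = none`) are unlabelled. -/
structure LDigraph (n : ℕ) : Type 1 where
  V : Type
  finite_V : Finite V
  Adj : V → V → Prop
  label : V → Option (IOLabel n)

namespace LDigraph

variable {n : ℕ}

/-- An isomorphism of partially unlabelled digraphs: it keeps edges and labels. -/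
structure Iso (G H : LDigraph n) where
  toEquiv : G.V ≃ H.V
  adj_iff : ∀ a b, H.Adj (toEquiv a) (toEquiv b) ↔ G.Adj a b
  label_eq : ∀ a, H.label (toEquiv a) = G.label a

namespace Iso

def refl (G : LDigraph n) : Iso G G := ⟨Equiv.refl _, fun _ _ => Iff.rfl, fun _ => rfl⟩

def symm {G H : LDigraph n} (e : Iso G H) : Iso H G :=
  ⟨e.toEquiv.symm, fun a b => by simpa using (e.adj_iff (e.toEquiv.symm a) (e.toEquiv.symm b)).symm,
    fun a => by simpa using (e.label_eq (e.toEquiv.symm a)).symm⟩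

def trans {G H K : LDigraph n} (e : Iso G H) (f : Iso H K) : Iso G K :=
  ⟨e.toEquiv.trans f.toEquiv, fun a b => (f.adj_iff _ _).trans (e.adj_iff a b),
    fun a => (f.label_eq _).trans (e.label_eq a)⟩

end Iso

/-- Two partially unlabelled digraphs are identified when they are isomorphic. -/
instance isoSetoid (n : ℕ) : Setoid (LDigraph n) where
  r G H := Nonempty (Iso G H)
  iseqv := ⟨fun G => ⟨Iso.refl G⟩, fun ⟨e⟩ => ⟨e.symm⟩, fun ⟨e⟩ ⟨f⟩ => ⟨e.trans f⟩⟩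

/-- `E(a, G)`, the subgraph entering `a`: all nodes `b` from which `a` is reachable, and all edges
`(b', b'')` such that `a` is reachable from `b''`. -/
def entering (G : LDigraph n) (a : G.V) : LDigraph n where
  V := {b : G.V // Relation.ReflTransGen G.Adj b a}
  finite_V := by have := G.finite_V; infer_instance
  Adj b c := G.Adj b.1 c.1
  label b := G.label b.1

/-- The node `a` of `E(a, G)`. -/
def enteringRoot (G : LDigraph n) (a : G.V) : (G.entering a).V := ⟨a, Relation.ReflTransGen.refl⟩

/-- `E(a, G) = E(b, H)` as partially unlabelled digraphs with roots `a` and `b`. -/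
def SameSubtree (G : LDigraph n) (a : G.V) (H : LDigraph n) (b : H.V) : Prop :=
  ∃ e : Iso (G.entering a) (H.entering b), e.toEquiv (G.enteringRoot a) = H.enteringRoot b

theorem SameSubtree.refl (G : LDigraph n) (a : G.V) : SameSubtree G a G a := ⟨Iso.refl _, rfl⟩

theorem SameSubtree.symm {G H : LDigraph n} {a : G.V} {b : H.V} (h : SameSubtree G a H b) :
    SameSubtree H b G a := by
  obtain ⟨e, he⟩ := h
  exact ⟨e.symm, by rw [← he]; exact e.toEquiv.symm_apply_apply _⟩

theorem SameSubtree.trans {G H K : LDigraph n} {a : G.V} {b : H.V} {c : K.V}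
    (h : SameSubtree G a H b) (h' : SameSubtree H b K c) : SameSubtree G a K c := by
  obtain ⟨e, he⟩ := h
  obtain ⟨f, hf⟩ := h'
  refine ⟨e.trans f, ?_⟩
  change f.toEquiv (e.toEquiv _) = _
  rw [he, hf]

theorem SameSubtree.label_eq {G H : LDigraph n} {a : G.V} {b : H.V} (h : SameSubtree G a H b) :
    G.label a = H.label b := by
  obtain ⟨e, he⟩ := h
  have := e.label_eq (G.enteringRoot a)
  rw [he] at this
  exact this.symm

theorem Iso.reach_iff {G H : LDigraph n} (e : Iso G H) (a b : G.V) :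
    Relation.ReflTransGen H.Adj (e.toEquiv b) (e.toEquiv a) ↔
      Relation.ReflTransGen G.Adj b a := by
  constructor
  · intro h
    have := h.lift (p := G.Adj) e.symm.toEquiv fun c d hcd => (e.symm.adj_iff c d).2 hcd
    simpa [Iso.symm, Function.onFun] using this
  · intro h
    exact h.lift e.toEquiv fun c d hcd => (e.adj_iff c d).2 hcd

/-- An isomorphism restricts to the subgraphs entering corresponding nodes. -/
def Iso.entering {G H : LDigraph n} (e : Iso G H) (a : G.V) :
    Iso (G.entering a) (H.entering (e.toEquiv a)) where
  toEquiv := e.toEquiv.subtypeEquiv fun b => (e.reach_iff a b).symm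
  adj_iff b c := e.adj_iff b.1 c.1
  label_eq b := e.label_eq b.1

theorem Iso.sameSubtree {G H : LDigraph n} (e : Iso G H) (a : G.V) :
    SameSubtree G a H (e.toEquiv a) := ⟨e.entering a, rfl⟩

/-- `G` is a directed binary tree: it is obtained from an undirected tree `T` with root `r`, in which
each node has either zero or two children, by directing each edge from child to parent. -/
def IsDBT (G : LDigraph n) : Prop :=
  ∃ (T : SimpleGraph G.V) (r : G.V), T.IsTree ∧
    (∀ c d, G.Adj c d ↔ T.Adj c d ∧ T.dist c r = T.dist d r + 1) ∧
    ∀ d, {c | G.Adj c d}.ncard = 0 ∨ {c | G.Adj c d}.ncard = 2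

/-- `a ∈ X`. -/
def IsInput (G : LDigraph n) (a : G.V) : Prop := ∃ j, G.label a = some (IOLabel.x j)

/-- Output nodes: computation nodes (nodes outside `X`) without outgoing edge. -/
def IsOutput (G : LDigraph n) (a : G.V) : Prop := ¬ G.IsInput a ∧ ∀ b, ¬ G.Adj a b

/-- A structure: a directed acyclic graph in which a node is in `X` iff it has no incoming edge, each
`E(a, S)` is a directed binary tree, and `E(a, S) ≠ E(b, S)` for different nodes `a`, `b`. -/
structure IsStructure (S : LDigraph n) : Prop where
  label_unique : ∀ a b l, S.label a = some l → S.label b = some l → a = b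
  acyclic : ∀ a, ¬ Relation.TransGen S.Adj a a
  input_iff : ∀ a, S.IsInput a ↔ ∀ b, ¬ S.Adj b a
  isDBT : ∀ a, (S.entering a).IsDBT
  subtree_ne : ∀ a b, a ≠ b → ¬ SameSubtree S a S b

/-- The labels of the leaves (the nodes without children) of a directed binary tree. -/
def leafLabels (G : LDigraph n) : Set (Option (IOLabel n)) := G.label '' {a | ∀ b, ¬ G.Adj b a}

/-- `S` is a structure used for computing `y`: its output nodes are exactly `y_1, …, y_n`, and
`E(y_j, S)` is a directed binary tree with leaves `X \ {x_j}`. -/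
structure ComputesY (S : LDigraph n) : Prop extends IsStructure S where
  output_iff : ∀ a, S.IsOutput a ↔ ∃ j, S.label a = some (IOLabel.y j)
  exists_output : ∀ j, ∃ a, S.label a = some (IOLabel.y j)
  leaves : ∀ j a, S.label a = some (IOLabel.y j) →
    (S.entering a).leafLabels = {l | ∃ i, i ≠ j ∧ l = some (IOLabel.x i)}

/-- The complexity `c(S)`: the number of computation nodes. -/
noncomputable def complexity (S : LDigraph n) : ℕ := {a : S.V | ¬ S.IsInput a}.ncard

/-- The minimum complexity of a structure used for computing `y` with `n` inputs. -/
noncomputable def minComplexity (n : ℕ) : ℕ :=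
  sInf {c | ∃ S : LDigraph n, S.ComputesY ∧ S.complexity = c}

/-- Complexity-optimal structures. -/
def IsComplexityOptimal (S : LDigraph n) : Prop :=
  S.ComputesY ∧ S.complexity = minComplexity n

/-- Nodes of the disjoint union of the `S i` are identified when they root the same subtree. -/
def veeSetoid {ι : Type} (S : ι → LDigraph n) : Setoid (Σ i, (S i).V) where
  r p q := SameSubtree (S p.1) p.2 (S q.1) q.2
  iseqv := ⟨fun _ => SameSubtree.refl _ _, fun h => h.symm, fun h h' => h.trans h'⟩

/-- The union `⋁ i, S i`: the disjoint union in which only one copy of the same subtrees is kept. -/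
def vee {ι : Type} [Finite ι] (S : ι → LDigraph n) : LDigraph n where
  V := Quotient (veeSetoid S)
  finite_V := by
    have := fun i => (S i).finite_V
    infer_instance
  Adj P Q := ∃ i a b, (S i).Adj a b ∧
    P = Quotient.mk (veeSetoid S) ⟨i, a⟩ ∧ Q = Quotient.mk (veeSetoid S) ⟨i, b⟩
  label := Quotient.lift (fun p => (S p.1).label p.2) fun _ _ h => SameSubtree.label_eq h

/-- The union depends only on the isomorphism classes of its members. -/
theorem vee_congr {ι κ : Type} [Finite ι] [Finite κ] (S : ι → LDigraph n) (S' : κ → LDigraph n)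
    (e : ι ≃ κ) (f : ∀ i, Nonempty (Iso (S i) (S' (e i)))) : Nonempty (Iso (vee S) (vee S')) := by
  classical
  let F : ∀ i, Iso (S i) (S' (e i)) := fun i => (f i).some
  let E : (Σ i, (S i).V) ≃ (Σ k, (S' k).V) := Equiv.sigmaCongr e fun i => (F i).toEquiv
  have hE : ∀ i a, E ⟨i, a⟩ = ⟨e i, (F i).toEquiv a⟩ := fun _ _ => rfl
  have hr : ∀ p q, (veeSetoid S).r p q ↔ (veeSetoid S').r (E p) (E q) := by
    rintro ⟨i, a⟩ ⟨k, b⟩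
    have h1 := (F i).sameSubtree a
    have h2 := (F k).sameSubtree b
    exact ⟨fun h => (h1.symm.trans h).trans h2, fun h => (h1.trans h).trans h2.symm⟩
  let Q : (vee S).V ≃ (vee S').V := Quotient.congr E hr
  have hQ : ∀ p, Q (Quotient.mk (veeSetoid S) p) = Quotient.mk (veeSetoid S') (E p) := fun _ => rfl
  refine ⟨⟨Q, fun A B => ⟨?_, ?_⟩, ?_⟩⟩
  · rintro ⟨k, a', b', hab, hA, hB⟩
    obtain ⟨i, rfl⟩ := e.surjective k
    obtain ⟨a, rfl⟩ := (F i).toEquiv.surjective a'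
    obtain ⟨b, rfl⟩ := (F i).toEquiv.surjective b'
    refine ⟨i, a, b, ((F i).adj_iff a b).1 hab, Q.injective ?_, Q.injective ?_⟩
    · rw [hA, hQ, hE]
    · rw [hB, hQ, hE]
  · rintro ⟨i, a, b, hab, rfl, rfl⟩
    exact ⟨e i, _, _, ((F i).adj_iff a b).2 hab, by rw [hQ, hE], by rw [hQ, hE]⟩
  · rintro ⟨i, a⟩
    exact (F i).label_eq a

open Classical in
/-- The digraph `G` in which the node `a` is given the label `l`. -/
noncomputable def setLabel (G : LDigraph n) (a : G.V) (l : IOLabel n) : LDigraph n where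
  V := G.V
  finite_V := G.finite_V
  Adj := G.Adj
  label b := if b = a then some l else G.label b

/-- Isomorphisms are compatible with giving a label to corresponding nodes. -/
noncomputable def Iso.setLabel {G H : LDigraph n} (e : Iso G H) (a : G.V) (l : IOLabel n) :
    Iso (G.setLabel a l) (H.setLabel (e.toEquiv a) l) where
  toEquiv := e.toEquiv
  adj_iff := e.adj_iff
  label_eq := by
    classical
    have h : ∀ b : G.V, (if e.toEquiv b = e.toEquiv a then some l else H.label (e.toEquiv b)) =
        if b = a then some l else G.label b := fun b => by
      rw [e.toEquiv.injective.eq_iff, e.label_eq]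
    exact h

end LDigraph

/-- A finite undirected graph some of whose nodes are labelled by `x_1, …, x_n`
(indexed by `Fin n`); all other nodes are unlabelled. -/
structure LGraph (n : ℕ) : Type 1 where
  V : Type
  finite_V : Finite V
  graph : SimpleGraph V
  label : V → Option (Fin n)

namespace LGraph

variable {n : ℕ}

/-- An isomorphism of partially unlabelled graphs: it keeps edges and labels. -/
structure Iso (T U : LGraph n) where
  toIso : T.graph ≃g U.graph
  label_eq : ∀ a, U.label (toIso a) = T.label a

/-- Two partially unlabelled graphs are identified when they are isomorphic. -/
instance isoSetoid (n : ℕ) : Setoid (LGraph n) where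
  r T U := Nonempty (Iso T U)
  iseqv := ⟨fun _ => ⟨⟨SimpleGraph.Iso.refl, fun _ => rfl⟩⟩,
    fun ⟨e⟩ => ⟨⟨e.toIso.symm, fun a => by simpa using (e.label_eq (e.toIso.symm a)).symm⟩⟩,
    fun ⟨e⟩ ⟨f⟩ => ⟨⟨e.toIso.trans f.toIso, fun a => (f.label_eq _).trans (e.label_eq a)⟩⟩⟩

/-- A T-tree: a tree whose leaves (nodes with only one edge) are exactly `x_1, …, x_n`, and each of
whose internal nodes (nodes with more than one edge) has exactly three edges. -/
structure IsTTree (T : LGraph n) : Prop where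
  isTree : T.graph.IsTree
  label_unique : ∀ a b j, T.label a = some j → T.label b = some j → a = b
  exists_label : ∀ j, ∃ a, T.label a = some j
  leaf_iff : ∀ a, (T.graph.neighborSet a).ncard = 1 ↔ ∃ j, T.label a = some j
  internal : ∀ a, 1 < (T.graph.neighborSet a).ncard → (T.graph.neighborSet a).ncard = 3

/-- `T_b`, the directed version of the tree `T` rooted at `b`: each edge is directed from child to
parent, where the child has the larger depth. -/
def rootedAt (T : LGraph n) (b : T.V) : LDigraph n where
  V := T.V
  finite_V := T.finite_V
  Adj c d := T.graph.Adj c d ∧ T.graph.dist c b = T.graph.dist d b + 1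
  label c := (T.label c).map IOLabel.x

/-- `D(a, b, T) = E(a, T_b)`. -/
def subtreeD (T : LGraph n) (a b : T.V) : LDigraph n := (T.rootedAt b).entering a

/-- `D(a, x_j, T)`, where `b` is the node `x_j` of `T`, with its root `a` labelled by `y_j`. -/
noncomputable def outputTree (T : LGraph n) (j : Fin n) (a b : T.V) : LDigraph n :=
  (T.subtreeD a b).setLabel ((T.rootedAt b).enteringRoot a) (IOLabel.y j)

/-- The triples `(j, a, b)` such that `(a, b)` is an edge of `T` and `b = x_j`. -/
def LeafEdge (T : LGraph n) : Type :=
  {p : Fin n × T.V × T.V // T.label p.2.2 = some p.1 ∧ T.graph.Adj p.2.1 p.2.2}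

instance (T : LGraph n) : Finite T.LeafEdge := by
  have := T.finite_V
  unfold LeafEdge
  infer_instance

/-- The union of the trees `D(a, x_j, T)` over all `j` and all edges `(a, x_j)` of `T`. -/
noncomputable def unionD (T : LGraph n) : LDigraph n :=
  LDigraph.vee fun p : T.LeafEdge => T.outputTree p.1.1 p.1.2.1 p.1.2.2

theorem dist_iso {V W : Type} {G : SimpleGraph V} {H : SimpleGraph W} (e : G ≃g H) (a b : V) :
    H.dist (e a) (e b) = G.dist a b := by
  rw [SimpleGraph.dist_eq_sInf, SimpleGraph.dist_eq_sInf]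
  congr 1
  ext k
  constructor
  · rintro ⟨w, rfl⟩
    refine ⟨(w.map e.symm.toHom).copy (e.symm_apply_apply a) (e.symm_apply_apply b), ?_⟩
    simp
  · rintro ⟨w, rfl⟩
    exact ⟨w.map e.toHom, by simp⟩

/-- An isomorphism of graphs is one of the rooted directed versions. -/
def Iso.rootedAt {T U : LGraph n} (e : Iso T U) (b : T.V) :
    LDigraph.Iso (T.rootedAt b) (U.rootedAt (e.toIso b)) where
  toEquiv := e.toIso.toEquiv
  adj_iff := by
    have h : ∀ c d : T.V, (U.graph.Adj (e.toIso c) (e.toIso d) ∧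
        U.graph.dist (e.toIso c) (e.toIso b) = U.graph.dist (e.toIso d) (e.toIso b) + 1) ↔
        T.graph.Adj c d ∧ T.graph.dist c b = T.graph.dist d b + 1 := fun c d => by
      rw [dist_iso, dist_iso, e.toIso.map_adj_iff]
    exact h
  label_eq c := congrArg (Option.map IOLabel.x) (e.label_eq c)

theorem unionD_congr (T U : LGraph n) (h : T ≈ U) : T.unionD ≈ U.unionD := by
  obtain ⟨e⟩ := h
  let ε : T.LeafEdge ≃ U.LeafEdge :=
    ((Equiv.refl (Fin n)).prodCongr (e.toIso.toEquiv.prodCongr e.toIso.toEquiv)).subtypeEquiv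
      fun p => and_congr (by rw [← e.label_eq p.2.2]; rfl) e.toIso.map_adj_iff.symm
  exact LDigraph.vee_congr _ _ ε fun p =>
    ⟨((e.rootedAt p.1.2.2).entering p.1.2.1).setLabel _ _⟩

end LGraph

/-- `𝒯_n`, the set of all T-trees (up to isomorphism). -/
def tTrees (n : ℕ) : Set (Quotient (LGraph.isoSetoid n)) :=
  {q | ∃ T : LGraph n, T.IsTTree ∧ Quotient.mk _ T = q}

/-- The set of all complexity-optimal structures (up to isomorphism). -/
def optimalStructures (n : ℕ) : Set (Quotient (LDigraph.isoSetoid n)) :=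
  {q | ∃ S : LDigraph n, S.IsComplexityOptimal ∧ Quotient.mk _ S = q}

/-- The map `h`, which sends `T` to the union of the trees `D(a, x_j, T)`. -/
noncomputable def hMap (n : ℕ) : Quotient (LGraph.isoSetoid n) → Quotient (LDigraph.isoSetoid n) :=
  Quotient.map LGraph.unionD LGraph.unionD_congr

/-! Send a node to its cluster, the set of indices of the inputs below it. Clusters turn both sides
of the theorem into families of subsets of {1, …, n}.

The clusters of a structure computing y form a `LeaveOneOut` family C: nonempty proper subsets,
among them all complements of singletons, each member with two or more elements being a disjoint
union of two members (`ComputesY.leaveOneOut`). Such a family has at least 4n - 6 members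
(`LeaveOneOut.card_le_and_splitSystem`). For the induction, delete an index z from the ground set,
leaving R. The sets {z} and R are lost, and w merges with w ∪ {z} whenever both lie in C; call such
a w a sibling of z. A descent along splits from the complement of j to {z} ends at a sibling
avoiding j, so the siblings have no common element and there are at least two. Each index thus costs
at least 4 members. In the equality case the two siblings are the two halves p, q of R, and C is the
smaller family with z attached to the edge p | q. Hence C is a `SplitSystem`: closed under
complements and pairwise compatible.

As n nodes are inputs, every structure has complexity at least 3n - 6. Equality forces nodes to be
determined by their clusters, and then the structure is `ofClusters C`. Conversely each split system
yields a structure attaining the bound (`ofClusters_computesY`, `ofClusters_complexity`). Optimal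
structures are therefore the same as split systems.

So are T-trees: the two sides of all edges form a split system (`IsTTree.splitSystem`), which
determines the tree (`nonempty_iso_ofSplits`) and may be any split system (`ofSplits_splits`). Under
these correspondences h is the identity (`nonempty_unionD_iso`), because a cluster avoiding j is a
node of the tree hanging from x_j.

For the count, rooting at a leaf r turns a split system into a hierarchy on the other leaves. A new
leaf can be attached to a hierarchy with m leaves above any of its 2m - 1 clusters, which gives the
double factorial. -/

namespace SetSystem

/-! ### Hierarchies: rooted binary trees as families of leaf sets. -/

variable {α : Type*} [DecidableEq α]

/-- Every member with at least two elements is the disjoint union of two members. -/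
def Splits (C : Finset (Finset α)) : Prop :=
  ∀ c ∈ C, c.Nontrivial → ∃ a ∈ C, ∃ b ∈ C, Disjoint a b ∧ a ∪ b = c

/-- The cluster system of a rooted binary tree whose set of leaves is `R`. -/
structure Hierarchy (R : Finset α) (H : Finset (Finset α)) : Prop where
  top_mem : R ∈ H
  empty_notMem : ∅ ∉ H
  subset_top : ∀ c ∈ H, c ⊆ R
  laminar : ∀ a ∈ H, ∀ b ∈ H, a ⊆ b ∨ b ⊆ a ∨ Disjoint a b
  splits : Splits H

theorem singleton_or_nontrivial {β : Type*} {C : Finset (Finset β)} (h0 : ∅ ∉ C) {c : Finset β}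
    (hc : c ∈ C) : (∃ j, c = {j}) ∨ c.Nontrivial := by
  have : c.Nonempty := Finset.nonempty_iff_ne_empty.2 fun h => h0 (h ▸ hc)
  exact this.exists_eq_singleton_or_nontrivial

theorem Splits.singleton_mem {C : Finset (Finset α)} (h : Splits C) (h0 : ∅ ∉ C) (c : Finset α)
    (hc : c ∈ C) (j : α) (hj : j ∈ c) : {j} ∈ C := by
  induction c using Finset.strongInduction with
  | H c ih =>
    rcases singleton_or_nontrivial h0 hc with ⟨k, rfl⟩ | hn
    · grind
    · obtain ⟨a, ha, b, hb, hd, rfl⟩ := h c hc hn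
      have ha0 : a ≠ ∅ := fun h => h0 (h ▸ ha)
      have hb0 : b ≠ ∅ := fun h => h0 (h ▸ hb)
      rcases Finset.mem_union.1 hj with hj | hj
      · refine ih a ?_ ha hj
        rw [Finset.ssubset_iff_subset_ne]
        grind [Finset.disjoint_left]
      · refine ih b ?_ hb hj
        rw [Finset.ssubset_iff_subset_ne]
        grind [Finset.disjoint_left]

section Disjoint

variable {a b : Finset α}

theorem ssubset_union_of_disjoint (hd : Disjoint a b) (hb : b ≠ ∅) : a ⊂ a ∪ b := by
  rw [Finset.ssubset_iff_subset_ne]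
  grind [Finset.disjoint_left]

end Disjoint

namespace Hierarchy

variable {R : Finset α} {H : Finset (Finset α)}

theorem ne_empty (h : Hierarchy R H) {c : Finset α} (hc : c ∈ H) : c ≠ ∅ :=
  fun h' => h.empty_notMem (h' ▸ hc)

/-- The union of a cluster with its sibling is the least cluster strictly above it. -/
theorem union_subset (h : Hierarchy R H) {c e x : Finset α} (hc : c ∈ H) (he : e ∈ H)
    (hd : Disjoint c e) (hu : c ∪ e ∈ H) (hx : x ∈ H) (hcx : c ⊂ x) : c ∪ e ⊆ x := by
  have hc0 := h.ne_empty hc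
  have h1 := h.laminar _ hu _ hx
  have h2 := h.laminar _ he _ hx
  have h3 := hcx.1
  have h4 := hcx.2
  have ⟨k, hk⟩ := Finset.nonempty_iff_ne_empty.2 hc0
  rw [Finset.disjoint_left] at h1 h2 hd
  rcases h1 with h1 | h1 | h1
  · exact h1
  · rcases h2 with h2 | h2 | h2
    · grind
    · grind
    · grind
  · grind

theorem union_unique (h : Hierarchy R H) {c e e' : Finset α} (hc : c ∈ H) (he : e ∈ H)
    (he' : e' ∈ H) (hd : Disjoint c e) (hd' : Disjoint c e') (hu : c ∪ e ∈ H) (hu' : c ∪ e' ∈ H) :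
    e = e' := by
  have h1 := h.union_subset hc he hd hu hu' (ssubset_union_of_disjoint hd' (h.ne_empty he'))
  have h2 := h.union_subset hc he' hd' hu' hu (ssubset_union_of_disjoint hd (h.ne_empty he))
  have h3 := Finset.ext_iff.1 (Finset.Subset.antisymm h1 h2)
  ext k
  have := h3 k
  rw [Finset.disjoint_left] at hd hd'
  grind

/-- Were `a` strictly inside `a'`, the least cluster above `a`, which is the whole union, would fit
into `a'`, a proper part of it. -/
theorem eq_of_subset_of_union_eq (h : Hierarchy R H) {a b a' b' : Finset α} (ha : a ∈ H)
    (hb : b ∈ H) (ha' : a' ∈ H) (hb' : b' ∈ H) (hd : Disjoint a b) (hd' : Disjoint a' b')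
    (hu : a ∪ b = a' ∪ b') (huH : a ∪ b ∈ H) (haa : a ⊆ a') : a = a' := by
  by_contra hne
  have h1 := h.union_subset ha hb hd huH ha' (Finset.ssubset_iff_subset_ne.2 ⟨haa, hne⟩)
  rw [hu] at h1
  exact (ssubset_union_of_disjoint hd' (h.ne_empty hb')).2 h1

/-- The decomposition of a cluster into two clusters is unique. -/
theorem split_unique (h : Hierarchy R H) {a b a' b' : Finset α} (ha : a ∈ H) (hb : b ∈ H)
    (ha' : a' ∈ H) (hb' : b' ∈ H) (hd : Disjoint a b) (hd' : Disjoint a' b')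
    (hu : a ∪ b = a' ∪ b') (huH : a ∪ b ∈ H) : a = a' ∧ b = b' ∨ a = b' ∧ b = a' := by
  have key : a = a' ∨ a = b' := by
    rcases h.laminar _ ha _ ha' with h1 | h1 | h1
    · exact Or.inl (h.eq_of_subset_of_union_eq ha hb ha' hb' hd hd' hu huH h1)
    · exact Or.inl (h.eq_of_subset_of_union_eq ha' hb' ha hb hd' hd hu.symm (hu ▸ huH) h1).symm
    · right
      refine h.eq_of_subset_of_union_eq ha hb hb' ha' hd hd'.symm (by rw [hu, Finset.union_comm])
        huH fun k hk => ?_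
      have : k ∈ a' ∪ b' := hu ▸ Finset.mem_union_left b hk
      exact (Finset.mem_union.1 this).resolve_left (Finset.disjoint_left.1 h1 hk)
  rcases key with rfl | rfl
  · exact Or.inl ⟨rfl, h.union_unique ha hb hb' hd hd' huH (hu ▸ huH)⟩
  · exact Or.inr ⟨rfl, h.union_unique ha hb ha' hd hd'.symm huH
      (by rwa [Finset.union_comm, ← hu])⟩

theorem restrict (h : Hierarchy R H) {c : Finset α} (hc : c ∈ H) :
    Hierarchy c (H.filter (· ⊆ c)) where
  top_mem := by simp [hc]
  empty_notMem := by simp [h.empty_notMem]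
  subset_top := by simp
  laminar a ha b hb := h.laminar a (Finset.mem_filter.1 ha).1 b (Finset.mem_filter.1 hb).1
  splits d hd hn := by
    obtain ⟨a, ha, b, hb, hab, rfl⟩ := h.splits d (Finset.mem_filter.1 hd).1 hn
    grind

/-- Descend from the top along splits. By laminarity, `c` is one half of the current split or lies
strictly inside one half, so the descent stops at the parent of `c`. -/
theorem exists_sibling (h : Hierarchy R H) {c : Finset α} (hc : c ∈ H) (hcR : c ≠ R) :
    ∃ e ∈ H, Disjoint c e ∧ c ∪ e ∈ H := by
  have key : ∀ d ∈ H, c ⊂ d → ∃ e ∈ H, Disjoint c e ∧ c ∪ e ∈ H := by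
    intro d
    induction d using Finset.strongInduction with
    | H d ih =>
      intro hd hcd
      have hc0 := h.ne_empty hc
      have hn : d.Nontrivial := by
        rcases singleton_or_nontrivial h.empty_notMem hd with ⟨k, rfl⟩ | hn
        · exact absurd (Finset.ssubset_singleton_iff.1 hcd) hc0
        · exact hn
      obtain ⟨a, ha, b, hb, hab, rfl⟩ := h.splits d hd hn
      have h1 := ssubset_union_of_disjoint hab (h.ne_empty hb)
      have h2 := ssubset_union_of_disjoint hab.symm (h.ne_empty ha)
      rw [Finset.union_comm] at h2
      by_cases hca : c = a
      · subst hca; exact ⟨b, hb, hab, hd⟩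
      by_cases hcb : c = b
      · subst hcb; exact ⟨a, ha, hab.symm, by rwa [Finset.union_comm]⟩
      have h3 := h.laminar c hc a ha
      have h4 := h.laminar c hc b hb
      rcases h3 with h3 | h3 | h3
      · exact ih a h1 ha (Finset.ssubset_iff_subset_ne.2 ⟨h3, hca⟩)
      · have := h.ne_empty ha
        rcases h4 with h4 | h4 | h4
        · exact ih b h2 hb (Finset.ssubset_iff_subset_ne.2 ⟨h4, hcb⟩)
        · exact absurd (Finset.union_subset h3 h4) hcd.2
        · exfalso
          have := hcd.1
          rw [Finset.disjoint_left] at h4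
          grind
      · rcases h4 with h4 | h4 | h4
        · exact ih b h2 hb (Finset.ssubset_iff_subset_ne.2 ⟨h4, hcb⟩)
        · exfalso
          have := hcd.1
          rw [Finset.disjoint_left] at h3
          grind
        · exfalso
          have := hcd.1
          rw [Finset.disjoint_left] at h3 h4
          grind
  exact key R h.top_mem (Finset.ssubset_iff_subset_ne.2 ⟨h.subset_top c hc, hcR⟩)

/-- The number of clusters strictly above a cluster serves as its depth; this is the step from
parent to child. -/
theorem card_filter_ssubset (h : Hierarchy R H) {x e : Finset α} (hx : x ∈ H) (he : e ∈ H)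
    (hd : Disjoint x e) (hu : x ∪ e ∈ H) :
    (H.filter (x ⊂ ·)).card = (H.filter (x ∪ e ⊂ ·)).card + 1 := by
  have hlt : x ⊂ x ∪ e := ssubset_union_of_disjoint hd (h.ne_empty he)
  have h1 : H.filter (x ⊂ ·) = insert (x ∪ e) (H.filter (x ∪ e ⊂ ·)) := by
    ext z
    rw [Finset.mem_insert]
    constructor
    · intro hz'
      obtain ⟨hz, hxz⟩ := Finset.mem_filter.1 hz'
      have h2 := h.union_subset hx he hd hu hz hxz
      by_cases hyz : z = x ∪ e
      · exact Or.inl hyz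
      · exact Or.inr (Finset.mem_filter.2
          ⟨hz, Finset.ssubset_iff_subset_ne.2 ⟨h2, fun h => hyz h.symm⟩⟩)
    · rintro (rfl | hz)
      · exact Finset.mem_filter.2 ⟨hu, hlt⟩
      · obtain ⟨hz, hyz⟩ := Finset.mem_filter.1 hz
        exact Finset.mem_filter.2 ⟨hz, hlt.trans hyz⟩
  rw [h1, Finset.card_insert_of_notMem]
  exact fun h => (Finset.mem_filter.1 h).2.2 subset_rfl

/-- A binary tree with m leaves has 2m - 1 nodes: apart from the top, the clusters are those below
one half of its split and those below the other. -/
theorem card_eq (h : Hierarchy R H) : H.card + 1 = 2 * R.card := by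
  induction R using Finset.strongInduction generalizing H with
  | H R ih =>
    rcases singleton_or_nontrivial h.empty_notMem h.top_mem with ⟨j, rfl⟩ | hn
    · have : H = {{j}} := by
        ext c
        rw [Finset.mem_singleton]
        refine ⟨fun hc => ?_, fun hc => hc ▸ h.top_mem⟩
        rcases Finset.subset_singleton_iff.1 (h.subset_top c hc) with h' | h'
        · exact absurd h' (h.ne_empty hc)
        · exact h'
      simp [this]
    · obtain ⟨a, ha, b, hb, hab, rfl⟩ := h.splits R h.top_mem hn
      have h1 := ssubset_union_of_disjoint hab (h.ne_empty hb)
      have h2 := ssubset_union_of_disjoint hab.symm (h.ne_empty ha)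
      have ka := ih a h1 (h.restrict ha)
      have kb := ih b (by rwa [Finset.union_comm]) (h.restrict hb)
      have hH : H = insert (a ∪ b) (H.filter (· ⊆ a) ∪ H.filter (· ⊆ b)) := by
        ext c
        rw [Finset.mem_insert, Finset.mem_union, Finset.mem_filter, Finset.mem_filter]
        constructor
        · intro hc
          by_cases hcR : c = a ∪ b
          · exact Or.inl hcR
          obtain ⟨e, he, hd, hu⟩ := h.exists_sibling hc hcR
          have h3 := h.laminar c hc a ha
          have h4 := h.laminar c hc b hb
          have hcs := h.subset_top c hc
          have hc0 := Finset.nonempty_iff_ne_empty.2 (h.ne_empty hc)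
          obtain ⟨k, hk⟩ := hc0
          by_contra hcon
          have hna : ¬ c ⊆ a := by tauto
          have hnb : ¬ c ⊆ b := by tauto
          rw [Finset.disjoint_left] at h3 h4
          rcases h3 with h3 | h3 | h3 <;> rcases h4 with h4 | h4 | h4 <;> grind
        · rintro (rfl | hc | hc)
          exacts [h.top_mem, hc.1, hc.1]
      have hdis : Disjoint (H.filter (· ⊆ a)) (H.filter (· ⊆ b)) := by
        rw [Finset.disjoint_left]
        intro c hc hc'
        rw [Finset.mem_filter] at hc hc'
        have hc0 := Finset.nonempty_iff_ne_empty.2 (h.ne_empty hc.1)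
        obtain ⟨k, hk⟩ := hc0
        exact Finset.disjoint_left.1 hab (hc.2 hk) (hc'.2 hk)
      have hnot : a ∪ b ∉ H.filter (· ⊆ a) ∪ H.filter (· ⊆ b) := by
        rw [Finset.mem_union, Finset.mem_filter, Finset.mem_filter]
        rintro (h' | h')
        · exact h1.2 h'.2
        · rw [Finset.union_comm] at h'; exact h2.2 h'.2
      rw [hH, Finset.card_insert_of_notMem hnot, Finset.card_union_of_disjoint hdis,
        Finset.card_union_of_disjoint hab]
      omega

end Hierarchy

end SetSystem

/-! ### Attaching and removing a leaf; the number of hierarchies. -/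

namespace SetSystem

variable {α : Type*} [DecidableEq α]

/-- Attach a new leaf `z` to the edge above the cluster `w`. -/
def attach (z : α) (H : Finset (Finset α)) (w : Finset α) : Finset (Finset α) :=
  insert {z} (H.filter (¬ w ⊂ ·) ∪ (H.filter (w ⊆ ·)).image (insert z))

/-- Remove the leaf `z`. -/
def detach (z : α) (K : Finset (Finset α)) : Finset (Finset α) :=
  (K.image (·.erase z)).erase ∅

theorem mem_attach {z : α} {H : Finset (Finset α)} {w c : Finset α} :
    c ∈ attach z H w ↔ c = {z} ∨ (c ∈ H ∧ ¬ w ⊂ c) ∨ ∃ d ∈ H, w ⊆ d ∧ insert z d = c := by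
  simp [attach, and_assoc]

theorem mem_detach {z : α} {K : Finset (Finset α)} {c : Finset α} :
    c ∈ detach z K ↔ c ≠ ∅ ∧ ∃ d ∈ K, d.erase z = c := by
  simp [detach]

namespace Hierarchy

variable {R : Finset α} {H : Finset (Finset α)} {z : α}

theorem notMem_of_notMem (h : Hierarchy R H) (hz : z ∉ R) {c : Finset α} (hc : c ∈ H) : z ∉ c :=
  fun h' => hz (h.subset_top c hc h')

theorem singleton_mem (h : Hierarchy R H) {j : α} (hj : j ∈ R) : {j} ∈ H :=
  h.splits.singleton_mem h.empty_notMem R h.top_mem j hj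

/-- The edge above `w` is subdivided. The cluster `w` survives unchanged and also yields `insert z
w`, whose halves are `{z}` and `w`; clusters strictly above `w` occur only with `z` added. -/
theorem attach (h : Hierarchy R H) (hz : z ∉ R) {w : Finset α} (hw : w ∈ H) :
    Hierarchy (insert z R) (attach z H w) where
  top_mem := mem_attach.2 (Or.inr (Or.inr ⟨R, h.top_mem, h.subset_top w hw, rfl⟩))
  empty_notMem h' := by
    rcases mem_attach.1 h' with h' | ⟨h', -⟩ | ⟨d, -, -, h'⟩
    · exact (Finset.singleton_ne_empty z) h'.symm
    · exact h.empty_notMem h'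
    · exact Finset.insert_ne_empty _ _ h'
  subset_top c hc := by
    rcases mem_attach.1 hc with rfl | ⟨h', -⟩ | ⟨d, hd, -, rfl⟩
    · simp
    · exact (h.subset_top c h').trans (Finset.subset_insert z R)
    · exact Finset.insert_subset_insert z (h.subset_top d hd)
  laminar a ha b hb := by
    have key : ∀ a ∈ H, ¬ w ⊂ a → ∀ b ∈ H, w ⊆ b →
        (a ⊆ insert z b ∨ Disjoint a (insert z b)) := by
      intro a ha hwa b hb hwb
      have hza := h.notMem_of_notMem hz ha
      rcases h.laminar a ha b hb with h1 | h1 | h1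
      · exact Or.inl (h1.trans (Finset.subset_insert z b))
      · left
        have : w = a := by
          by_contra hne
          exact hwa (Finset.ssubset_iff_subset_ne.2 ⟨hwb.trans h1, hne⟩)
        rw [← this]
        exact hwb.trans (Finset.subset_insert z b)
      · right
        rw [Finset.disjoint_insert_right]
        exact ⟨hza, h1⟩
    rcases mem_attach.1 ha with rfl | ⟨ha', hwa⟩ | ⟨a, ha', hwa, rfl⟩ <;>
      rcases mem_attach.1 hb with rfl | ⟨hb', hwb⟩ | ⟨b, hb', hwb, rfl⟩
    · simp
    · simp [h.notMem_of_notMem hz hb']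
    · simp
    · simp [h.notMem_of_notMem hz ha']
    · exact h.laminar a ha' b hb'
    · have := key a ha' hwa b hb' hwb; tauto
    · simp
    · have := key b hb' hwb a ha' hwa
      rw [disjoint_comm] at this
      tauto
    · rcases h.laminar a ha' b hb' with h1 | h1 | h1
      · exact Or.inl (Finset.insert_subset_insert z h1)
      · exact Or.inr (Or.inl (Finset.insert_subset_insert z h1))
      · exact absurd (Finset.subset_empty.1 (h1 hwa hwb)) (h.ne_empty hw)
  splits c hc hn := by
    have hwz := h.notMem_of_notMem hz hw
    rcases mem_attach.1 hc with rfl | ⟨h', hwc⟩ | ⟨d, hd, hwd, rfl⟩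
    · simp at hn
    · obtain ⟨a, ha, b, hb, hab, rfl⟩ := h.splits c h' hn
      refine ⟨a, mem_attach.2 (Or.inr (Or.inl ⟨ha, fun h1 => hwc ?_⟩)), b,
        mem_attach.2 (Or.inr (Or.inl ⟨hb, fun h1 => hwc ?_⟩)), hab, rfl⟩
      · exact h1.trans_subset Finset.subset_union_left
      · exact h1.trans_subset Finset.subset_union_right
    · by_cases hwd' : w = d
      · subst hwd'
        refine ⟨{z}, mem_attach.2 (Or.inl rfl), w, mem_attach.2 (Or.inr (Or.inl ⟨hw, ?_⟩)), ?_, ?_⟩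
        · exact fun h' => h'.2 subset_rfl
        · simpa using hwz
        · simp
      · have hdn : d.Nontrivial := by
          rcases singleton_or_nontrivial h.empty_notMem hd with ⟨k, rfl⟩ | hn
          · rcases Finset.subset_singleton_iff.1 hwd with h1 | h1
            · exact absurd h1 (h.ne_empty hw)
            · exact absurd h1 hwd'
          · exact hn
        have key : ∀ a ∈ H, ∀ b ∈ H, Disjoint a b → a ∪ b = d → w ⊆ a →
            ∃ a' ∈ SetSystem.attach z H w, ∃ b' ∈ SetSystem.attach z H w,
              Disjoint a' b' ∧ a' ∪ b' = insert z d := by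
          rintro a ha b hb hab rfl hwa
          refine ⟨insert z a, mem_attach.2 (Or.inr (Or.inr ⟨a, ha, hwa, rfl⟩)), b,
            mem_attach.2 (Or.inr (Or.inl ⟨hb, fun h1 => ?_⟩)), ?_, by simp⟩
          · exact h.ne_empty hw (Finset.subset_empty.1 (hab hwa h1.1))
          · rw [Finset.disjoint_insert_left]
            exact ⟨h.notMem_of_notMem hz hb, hab⟩
        obtain ⟨a, ha, b, hb, hab, hu⟩ := h.splits d hd hdn
        -- A proper subcluster `w` of `d` lies in one half of `d`; that half receives `z` and the
        -- other stays as it is.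
        have hsub : w ⊆ a ∨ w ⊆ b := by
          subst hu
          rcases h.laminar w hw a ha with h1 | h1 | h1
          · exact Or.inl h1
          · by_cases hwa : a = w
            · exact Or.inl hwa.ge
            exact absurd (Finset.Subset.antisymm hwd (h.union_subset ha hb hab hd hw
              (Finset.ssubset_iff_subset_ne.2 ⟨h1, hwa⟩))) hwd'
          · right
            intro k hk
            exact (Finset.mem_union.1 (hwd hk)).resolve_left (Finset.disjoint_left.1 h1 hk)
        rcases hsub with h1 | h1
        · exact key a ha b hb hab hu h1
        · exact key b hb a ha hab.symm (by rw [Finset.union_comm, hu]) h1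

theorem detach_attach (h : Hierarchy R H) (hz : z ∉ R) {w : Finset α} :
    detach z (SetSystem.attach z H w) = H := by
  ext c
  rw [mem_detach]
  constructor
  · rintro ⟨hc0, d, hd, rfl⟩
    rcases mem_attach.1 hd with rfl | ⟨h', -⟩ | ⟨e, he, -, rfl⟩
    · simp at hc0
    · rwa [Finset.erase_eq_of_notMem (h.notMem_of_notMem hz h')]
    · rwa [Finset.erase_insert (h.notMem_of_notMem hz he)]
  · intro hc
    refine ⟨h.ne_empty hc, ?_⟩
    have hzc := h.notMem_of_notMem hz hc
    by_cases hwc : w ⊂ c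
    · exact ⟨insert z c, mem_attach.2 (Or.inr (Or.inr ⟨c, hc, hwc.1, rfl⟩)),
        Finset.erase_insert hzc⟩
    · exact ⟨c, mem_attach.2 (Or.inr (Or.inl ⟨hc, hwc⟩)), Finset.erase_eq_of_notMem hzc⟩

/-- The cluster `w` is recovered as the unique sibling of `{z}`. -/
theorem attach_injective (h : Hierarchy R H) (hz : z ∉ R) {w w' : Finset α} (hw : w ∈ H)
    (hw' : w' ∈ H) (heq : SetSystem.attach z H w = SetSystem.attach z H w') : w = w' := by
  have hK := h.attach hz hw
  have hz' : ({z} : Finset α) ∈ SetSystem.attach z H w := mem_attach.2 (Or.inl rfl)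
  have key : ∀ v ∈ H, v ∈ SetSystem.attach z H v ∧ {z} ∪ v ∈ SetSystem.attach z H v :=
    fun v hv => ⟨mem_attach.2 (Or.inr (Or.inl ⟨hv, fun h' => h'.2 subset_rfl⟩)),
      mem_attach.2 (Or.inr (Or.inr ⟨v, hv, subset_rfl, rfl⟩))⟩
  have h1 := key w hw
  have h2 := key w' hw'
  rw [← heq] at h2
  exact hK.union_unique hz' h1.1 h2.1
    (by simpa using h.notMem_of_notMem hz hw) (by simpa using h.notMem_of_notMem hz hw') h1.2 h2.2

variable {K : Finset (Finset α)}

theorem detach (h : Hierarchy (insert z R) K) (hz : z ∉ R) (hR : R.Nonempty) :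
    Hierarchy R (detach z K) where
  top_mem := mem_detach.2 ⟨hR.ne_empty, _, h.top_mem, Finset.erase_insert hz⟩
  empty_notMem h' := (mem_detach.1 h').1 rfl
  subset_top c hc := by
    obtain ⟨-, d, hd, rfl⟩ := mem_detach.1 hc
    have := Finset.erase_subset_erase z (h.subset_top d hd)
    rwa [Finset.erase_insert hz] at this
  laminar a ha b hb := by
    obtain ⟨-, a, ha', rfl⟩ := mem_detach.1 ha
    obtain ⟨-, b, hb', rfl⟩ := mem_detach.1 hb
    rcases h.laminar a ha' b hb' with h1 | h1 | h1
    · exact Or.inl (Finset.erase_subset_erase z h1)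
    · exact Or.inr (Or.inl (Finset.erase_subset_erase z h1))
    · exact Or.inr (Or.inr (h1.mono (Finset.erase_subset _ _) (Finset.erase_subset _ _)))
  splits c hc hn := by
    obtain ⟨-, d, hd, rfl⟩ := mem_detach.1 hc
    clear hc
    induction d using Finset.strongInduction with
    | H d ih =>
      obtain ⟨a, ha, b, hb, hab, rfl⟩ := h.splits d hd (hn.mono (Finset.erase_subset _ _))
      have h1 := ssubset_union_of_disjoint hab (h.ne_empty hb)
      have h2 := ssubset_union_of_disjoint hab.symm (h.ne_empty ha)
      rw [Finset.union_comm] at h2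
      have hu : (a ∪ b).erase z = a.erase z ∪ b.erase z := Finset.erase_union_distrib a b z
      -- If one half is `{z}`, erasing `z` leaves just the other half, and the split is sought
      -- further down.
      by_cases ha0 : a.erase z = ∅
      · have : (a ∪ b).erase z = b.erase z := by rw [hu, ha0, Finset.empty_union]
        rw [this] at hn ⊢
        exact ih b h2 hb hn
      by_cases hb0 : b.erase z = ∅
      · have : (a ∪ b).erase z = a.erase z := by rw [hu, hb0, Finset.union_empty]
        rw [this] at hn ⊢
        exact ih a h1 ha hn
      exact ⟨_, mem_detach.2 ⟨ha0, a, ha, rfl⟩, _, mem_detach.2 ⟨hb0, b, hb, rfl⟩,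
        hab.mono (Finset.erase_subset _ _) (Finset.erase_subset _ _), hu.symm⟩

/-- Take for `w` the sibling of `{z}`. Clusters containing `z`, other than `{z}`, contain `insert z
w`, and clusters without `z` are never strictly above `w`; so the position relative to `w` tells
whether `z` must be put back. -/
theorem exists_attach (h : Hierarchy (insert z R) K) (hz : z ∉ R) (hR : R.Nonempty) :
    ∃ w ∈ SetSystem.detach z K, SetSystem.attach z (SetSystem.detach z K) w = K := by
  have hzK : {z} ∈ K := h.singleton_mem (Finset.mem_insert_self z R)
  have hne : {z} ≠ insert z R := by
    obtain ⟨j, hj⟩ := hR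
    intro h'
    have : j ∈ ({z} : Finset α) := h' ▸ Finset.mem_insert_of_mem hj
    rw [Finset.mem_singleton] at this
    exact hz (this ▸ hj)
  obtain ⟨w, hw, hzw, hu⟩ := h.exists_sibling hzK hne
  have hzw' : z ∉ w := by simpa using hzw
  have hwd : w ∈ SetSystem.detach z K :=
    mem_detach.2 ⟨h.ne_empty hw, w, hw, Finset.erase_eq_of_notMem hzw'⟩
  have hdet := h.detach hz hR
  have hu' : insert z w ∈ K := hu
  have key : ∀ c ∈ K, z ∈ c → c ≠ {z} → insert z w ⊆ c := by
    intro c hc hzc hcz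
    exact h.union_subset hzK hw hzw hu hc (Finset.ssubset_iff_subset_ne.2 ⟨by simpa, hcz.symm⟩)
  have key2 : ∀ c ∈ K, z ∉ c → ¬ w ⊂ c := by
    intro c hc hzc hwc
    have := h.union_subset hw hzK hzw.symm (by rwa [Finset.union_comm]) hc hwc
    exact hzc (this (by simp))
  refine ⟨w, hwd, ?_⟩
  ext c
  rw [mem_attach]
  constructor
  · rintro (rfl | ⟨hc, hwc⟩ | ⟨d, hd, hwd, rfl⟩)
    · exact hzK
    · obtain ⟨hc0, d, hd, rfl⟩ := mem_detach.1 hc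
      by_cases hzd : z ∈ d
      · have hdz : d ≠ {z} := by rintro rfl; simp at hc0
        have h1 := key d hd hzd hdz
        have h2 : w ⊆ d.erase z := by
          rw [← Finset.erase_insert hzw']
          exact Finset.erase_subset_erase z h1
        have h3 : w = d.erase z := by
          by_contra hne
          exact hwc (Finset.ssubset_iff_subset_ne.2 ⟨h2, hne⟩)
        rwa [← h3]
      · rwa [Finset.erase_eq_of_notMem hzd]
    · obtain ⟨hc0, e, he, rfl⟩ := mem_detach.1 hd
      by_cases hze : z ∈ e
      · rwa [Finset.insert_erase hze]
      · rw [Finset.erase_eq_of_notMem hze] at hwd ⊢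
        have : w = e := by
          by_contra hne
          exact key2 e he hze (Finset.ssubset_iff_subset_ne.2 ⟨hwd, hne⟩)
        rwa [← this]
  · intro hc
    by_cases hzc : z ∈ c
    · by_cases hcz : c = {z}
      · exact Or.inl hcz
      right; right
      have h1 := key c hc hzc hcz
      have h2 : w ⊆ c.erase z := by
        rw [← Finset.erase_insert hzw']
        exact Finset.erase_subset_erase z h1
      refine ⟨c.erase z, mem_detach.2 ⟨?_, c, hc, rfl⟩, h2, Finset.insert_erase hzc⟩
      intro h0
      rw [h0] at h2
      exact h.ne_empty hw (Finset.subset_empty.1 h2)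
    · right; left
      exact ⟨mem_detach.2 ⟨h.ne_empty hc, c, hc, Finset.erase_eq_of_notMem hzc⟩, key2 c hc hzc⟩

end Hierarchy

/-- The set of all hierarchies with set of leaves `R`. -/
noncomputable def hierarchies (R : Finset α) : Finset (Finset (Finset α)) :=
  @Finset.filter _ (Hierarchy R) (Classical.decPred _) R.powerset.powerset

theorem mem_hierarchies {R : Finset α} {H : Finset (Finset α)} :
    H ∈ hierarchies R ↔ Hierarchy R H := by
  refine (@Finset.mem_filter _ _ (Classical.decPred _) _ _).trans (and_iff_right_of_imp fun h => ?_)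
  rw [Finset.mem_powerset]
  exact fun c hc => Finset.mem_powerset.2 (h.subset_top c hc)

/-- Hierarchies with the extra leaf correspond, through `attach`, to pairs of a hierarchy on `R` and
one of its `2 * R.card - 1` clusters. -/
theorem card_hierarchies_insert {R : Finset α} {z : α} (hz : z ∉ R) (hR : R.Nonempty) :
    (hierarchies (insert z R)).card = (2 * R.card - 1) * (hierarchies R).card := by
  have h1 : (hierarchies (insert z R)).card = ((hierarchies R).sigma fun H => H).card := by
    symm
    refine Finset.card_bij (fun p _ => attach z p.1 p.2) ?_ ?_ ?_
    · rintro ⟨H, w⟩ hp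
      rw [Finset.mem_sigma, mem_hierarchies] at hp
      exact mem_hierarchies.2 (hp.1.attach hz hp.2)
    · rintro ⟨H, w⟩ hp ⟨H', w'⟩ hp' heq
      rw [Finset.mem_sigma, mem_hierarchies] at hp hp'
      dsimp only at hp hp' heq
      have hH : H = H' := by
        rw [← hp.1.detach_attach (w := w) hz, heq, hp'.1.detach_attach hz]
      subst hH
      rw [hp.1.attach_injective hz hp.2 hp'.2 heq]
    · intro K hK
      rw [mem_hierarchies] at hK
      obtain ⟨w, hw, heq⟩ := hK.exists_attach hz hR
      exact ⟨⟨detach z K, w⟩, Finset.mem_sigma.2 ⟨mem_hierarchies.2 (hK.detach hz hR), hw⟩, heq⟩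
  rw [h1, Finset.card_sigma, Finset.sum_const_nat (m := 2 * R.card - 1), mul_comm]
  intro H hH
  have := (mem_hierarchies.1 hH).card_eq
  omega

theorem card_hierarchies {R : Finset α} (hR : R.Nonempty) :
    (hierarchies R).card = (2 * R.card - 3)‼ := by
  induction hR using Finset.Nonempty.cons_induction with
  | singleton a =>
    -- The subtraction truncates to 0, and 0‼ = 1.
    rw [Finset.card_singleton, show (2 * 1 - 3)‼ = 1 from rfl, Finset.card_eq_one]
    refine ⟨{{a}}, ?_⟩
    ext H
    rw [mem_hierarchies, Finset.mem_singleton]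
    constructor
    · intro h
      ext c
      rw [Finset.mem_singleton]
      refine ⟨fun hc => ?_, fun hc => hc ▸ h.top_mem⟩
      exact (Finset.subset_singleton_iff.1 (h.subset_top c hc)).resolve_left (h.ne_empty hc)
    · rintro rfl
      refine ⟨by simp, by simp, by simp, by simp, fun c hc hn => ?_⟩
      rw [Finset.mem_singleton] at hc
      subst hc
      simp at hn
  | cons a s ha hs ih =>
    rw [Finset.cons_eq_insert, card_hierarchies_insert ha hs, ih, Finset.card_insert_of_notMem ha]
    have := hs.card_pos
    -- For one leaf the truncated argument breaks the recursion of the double factorial in steps of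
    -- two, so this case is evaluated directly.
    obtain h1 | h1 : s.card = 1 ∨ 2 ≤ s.card := by omega
    · rw [h1]; rfl
    · obtain ⟨k, hk⟩ : ∃ k, s.card = k + 2 := ⟨s.card - 2, by omega⟩
      rw [hk, show 2 * (k + 2 + 1) - 3 = (2 * (k + 2) - 3) + 2 by omega,
        Nat.doubleFactorial_add_two]
      rfl

end SetSystem

/-! ### Leave-one-out systems and the cost of one index. -/

namespace SetSystem

variable {α : Type*} [DecidableEq α]

/-- A system of proper nonempty subsets of `R`, each of which can be split down to singletons,
which contains every set `R \ {j}`. -/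
structure LeaveOneOut (R : Finset α) (C : Finset (Finset α)) : Prop where
  ssubset_top : ∀ c ∈ C, c ⊂ R
  empty_notMem : ∅ ∉ C
  erase_mem : ∀ j ∈ R, R.erase j ∈ C
  splits : Splits C

/-- The system of both sides of all edges of an unrooted binary tree with set of leaves `R`. -/
structure SplitSystem (R : Finset α) (C : Finset (Finset α)) : Prop extends LeaveOneOut R C where
  sdiff_mem : ∀ c ∈ C, R \ c ∈ C
  compatible : ∀ a ∈ C, ∀ b ∈ C, a ⊆ b ∨ b ⊆ a ∨ Disjoint a b ∨ a ∪ b = R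

namespace LeaveOneOut

variable {R : Finset α} {C : Finset (Finset α)} {z : α}

theorem nonempty (h : LeaveOneOut R C) {c : Finset α} (hc : c ∈ C) : c.Nonempty :=
  Finset.nonempty_iff_ne_empty.2 fun h' => h.empty_notMem (h' ▸ hc)

theorem singleton_mem (h : LeaveOneOut R C) (hR : 2 ≤ R.card) {j : α} (hj : j ∈ R) :
    {j} ∈ C := by
  obtain ⟨k, hk, hkj⟩ := Finset.exists_mem_ne hR j
  exact h.splits.singleton_mem h.empty_notMem _ (h.erase_mem k hk) j
    (Finset.mem_erase.2 ⟨hkj.symm, hj⟩)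

/-- The system on `R` obtained by removing the leaf `z`. -/
theorem detach (h : LeaveOneOut (insert z R) C) (hz : z ∉ R) (hR : 2 ≤ R.card) :
    LeaveOneOut R ((detach z C).erase R) where
  ssubset_top c hc := by
    obtain ⟨hcR, hc⟩ := Finset.mem_erase.1 hc
    obtain ⟨-, d, hd, rfl⟩ := mem_detach.1 hc
    have := Finset.erase_subset_erase z (h.ssubset_top d hd).1
    rw [Finset.erase_insert hz] at this
    exact Finset.ssubset_iff_subset_ne.2 ⟨this, hcR⟩
  empty_notMem hc := (mem_detach.1 (Finset.mem_erase.1 hc).2).1 rfl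
  erase_mem j hj := by
    obtain ⟨k, hk, hkj⟩ := Finset.exists_mem_ne hR j
    have hjz : j ≠ z := fun h' => hz (h' ▸ hj)
    refine Finset.mem_erase.2 ⟨fun h' => ?_, mem_detach.2 ⟨?_, _,
      h.erase_mem j (Finset.mem_insert_of_mem hj), ?_⟩⟩
    · exact Finset.erase_eq_self.1 h' hj
    · exact Finset.ne_empty_of_mem (Finset.mem_erase.2 ⟨hkj, hk⟩)
    · rw [Finset.erase_right_comm, Finset.erase_insert hz]
  splits c hc hn := by
    obtain ⟨hcR, hc'⟩ := Finset.mem_erase.1 hc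
    obtain ⟨-, d, hd, rfl⟩ := mem_detach.1 hc'
    clear hc hc'
    have hdR : d.erase z ⊂ R := by
      have := Finset.erase_subset_erase z (h.ssubset_top d hd).1
      rw [Finset.erase_insert hz] at this
      exact Finset.ssubset_iff_subset_ne.2 ⟨this, hcR⟩
    clear hcR
    induction d using Finset.strongInduction with
    | H d ih =>
      obtain ⟨a, ha, b, hb, hab, rfl⟩ := h.splits d hd (hn.mono (Finset.erase_subset _ _))
      have h1 := ssubset_union_of_disjoint hab (h.nonempty hb).ne_empty
      have h2 := ssubset_union_of_disjoint hab.symm (h.nonempty ha).ne_empty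
      rw [Finset.union_comm] at h2
      have hu : (a ∪ b).erase z = a.erase z ∪ b.erase z := Finset.erase_union_distrib a b z
      by_cases ha0 : a.erase z = ∅
      · have : (a ∪ b).erase z = b.erase z := by rw [hu, ha0, Finset.empty_union]
        rw [this] at hn hdR ⊢
        exact ih b h2 hb hn hdR
      by_cases hb0 : b.erase z = ∅
      · have : (a ∪ b).erase z = a.erase z := by rw [hu, hb0, Finset.union_empty]
        rw [this] at hn hdR ⊢
        exact ih a h1 ha hn hdR
      -- Neither half can be the removed set `R`, since their union is a proper subset of `R`.
      have haR : a.erase z ≠ R := by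
        rintro h'
        rw [hu, h'] at hdR
        exact hdR.2 Finset.subset_union_left
      have hbR : b.erase z ≠ R := by
        rintro h'
        rw [hu, h'] at hdR
        exact hdR.2 Finset.subset_union_right
      exact ⟨_, Finset.mem_erase.2 ⟨haR, mem_detach.2 ⟨ha0, a, ha, rfl⟩⟩, _,
        Finset.mem_erase.2 ⟨hbR, mem_detach.2 ⟨hb0, b, hb, rfl⟩⟩,
        hab.mono (Finset.erase_subset _ _) (Finset.erase_subset _ _), hu.symm⟩

end LeaveOneOut

/-- The siblings of the leaf `z`. -/
def siblings (z : α) (C : Finset (Finset α)) : Finset (Finset α) :=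
  C.filter fun w => z ∉ w ∧ insert z w ∈ C

theorem mem_siblings {z : α} {C : Finset (Finset α)} {w : Finset α} :
    w ∈ siblings z C ↔ w ∈ C ∧ z ∉ w ∧ insert z w ∈ C := by
  simp [siblings]

namespace LeaveOneOut

variable {R : Finset α} {C : Finset (Finset α)} {z : α}

theorem top_mem (h : LeaveOneOut (insert z R) C) (hz : z ∉ R) : R ∈ C := by
  have := h.erase_mem z (Finset.mem_insert_self z R)
  rwa [Finset.erase_insert hz] at this

/-- Inclusion–exclusion for the members without `z` and the members with `z`, after `z` has been
erased from the latter. The two families meet in the siblings of `z`; their union is the smaller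
system together with `R` and with `∅`, which comes from `{z}`. -/
theorem card_eq (h : LeaveOneOut (insert z R) C) (hz : z ∉ R) (hR : 2 ≤ R.card) :
    C.card = ((SetSystem.detach z C).erase R).card + 2 + (siblings z C).card := by
  have hR0 : R ≠ ∅ := by rintro rfl; simp at hR
  have hzC : {z} ∈ C := h.singleton_mem (by rw [Finset.card_insert_of_notMem hz]; omega)
    (Finset.mem_insert_self z R)
  have h1 := Finset.card_union_add_card_inter (C.filter (z ∉ ·))
    ((C.filter (z ∈ ·)).image (·.erase z))
  have h2 : ((C.filter (z ∈ ·)).image (·.erase z)).card = (C.filter (z ∈ ·)).card := by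
    refine Finset.card_image_of_injOn fun a ha b hb hab => ?_
    have ha := (Finset.mem_filter.1 ha).2
    have hb := (Finset.mem_filter.1 hb).2
    rw [← Finset.insert_erase ha, ← Finset.insert_erase hb, show a.erase z = b.erase z from hab]
  have h3 := Finset.card_filter_add_card_filter_not (s := C) (z ∈ ·)
  have h4 : C.filter (z ∉ ·) ∩ (C.filter (z ∈ ·)).image (·.erase z) = siblings z C := by
    ext w
    simp only [Finset.mem_inter, Finset.mem_filter, Finset.mem_image, mem_siblings]
    constructor
    · rintro ⟨⟨hw, hzw⟩, d, ⟨hd, hzd⟩, rfl⟩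
      exact ⟨hw, hzw, by rwa [Finset.insert_erase hzd]⟩
    · rintro ⟨hw, hzw, hi⟩
      exact ⟨⟨hw, hzw⟩, _, ⟨hi, Finset.mem_insert_self z w⟩, Finset.erase_insert hzw⟩
  have h5 : C.filter (z ∉ ·) ∪ (C.filter (z ∈ ·)).image (·.erase z) =
      insert R (insert ∅ ((SetSystem.detach z C).erase R)) := by
    ext w
    simp only [Finset.mem_union, Finset.mem_filter, Finset.mem_image, Finset.mem_insert,
      Finset.mem_erase, mem_detach]
    constructor
    · rintro (⟨hw, hzw⟩ | ⟨d, ⟨hd, hzd⟩, rfl⟩)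
      · by_cases hwR : w = R
        · exact Or.inl hwR
        · exact Or.inr (Or.inr ⟨hwR, (h.nonempty hw).ne_empty, w, hw,
            Finset.erase_eq_of_notMem hzw⟩)
      · by_cases hwR : d.erase z = R
        · exact Or.inl hwR
        by_cases hw0 : d.erase z = ∅
        · exact Or.inr (Or.inl hw0)
        · exact Or.inr (Or.inr ⟨hwR, hw0, d, hd, rfl⟩)
    · rintro (rfl | rfl | ⟨hwR, hw0, d, hd, rfl⟩)
      · exact Or.inl ⟨h.top_mem hz, hz⟩
      · exact Or.inr ⟨{z}, ⟨hzC, by simp⟩, by simp⟩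
      · by_cases hzd : z ∈ d
        · exact Or.inr ⟨d, ⟨hd, hzd⟩, rfl⟩
        · rw [Finset.erase_eq_of_notMem hzd]
          exact Or.inl ⟨hd, hzd⟩
  have h6 : ∅ ∉ (SetSystem.detach z C).erase R := fun hc =>
    (mem_detach.1 (Finset.mem_erase.1 hc).2).1 rfl
  have h7 : R ∉ insert ∅ ((SetSystem.detach z C).erase R) := by
    simp [hR0]
  rw [h5, h4, h2, Finset.card_insert_of_notMem h7, Finset.card_insert_of_notMem h6] at h1
  omega

/-- Always pass to the half containing `z`: the last split before reaching `{z}` has a sibling of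
`z` as its other half. -/
theorem exists_sibling_subset (h : LeaveOneOut R C) {c : Finset α} (hc : c ∈ C) (hzc : z ∈ c)
    (hcz : c ≠ {z}) : ∃ w ∈ siblings z C, insert z w ⊆ c := by
  induction c using Finset.strongInduction with
  | H c ih =>
    have hn := (singleton_or_nontrivial h.empty_notMem hc).resolve_left (by
      rintro ⟨j, rfl⟩
      rw [Finset.mem_singleton] at hzc
      exact hcz (by rw [hzc]))
    have key : ∀ a ∈ C, ∀ b ∈ C, Disjoint a b → a ∪ b = c → z ∈ a →
        ∃ w ∈ siblings z C, insert z w ⊆ c := by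
      rintro a ha b hb hab rfl hza
      by_cases haz : a = {z}
      · subst haz
        exact ⟨b, mem_siblings.2 ⟨hb, by simpa using hab, hc⟩, subset_rfl⟩
      · obtain ⟨w, hw, hwa⟩ := ih a (ssubset_union_of_disjoint hab (h.nonempty hb).ne_empty) ha
          hza haz
        exact ⟨w, hw, hwa.trans Finset.subset_union_left⟩
    obtain ⟨a, ha, b, hb, hab, hu⟩ := h.splits c hc hn
    rcases Finset.mem_union.1 (hu ▸ hzc) with hza | hzb
    · exact key a ha b hb hab hu hza
    · exact key b hb a ha hab.symm (by rw [Finset.union_comm, hu]) hzb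

/-- The descent starts at the complement of `j`. This is how the complements of singletons enter the
lower bound. -/
theorem exists_sibling_notMem (h : LeaveOneOut (insert z R) C) (hz : z ∉ R) (hR : 2 ≤ R.card)
    {j : α} (hj : j ∈ R) : ∃ w ∈ siblings z C, j ∉ w := by
  obtain ⟨k, hk, hkj⟩ := Finset.exists_mem_ne hR j
  have hjz : j ≠ z := fun h' => hz (h' ▸ hj)
  have hkz : k ≠ z := fun h' => hz (h' ▸ hk)
  obtain ⟨w, hw, hs⟩ := h.exists_sibling_subset (z := z)
    (h.erase_mem j (Finset.mem_insert_of_mem hj)) (by simp [hjz.symm]) (fun h' => by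
      have : k ∈ (insert z R).erase j := by simp [hk, hkj]
      rw [h', Finset.mem_singleton] at this
      exact hkz this)
  exact ⟨w, hw, fun hjw => by simpa using hs (Finset.mem_insert_of_mem hjw)⟩

theorem sibling_subset (h : LeaveOneOut (insert z R) C) {w : Finset α} (hw : w ∈ siblings z C) :
    w ⊆ R := by
  obtain ⟨hw, hzw, -⟩ := mem_siblings.1 hw
  exact fun k hk => (Finset.mem_insert.1 ((h.ssubset_top w hw).1 hk)).resolve_left
    fun h' => hzw (h' ▸ hk)

/-- Siblings are nonempty, yet every element is missed by one of them. -/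
theorem two_le_card_siblings (h : LeaveOneOut (insert z R) C) (hz : z ∉ R) (hR : 2 ≤ R.card) :
    2 ≤ (siblings z C).card := by
  obtain ⟨j, hj⟩ : R.Nonempty := Finset.card_pos.1 (by omega)
  obtain ⟨w, hw, hjw⟩ := h.exists_sibling_notMem hz hR hj
  obtain ⟨k, hk⟩ := h.nonempty (mem_siblings.1 hw).1
  obtain ⟨w', hw', hkw'⟩ := h.exists_sibling_notMem hz hR (h.sibling_subset hw hk)
  exact Finset.one_lt_card.2 ⟨w, hw, w', hw', fun h' => hkw' (h' ▸ hk)⟩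

/-- If the system without `z` is compatible, descending to `z` along clusters which contain a
cluster `p` leads to a sibling of `z` which is above `p` or disjoint from it. -/
theorem exists_sibling_of_subset (h : LeaveOneOut (insert z R) C) (hz : z ∉ R)
    (hS : SplitSystem R ((SetSystem.detach z C).erase R)) {p c : Finset α}
    (hp : p ∈ (SetSystem.detach z C).erase R) (hpC : insert z p ∉ C) (hc : c ∈ C) (hzc : z ∈ c)
    (hpc : p ⊆ c) : ∃ w ∈ siblings z C, insert z w ⊆ c ∧ (p ⊆ w ∨ Disjoint w p) := by
  have hp0 := hS.nonempty hp
  have hzp : z ∉ p := fun h' => hz ((hS.ssubset_top p hp).1 h')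
  induction c using Finset.strongInduction with
  | H c ih =>
    -- The witness `j` outside `c` excludes every case in which clusters inside `c` would cover `R`.
    obtain ⟨j, hjR, hjc⟩ : ∃ j ∈ R, j ∉ c := by
      obtain ⟨j, hj, hjc⟩ := Finset.exists_of_ssubset (h.ssubset_top c hc)
      exact ⟨j, (Finset.mem_insert.1 hj).resolve_left fun h' => hjc (h' ▸ hzc), hjc⟩
    have hn := (singleton_or_nontrivial h.empty_notMem hc).resolve_left (by
      rintro ⟨k, rfl⟩
      rw [Finset.mem_singleton] at hzc
      obtain ⟨l, hl⟩ := hp0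
      have := Finset.mem_singleton.1 (hpc hl)
      exact hzp (hzc ▸ this ▸ hl))
    have key : ∀ a ∈ C, ∀ b ∈ C, Disjoint a b → a ∪ b = c → z ∈ b →
        ∃ w ∈ siblings z C, insert z w ⊆ c ∧ (p ⊆ w ∨ Disjoint w p) := by
      rintro a ha b hb hab rfl hzb
      have hza : z ∉ a := Finset.disjoint_right.1 hab hzb
      by_cases hbz : b = {z}
      · subst hbz
        have hi : insert z a = a ∪ {z} := by rw [Finset.union_comm]; rfl
        refine ⟨a, mem_siblings.2 ⟨ha, hza, hi ▸ hc⟩, hi.le, Or.inl fun k hk => ?_⟩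
        refine (Finset.mem_union.1 (hpc hk)).resolve_right fun h' => ?_
        exact hzp (Finset.mem_singleton.1 h' ▸ hk)
      have haS : a ∈ (SetSystem.detach z C).erase R := by
        refine Finset.mem_erase.2 ⟨?_, mem_detach.2 ⟨(h.nonempty ha).ne_empty, a, ha,
          Finset.erase_eq_of_notMem hza⟩⟩
        rintro rfl
        exact hjc (Finset.mem_union_left _ hjR)
      have hbS : b.erase z ∈ (SetSystem.detach z C).erase R := by
        refine Finset.mem_erase.2 ⟨?_, mem_detach.2 ⟨fun h' => ?_, b, hb, rfl⟩⟩
        · intro h'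
          rw [← h'] at hjR
          exact hjc (Finset.mem_union_right _ (Finset.mem_erase.1 hjR).2)
        · rw [Finset.erase_eq_empty_iff] at h'
          rcases h' with rfl | h'
          · simp at hzb
          · exact hbz h'
      have hsub : p ⊆ a → ∃ w ∈ siblings z C, insert z w ⊆ a ∪ b ∧ (p ⊆ w ∨ Disjoint w p) := by
        intro hpa
        obtain ⟨w, hw, hwb⟩ := h.exists_sibling_subset hb hzb hbz
        exact ⟨w, hw, hwb.trans Finset.subset_union_right, Or.inr
          (hab.symm.mono ((Finset.subset_insert z w).trans hwb) hpa)⟩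
      -- Compare `p` with the half `a` not containing `z`. If `p ⊆ a`, any sibling found in `b` is
      -- disjoint from `p`; if `p` misses `a`, then `p ⊆ b` and the descent continues.
      rcases hS.compatible p hp a haS with h1 | h1 | h1 | h1
      · exact hsub h1
      · rcases hS.compatible p hp _ hbS with h2 | h2 | h2 | h2
        · obtain ⟨k, hk⟩ := h.nonempty ha
          exact absurd (Finset.mem_erase.1 (h2 (h1 hk))).2 (Finset.disjoint_left.1 hab hk)
        -- Here `p` contains `a` and all of `b` except `z`, so `insert z p` is the cluster `a ∪ b`,
        -- contrary to `hpC`.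
        · exfalso
          apply hpC
          have hcp : insert z p = a ∪ b := by
            refine Finset.Subset.antisymm (Finset.insert_subset hzc hpc)
              (Finset.union_subset (h1.trans (Finset.subset_insert z p)) fun k hk => ?_)
            by_cases hkz : k = z
            · exact hkz ▸ Finset.mem_insert_self z p
            · exact Finset.mem_insert_of_mem (h2 (Finset.mem_erase.2 ⟨hkz, hk⟩))
          rwa [hcp]
        · refine hsub fun k hk => (Finset.mem_union.1 (hpc hk)).resolve_right fun h' => ?_
          exact Finset.disjoint_left.1 h2 hk (Finset.mem_erase.2 ⟨fun h'' => hzp (h'' ▸ hk), h'⟩)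
        · rw [← h2] at hjR
          refine absurd ?_ hjc
          rcases Finset.mem_union.1 hjR with h' | h'
          · exact hpc h'
          · exact Finset.mem_union_right _ (Finset.mem_erase.1 h').2
      · have hpb : p ⊆ b := fun k hk =>
          (Finset.mem_union.1 (hpc hk)).resolve_left (Finset.disjoint_left.1 h1 hk)
        have hlt := ssubset_union_of_disjoint hab.symm (h.nonempty ha).ne_empty
        rw [Finset.union_comm] at hlt
        obtain ⟨w, hw, hwb, hor⟩ := ih b hlt hb hzb hpb
        exact ⟨w, hw, hwb.trans Finset.subset_union_right, hor⟩
      · rw [← h1] at hjR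
        refine absurd ?_ hjc
        rcases Finset.mem_union.1 hjR with h' | h'
        · exact hpc h'
        · exact Finset.mem_union_left _ h'
    obtain ⟨a, ha, b, hb, hab, hu⟩ := h.splits c hc hn
    rcases Finset.mem_union.1 (hu ▸ hzc) with hza | hzb
    · exact key b hb a ha hab.symm (by rw [Finset.union_comm, hu]) hza
    · exact key a ha b hb hab hu hzb

end LeaveOneOut

end SetSystem

/-! ### The equality case: an extremal system is a split system. -/

namespace SetSystem

variable {α : Type*} [DecidableEq α]

namespace LeaveOneOut

variable {R : Finset α} {C : Finset (Finset α)} {z : α}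

/-- If the leaf `z` has exactly two siblings, they are disjoint. -/
theorem disjoint_siblings (h : LeaveOneOut (insert z R) C) (hz : z ∉ R) (hR : 2 ≤ R.card)
    (hU : (siblings z C).card = 2) {w w' : Finset α} (hw : w ∈ siblings z C)
    (hw' : w' ∈ siblings z C) (hne : w ≠ w') : Disjoint w w' := by
  rw [Finset.disjoint_left]
  intro k hk hk'
  -- A common element is missed by some sibling, which would be a third one.
  obtain ⟨v, hv, hkv⟩ := h.exists_sibling_notMem hz hR (h.sibling_subset hw hk)
  have : 2 < (siblings z C).card := Finset.two_lt_card.2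
    ⟨w, hw, w', hw', v, hv, hne, fun h' => hkv (h' ▸ hk), fun h' => hkv (h' ▸ hk')⟩
  omega

/-- The hypotheses of the equality case of the induction: `z` has two siblings, the system without
`z` is compatible, and `p`, `q` are the children of `R`. -/
structure Tight (R : Finset α) (C : Finset (Finset α)) (z : α) (p q : Finset α) : Prop where
  leaveOneOut : LeaveOneOut (insert z R) C
  notMem : z ∉ R
  two_le : 2 ≤ R.card
  card_siblings : (siblings z C).card = 2
  splitSystem : SplitSystem R ((SetSystem.detach z C).erase R)
  left_mem : p ∈ C
  right_mem : q ∈ C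
  disjoint : Disjoint p q
  union_eq : p ∪ q = R

namespace Tight

variable {p q : Finset α}

theorem symm (h : Tight R C z p q) : Tight R C z q p :=
  { h with
    left_mem := h.right_mem
    right_mem := h.left_mem
    disjoint := h.disjoint.symm
    union_eq := by rw [Finset.union_comm]; exact h.union_eq }

theorem left_subset (h : Tight R C z p q) : p ⊆ R := h.union_eq ▸ Finset.subset_union_left

theorem notMem_left (h : Tight R C z p q) : z ∉ p := fun h' => h.notMem (h.left_subset h')

theorem left_nonempty (h : Tight R C z p q) : p.Nonempty := h.leaveOneOut.nonempty h.left_mem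

theorem left_mem_detach (h : Tight R C z p q) : p ∈ (SetSystem.detach z C).erase R := by
  refine Finset.mem_erase.2 ⟨fun h' => ?_, mem_detach.2 ⟨h.left_nonempty.ne_empty, p, h.left_mem,
    Finset.erase_eq_of_notMem h.notMem_left⟩⟩
  obtain ⟨k, hk⟩ := h.symm.left_nonempty
  exact Finset.disjoint_right.1 h.disjoint hk (h' ▸ h.symm.left_subset hk)

/-- Since `p` is not a sibling, `exists_sibling_of_subset` applies to `p` inside the complement of
`j`; a sibling disjoint from `p` lies in `q` because `p` and `q` cover `R`. -/
theorem exists_sibling (h : Tight R C z p q) (hp : p ∉ siblings z C) {j : α} (hj : j ∈ q) :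
    ∃ w ∈ siblings z C, j ∉ w ∧ (p ⊆ w ∨ w ⊆ q) := by
  have hjR : j ∈ insert z R := Finset.mem_insert_of_mem (h.symm.left_subset hj)
  have hpC : insert z p ∉ C := fun h' => hp (mem_siblings.2 ⟨h.left_mem, h.notMem_left, h'⟩)
  have hjz : j ≠ z := fun h' => h.symm.notMem_left (h' ▸ hj)
  have hjp : j ∉ p := Finset.disjoint_right.1 h.disjoint hj
  obtain ⟨w, hw, hwc, hor⟩ := h.leaveOneOut.exists_sibling_of_subset h.notMem h.splitSystem
    h.left_mem_detach hpC (h.leaveOneOut.erase_mem j hjR) (by simp [hjz.symm])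
    (fun k hk => Finset.mem_erase.2 ⟨fun h' => hjp (h' ▸ hk),
      Finset.mem_insert_of_mem (h.left_subset hk)⟩)
  refine ⟨w, hw, fun hjw => by simpa using hwc (Finset.mem_insert_of_mem hjw), hor.imp_right ?_⟩
  intro hd k hk
  have := h.leaveOneOut.sibling_subset hw hk
  rw [← h.union_eq] at this
  exact (Finset.mem_union.1 this).resolve_left (Finset.disjoint_left.1 hd hk)

theorem disjoint_siblings (h : Tight R C z p q) {w w' : Finset α} (hw : w ∈ siblings z C)
    (hw' : w' ∈ siblings z C) {j : α} (hj : j ∈ w) (hj' : j ∉ w') : Disjoint w w' :=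
  h.leaveOneOut.disjoint_siblings h.notMem h.two_le h.card_siblings hw hw'
    fun h' => hj' (h' ▸ hj)

theorem sibling_nonempty (h : Tight R C z p q) {w : Finset α} (hw : w ∈ siblings z C) :
    w.Nonempty := h.leaveOneOut.nonempty (mem_siblings.1 hw).1

/-- A sibling of `z` which is disjoint from `q` is contained in `p`. -/
theorem subset_left (h : Tight R C z p q) {w : Finset α} (hw : w ∈ siblings z C)
    (hd : Disjoint w q) : w ⊆ p := by
  intro k hk
  have := h.leaveOneOut.sibling_subset hw hk
  rw [← h.union_eq] at this
  exact (Finset.mem_union.1 this).resolve_right (Finset.disjoint_left.1 hd hk)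

/-- A sibling missing an element of `q` is disjoint from the sibling `q`, hence inside `p`. If `p`
were not a sibling, `exists_sibling` would make it contain `p`, so equal `p`, or lie in `q`; both
are absurd. -/
theorem left_mem_siblings_of_right (h : Tight R C z p q) (hq : q ∈ siblings z C) :
    p ∈ siblings z C := by
  by_contra hp
  obtain ⟨j, hj⟩ := h.symm.left_nonempty
  obtain ⟨w, hw, hjw, hor⟩ := h.exists_sibling hp hj
  have hd := (h.disjoint_siblings hq hw hj hjw).symm
  rcases hor with hpw | hwq
  · exact hp (Finset.Subset.antisymm hpw (h.subset_left hw hd) ▸ hw)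
  · obtain ⟨k, hk⟩ := h.sibling_nonempty hw
    exact Finset.disjoint_left.1 hd hk (hwq hk)

/-- If `p ⊆ w`, a sibling `w'` missing an element of `p` is disjoint from `w`, so it cannot lie in
`p` and must contain `q`. Then `w` misses `q`, which forces `w = p`. -/
theorem not_left_subset (h : Tight R C z p q) (hp : p ∉ siblings z C) (hq : q ∉ siblings z C)
    {w : Finset α} (hw : w ∈ siblings z C) : ¬ p ⊆ w := by
  intro hpw
  obtain ⟨k, hk⟩ := h.left_nonempty
  obtain ⟨w', hw', hkw', hor⟩ := h.symm.exists_sibling hq hk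
  have hd := h.disjoint_siblings hw hw' (hpw hk) hkw'
  rcases hor with hqw | hwp
  · exact hp (Finset.Subset.antisymm hpw (h.subset_left hw (hd.mono_right hqw)) ▸ hw)
  · obtain ⟨l, hl⟩ := h.sibling_nonempty hw'
    exact Finset.disjoint_right.1 hd hl (hpw (hwp hl))

/-- Otherwise neither `p` nor `q` is a sibling. Then `p` contains a sibling, and `q` contains two,
because every element of `q` is missed by a sibling inside `q`. That makes three. -/
theorem left_mem_siblings (h : Tight R C z p q) : p ∈ siblings z C := by
  by_contra hp
  have hq : q ∉ siblings z C := fun hq => hp (h.left_mem_siblings_of_right hq)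
  have hA : ∀ j ∈ q, ∃ w ∈ siblings z C, j ∉ w ∧ w ⊆ q := fun j hj => by
    obtain ⟨w, hw, hjw, hor⟩ := h.exists_sibling hp hj
    exact ⟨w, hw, hjw, hor.resolve_left (h.not_left_subset hp hq hw)⟩
  obtain ⟨k, hk⟩ := h.left_nonempty
  obtain ⟨w₃, hw₃, -, hor⟩ := h.symm.exists_sibling hq hk
  have hw₃p := hor.resolve_left (h.symm.not_left_subset hq hp hw₃)
  obtain ⟨j, hj⟩ := h.symm.left_nonempty
  obtain ⟨w, hw, -, hwq⟩ := hA j hj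
  obtain ⟨l, hl⟩ := h.sibling_nonempty hw
  obtain ⟨w', hw', hlw', hwq'⟩ := hA l (hwq hl)
  have key : ∀ v, v ⊆ q → w₃ ≠ v := by
    rintro v hv rfl
    obtain ⟨i, hi⟩ := h.sibling_nonempty hw₃
    exact Finset.disjoint_left.1 h.disjoint (hw₃p hi) (hv hi)
  have : 2 < (siblings z C).card := Finset.two_lt_card.2
    ⟨w₃, hw₃, w, hw, w', hw', key w hwq, key w' hwq', fun h' => hlw' (h' ▸ hl)⟩
  have := h.card_siblings
  omega

theorem siblings_eq (h : Tight R C z p q) : siblings z C = {p, q} := by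
  symm
  apply Finset.eq_of_subset_of_card_le
  · intro w hw
    rw [Finset.mem_insert, Finset.mem_singleton] at hw
    rcases hw with rfl | rfl
    exacts [h.left_mem_siblings, h.symm.left_mem_siblings]
  · have hne : p ≠ q := by
      obtain ⟨k, hk⟩ := h.left_nonempty
      intro h'
      exact Finset.disjoint_left.1 h.disjoint hk (h' ▸ hk)
    rw [h.card_siblings, Finset.card_pair hne]

theorem insert_left_mem (h : Tight R C z p q) : insert z p ∈ C :=
  (mem_siblings.1 h.left_mem_siblings).2.2

theorem _root_.SetSystem.mem_or_insert_mem_of_mem_detach {c : Finset α}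
    (hc : c ∈ (SetSystem.detach z C).erase R) : c ∈ C ∨ insert z c ∈ C := by
  obtain ⟨-, d, hd, rfl⟩ := mem_detach.1 (Finset.mem_erase.1 hc).2
  by_cases hzd : z ∈ d
  · exact Or.inr (by rwa [Finset.insert_erase hzd])
  · exact Or.inl (by rwa [Finset.erase_eq_of_notMem hzd])

theorem notMem_detach (h : Tight R C z p q) {c : Finset α}
    (hc : c ∈ (SetSystem.detach z C).erase R) : z ∉ c :=
  fun h' => h.notMem ((h.splitSystem.ssubset_top c hc).1 h')

/-- A descent from `insert z c` to `{z}` would find a sibling inside `c`; but the only siblings are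
`p` and `q`, and neither fits. -/
theorem insert_notMem (h : Tight R C z p q) {c : Finset α}
    (hc : c ∈ (SetSystem.detach z C).erase R) (hcp : c ⊂ p) : insert z c ∉ C := by
  intro hi
  have hzc := h.notMem_detach hc
  have hc0 := h.splitSystem.nonempty hc
  obtain ⟨w, hw, hs⟩ := h.leaveOneOut.exists_sibling_subset hi (Finset.mem_insert_self z c)
    (fun h' => by
      obtain ⟨k, hk⟩ := hc0
      have : k ∈ ({z} : Finset α) := h' ▸ Finset.mem_insert_of_mem hk
      exact hzc (Finset.mem_singleton.1 this ▸ hk))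
  have hwc : w ⊆ c := by
    rw [← Finset.erase_insert hzc, ← Finset.erase_insert (mem_siblings.1 hw).2.1]
    exact Finset.erase_subset_erase z hs
  rw [h.siblings_eq, Finset.mem_insert, Finset.mem_singleton] at hw
  rcases hw with rfl | rfl
  · exact hcp.2 hwc
  · obtain ⟨k, hk⟩ := h.symm.left_nonempty
    exact Finset.disjoint_right.1 h.disjoint hk (hcp.1 (hwc hk))

/-- Pick `j` in `R` outside `c`, hence in `q`, and descend from the complement of `j`. The sibling
found avoids `j`, so it is `p`; but `p` neither contains `c` nor is disjoint from it. -/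
theorem notMem_of_left_ssubset (h : Tight R C z p q) {c : Finset α}
    (hc : c ∈ (SetSystem.detach z C).erase R) (hpc : p ⊂ c) : c ∉ C := by
  intro hcC
  have hzc := h.notMem_detach hc
  obtain ⟨i, hi⟩ := h.left_nonempty
  have hiC : insert z c ∉ C := by
    intro h'
    have hcU : c ∈ siblings z C := mem_siblings.2 ⟨hcC, hzc, h'⟩
    rw [h.siblings_eq, Finset.mem_insert, Finset.mem_singleton] at hcU
    rcases hcU with rfl | rfl
    · exact hpc.2 subset_rfl
    · exact Finset.disjoint_left.1 h.disjoint hi (hpc.1 hi)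
  obtain ⟨j, hjR, hjc⟩ := Finset.exists_of_ssubset (h.splitSystem.ssubset_top c hc)
  have hjz : j ≠ z := fun h' => h.notMem (h' ▸ hjR)
  have hjq : j ∈ q := by
    rw [← h.union_eq] at hjR
    exact (Finset.mem_union.1 hjR).resolve_left fun h' => hjc (hpc.1 h')
  obtain ⟨w, hw, hwc, hor⟩ := h.leaveOneOut.exists_sibling_of_subset h.notMem h.splitSystem
    hc hiC (h.leaveOneOut.erase_mem j (Finset.mem_insert_of_mem hjR)) (by simp [hjz.symm])
    (fun k hk => Finset.mem_erase.2 ⟨fun h' => hjc (h' ▸ hk),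
      Finset.mem_insert_of_mem ((h.splitSystem.ssubset_top c hc).1 hk)⟩)
  have hjw : j ∉ w := fun hjw => by simpa using hwc (Finset.mem_insert_of_mem hjw)
  rw [h.siblings_eq, Finset.mem_insert, Finset.mem_singleton] at hw
  rcases hw with rfl | rfl
  · rcases hor with h' | h'
    · exact hpc.2 h'
    · exact Finset.disjoint_left.1 h' hi (hpc.1 hi)
  · exact hjw hjq

/-- In the tree picture `z` sits on the edge `p | q`. A side of an old edge either lies within `p`
or `q`, away from `z`, or contains one of them and acquires `z`. Compatibility with `p` leaves no
other sides. -/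
theorem mem_and_insert_mem (h : Tight R C z p q) {c : Finset α}
    (hc : c ∈ (SetSystem.detach z C).erase R) :
    (c ∈ C ↔ c ⊆ p ∨ c ⊆ q) ∧ (insert z c ∈ C ↔ p ⊆ c ∨ q ⊆ c) := by
  have hd := h.disjoint
  have hu := h.union_eq
  have key : ∀ {p q : Finset α}, Tight R C z p q → c ⊆ p →
      c ∈ C ∧ (insert z c ∈ C ↔ p ⊆ c ∨ q ⊆ c) := by
    intro p q h hcp
    by_cases hne : c = p
    · subst hne
      exact ⟨h.left_mem, by simp [h.insert_left_mem]⟩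
    have h1 := h.insert_notMem hc (Finset.ssubset_iff_subset_ne.2 ⟨hcp, hne⟩)
    refine ⟨(mem_or_insert_mem_of_mem_detach hc).resolve_right h1, iff_of_false h1 ?_⟩
    rintro (h' | h')
    · exact hne (Finset.Subset.antisymm hcp h')
    · obtain ⟨k, hk⟩ := h.symm.left_nonempty
      exact Finset.disjoint_right.1 h.disjoint hk (hcp (h' hk))
  have key' : ∀ {p q : Finset α}, Tight R C z p q → p ⊂ c →
      insert z c ∈ C ∧ (c ∈ C ↔ c ⊆ p ∨ c ⊆ q) := by
    intro p q h hpc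
    have h1 := h.notMem_of_left_ssubset hc hpc
    refine ⟨(mem_or_insert_mem_of_mem_detach hc).resolve_left h1, iff_of_false h1 ?_⟩
    rintro (h' | h')
    · exact hpc.2 h'
    · obtain ⟨k, hk⟩ := h.left_nonempty
      exact Finset.disjoint_left.1 h.disjoint hk (h' (hpc.1 hk))
  by_cases h1 : c ⊆ p
  · have := key h h1
    tauto
  by_cases h2 : c ⊆ q
  · have := key h.symm h2
    tauto
  by_cases h3 : p ⊆ c
  · have := key' h ⟨h3, h1⟩
    tauto
  by_cases h4 : q ⊆ c
  · have := key' h.symm ⟨h4, h2⟩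
    tauto
  exfalso
  rcases h.splitSystem.compatible c hc p h.left_mem_detach with h' | h' | h' | h'
  · exact h1 h'
  · exact h3 h'
  · refine h2 fun k hk => ?_
    have := (h.splitSystem.ssubset_top c hc).1 hk
    rw [← hu] at this
    exact (Finset.mem_union.1 this).resolve_left (Finset.disjoint_left.1 h' hk)
  · refine h4 fun k hk => ?_
    have := h.symm.left_subset hk
    rw [← h'] at this
    exact (Finset.mem_union.1 this).resolve_right (Finset.disjoint_right.1 hd hk)

/-- The members of `C`. -/
theorem cases (h : Tight R C z p q) {c : Finset α} (hc : c ∈ C) :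
    c = R ∨ c = {z} ∨ (z ∉ c ∧ c ∈ (SetSystem.detach z C).erase R ∧ (c ⊆ p ∨ c ⊆ q)) ∨
      ∃ d ∈ (SetSystem.detach z C).erase R, insert z d = c ∧ (p ⊆ d ∨ q ⊆ d) := by
  by_cases hzc : z ∈ c
  · by_cases hcz : c = {z}
    · exact Or.inr (Or.inl hcz)
    right; right; right
    have hcR : c.erase z ≠ R := by
      rintro rfl
      have := (h.leaveOneOut.ssubset_top c hc).2
      rw [Finset.insert_erase hzc] at this
      exact this subset_rfl
    have hc0 : c.erase z ≠ ∅ := by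
      intro h'
      rw [Finset.erase_eq_empty_iff] at h'
      rcases h' with rfl | h'
      · simp at hzc
      · exact hcz h'
    have hm : c.erase z ∈ (SetSystem.detach z C).erase R :=
      Finset.mem_erase.2 ⟨hcR, mem_detach.2 ⟨hc0, c, hc, rfl⟩⟩
    exact ⟨_, hm, Finset.insert_erase hzc,
      (h.mem_and_insert_mem hm).2.1 (by rwa [Finset.insert_erase hzc])⟩
  · by_cases hcR : c = R
    · exact Or.inl hcR
    have hm : c ∈ (SetSystem.detach z C).erase R :=
      Finset.mem_erase.2 ⟨hcR, mem_detach.2 ⟨(h.leaveOneOut.nonempty hc).ne_empty, c, hc,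
        Finset.erase_eq_of_notMem hzc⟩⟩
    exact Or.inr (Or.inr (Or.inl ⟨hzc, hm, (h.mem_and_insert_mem hm).1.1 hc⟩))

theorem singleton_mem (h : Tight R C z p q) : {z} ∈ C :=
  h.leaveOneOut.singleton_mem (by
    have := h.two_le
    rw [Finset.card_insert_of_notMem h.notMem]; omega) (Finset.mem_insert_self z R)

theorem subset_sdiff (h : Tight R C z p q) {c : Finset α} (hcp : c ⊆ p) : q ⊆ R \ c :=
  fun _ hk => Finset.mem_sdiff.2
    ⟨h.symm.left_subset hk, fun hk' => Finset.disjoint_right.1 h.disjoint hk (hcp hk')⟩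

theorem sdiff_subset (h : Tight R C z p q) {c : Finset α} (hpc : p ⊆ c) : R \ c ⊆ q := by
  intro k hk
  obtain ⟨hkR, hkc⟩ := Finset.mem_sdiff.1 hk
  rw [← h.union_eq] at hkR
  exact (Finset.mem_union.1 hkR).resolve_left fun h' => hkc (hpc h')

/-- Complementation exchanges `R` with `{z}`, and the sets inside `p` or `q` with the sets `insert z
d` where `d` contains `p` or `q`. -/
theorem toSplitSystem (h : Tight R C z p q) : SplitSystem (insert z R) C where
  toLeaveOneOut := h.leaveOneOut
  sdiff_mem c hc := by
    rcases h.cases hc with rfl | rfl | ⟨hzc, hm, hor⟩ | ⟨d, hm, rfl, hor⟩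
    · rw [Finset.insert_sdiff_of_notMem _ h.notMem, sdiff_self]
      exact h.singleton_mem
    · rw [Finset.insert_sdiff_of_mem _ (Finset.mem_singleton_self z),
        Finset.sdiff_singleton_eq_erase, Finset.erase_eq_of_notMem h.notMem]
      exact h.leaveOneOut.top_mem h.notMem
    · rw [Finset.insert_sdiff_of_notMem _ hzc]
      refine (h.mem_and_insert_mem (h.splitSystem.sdiff_mem c hm)).2.2 ?_
      exact hor.symm.imp h.symm.subset_sdiff h.subset_sdiff
    · rw [Finset.insert_sdiff_insert, Finset.sdiff_insert,
        Finset.erase_eq_of_notMem (fun h' => h.notMem (Finset.mem_sdiff.1 h').1)]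
      refine (h.mem_and_insert_mem (h.splitSystem.sdiff_mem d hm)).1.2 ?_
      exact hor.symm.imp h.symm.sdiff_subset h.sdiff_subset
  compatible a ha b hb := by
    have hCR : ∀ b ∈ C, b ⊆ R ∨ b ⊆ {z} ∨ {z} ⊆ b := fun b hb => by
      by_cases hzb : z ∈ b
      · right; right; simpa
      · left
        exact fun k hk => (Finset.mem_insert.1 ((h.leaveOneOut.ssubset_top b hb).1 hk)).resolve_left
          fun h' => hzb (h' ▸ hk)
    have hR : ∀ b ∈ C, b ⊆ R ∨ R ∪ b = insert z R := fun b hb => by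
      by_cases hzb : z ∈ b
      · right
        refine Finset.Subset.antisymm (Finset.union_subset (Finset.subset_insert z R)
          (h.leaveOneOut.ssubset_top b hb).1) (Finset.insert_subset ?_ Finset.subset_union_left)
        exact Finset.mem_union_right _ hzb
      · left
        exact fun k hk => (Finset.mem_insert.1 ((h.leaveOneOut.ssubset_top b hb).1 hk)).resolve_left
          fun h' => hzb (h' ▸ hk)
    have hZ : ∀ b ∈ C, {z} ⊆ b ∨ Disjoint {z} b := fun b _ => by
      by_cases hzb : z ∈ b
      · left; simpa
      · right; simpa
    have hmix : ∀ {p q a d : Finset α}, Tight R C z p q →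
        a ∈ (SetSystem.detach z C).erase R → d ∈ (SetSystem.detach z C).erase R → z ∉ a →
        a ⊆ p → (p ⊆ d ∨ q ⊆ d) →
        a ⊆ insert z d ∨ Disjoint a (insert z d) ∨ a ∪ insert z d = insert z R := by
      intro p q a d h ha hd hza hap hor
      rcases hor with hpd | hqd
      · exact Or.inl ((hap.trans hpd).trans (Finset.subset_insert z d))
      rcases h.splitSystem.compatible a ha d hd with h' | h' | h' | h'
      · exact Or.inl (h'.trans (Finset.subset_insert z d))
      · obtain ⟨k, hk⟩ := h.symm.left_nonempty
        exact absurd (hap (h' (hqd hk))) (Finset.disjoint_right.1 h.disjoint hk)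
      · exact Or.inr (Or.inl (Finset.disjoint_insert_right.2 ⟨hza, h'⟩))
      · exact Or.inr (Or.inr (by rw [Finset.union_insert, h']))
    rcases h.cases ha with rfl | rfl | ⟨hza, hma, hora⟩ | ⟨d, hmd, rfl, hord⟩
    · rcases hR b hb with h' | h' <;> tauto
    · rcases hZ b hb with h' | h' <;> tauto
    · rcases h.cases hb with rfl | rfl | ⟨hzb, hmb, horb⟩ | ⟨e, hme, rfl, hore⟩
      · exact Or.inl (h.splitSystem.ssubset_top a hma).1
      · rcases hZ a ha with h' | h'
        · tauto
        · have := h'.symm; tauto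
      · rcases h.splitSystem.compatible a hma b hmb with h' | h' | h' | h'
        · tauto
        · tauto
        · tauto
        -- Two sets covering `R` no longer cover `insert z R`, so this case has to become
        -- disjointness.
        · have hdis : ∀ {p q a b : Finset α}, Tight R C z p q → a ∪ b = R → a ⊆ p →
              (b ⊆ p ∨ b ⊆ q) → Disjoint a b := by
            rintro p q a b h hab hap (hbp | hbq)
            · obtain ⟨k, hk⟩ := h.symm.left_nonempty
              exact absurd (Finset.union_subset hap hbp (hab ▸ h.symm.left_subset hk))
                (Finset.disjoint_right.1 h.disjoint hk)
            · exact h.disjoint.mono hap hbq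
          rcases hora with h1 | h1
          · exact Or.inr (Or.inr (Or.inl (hdis h h' h1 horb)))
          · exact Or.inr (Or.inr (Or.inl (hdis h.symm h' h1 horb.symm)))
      · rcases hora with h1 | h1
        · have := hmix h hma hme hza h1 hore; tauto
        · have := hmix h.symm hma hme hza h1 hore.symm; tauto
    · rcases h.cases hb with rfl | rfl | ⟨hzb, hmb, horb⟩ | ⟨e, hme, rfl, hore⟩
      · rcases hR _ ha with h' | h'
        · tauto
        · rw [Finset.union_comm] at h'; tauto
      · rcases hZ _ ha with h' | h'
        · tauto
        · have := h'.symm; tauto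
      · rw [disjoint_comm, Finset.union_comm]
        rcases horb with h1 | h1
        · have := hmix h hmb hmd hzb h1 hord; tauto
        · have := hmix h.symm hmb hmd hzb h1 hord.symm; tauto
      · rcases h.splitSystem.compatible d hmd e hme with h' | h' | h' | h'
        · exact Or.inl (Finset.insert_subset_insert z h')
        · exact Or.inr (Or.inl (Finset.insert_subset_insert z h'))
        -- Disjoint sets that both acquire `z` meet in `z`, so this case has to become covering.
        · have hdis : ∀ {p q d e : Finset α}, Tight R C z p q → Disjoint d e → p ⊆ d →
              (p ⊆ e ∨ q ⊆ e) → R ⊆ d ∪ e := by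
            rintro p q d e h hde hpd (hpe | hqe)
            · obtain ⟨k, hk⟩ := h.left_nonempty
              exact absurd (hpe hk) (Finset.disjoint_left.1 hde (hpd hk))
            · rw [← h.union_eq]
              exact Finset.union_subset_union hpd hqe
          have hRde : R ⊆ d ∪ e := by
            rcases hord with h1 | h1
            · exact hdis h h' h1 hore
            · exact hdis h.symm h' h1 hore.symm
          have hde : d ∪ e = R := Finset.Subset.antisymm (Finset.union_subset
            (h.splitSystem.ssubset_top d hmd).1 (h.splitSystem.ssubset_top e hme).1) hRde
          exact Or.inr (Or.inr (Or.inr (by simp [hde])))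
        · exact Or.inr (Or.inr (Or.inr (by simp [h'])))

end Tight

theorem eq_singleton_of_card_eq_two (h : LeaveOneOut R C) (hR : R.card = 2) {c : Finset α}
    (hc : c ∈ C) : c.card = 1 := by
  have h1 := Finset.card_lt_card (h.ssubset_top c hc)
  have h2 := (h.nonempty hc).card_pos
  omega

/-- Induction from a ground set of two elements, where both singletons are present. Each further
index adds 2 for `R` and `{z}` and at least 2 for siblings; equality at the end makes every step
tight. The bound 4m - 6 is written additively to avoid truncated subtraction. -/
theorem card_le_and_splitSystem (h : LeaveOneOut R C) (hR : 2 ≤ R.card) :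
    4 * R.card ≤ C.card + 6 ∧ (C.card + 6 = 4 * R.card → SplitSystem R C) := by
  induction R using Finset.induction generalizing C with
  | empty => simp at hR
  | insert z R hz ih =>
    by_cases hR' : 2 ≤ R.card
    · obtain ⟨ih1, ih2⟩ := ih (h.detach hz hR') hR'
      have h1 := h.card_eq hz hR'
      have h2 := h.two_le_card_siblings hz hR'
      rw [Finset.card_insert_of_notMem hz]
      refine ⟨by omega, fun heq => ?_⟩
      obtain ⟨p, hp, q, hq, hpq, hu⟩ := h.splits R (h.top_mem hz)
        (Finset.one_lt_card_iff_nontrivial.1 hR')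
      have ht : Tight R C z p q := ⟨h, hz, hR', by omega, ih2 (by omega), hp, hq, hpq, hu⟩
      exact ht.toSplitSystem
    · have hR2 : (insert z R).card = 2 := by
        rw [Finset.card_insert_of_notMem hz] at hR ⊢
        omega
      have hsub : 2 ≤ C.card := by
        have : (insert z R).image (insert z R).erase ⊆ C := by
          intro c hc
          obtain ⟨j, hj, rfl⟩ := Finset.mem_image.1 hc
          exact h.erase_mem j hj
        have h1 := Finset.card_le_card this
        rwa [Finset.card_image_of_injOn (Finset.erase_injOn _), hR2] at h1
      refine ⟨by omega, fun _ => ⟨h, fun c hc => ?_, fun a ha b hb => ?_⟩⟩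
      · have h1 := h.eq_singleton_of_card_eq_two hR2 hc
        have h2 := Finset.card_sdiff_of_subset (h.ssubset_top c hc).1
        obtain ⟨k, hk⟩ := Finset.card_eq_one.1 (show (insert z R \ c).card = 1 by omega)
        have hkR : k ∈ insert z R := by
          have : k ∈ insert z R \ c := hk ▸ Finset.mem_singleton_self k
          exact (Finset.mem_sdiff.1 this).1
        rw [hk]
        exact h.singleton_mem hR hkR
      · obtain ⟨j, rfl⟩ := Finset.card_eq_one.1 (h.eq_singleton_of_card_eq_two hR2 ha)
        obtain ⟨k, rfl⟩ := Finset.card_eq_one.1 (h.eq_singleton_of_card_eq_two hR2 hb)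
        by_cases hjk : j = k
        · exact Or.inl (by rw [hjk])
        · exact Or.inr (Or.inr (Or.inl (by simpa using hjk)))

end LeaveOneOut

end SetSystem

/-! ### Split systems as rooted hierarchies, and their number. -/

namespace SetSystem

variable {α : Type*} [DecidableEq α]

namespace SplitSystem

variable {R : Finset α} {C : Finset (Finset α)}

/-- Rooting the tree at the leaf `r`: sets that avoid `r` cannot cover `R`, so compatibility becomes
laminarity. -/
theorem hierarchy_erase (h : SplitSystem R C) {r : α} (hr : r ∈ R) :
    Hierarchy (R.erase r) (C.filter (r ∉ ·)) where
  top_mem := Finset.mem_filter.2 ⟨h.erase_mem r hr, Finset.notMem_erase r R⟩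
  empty_notMem h' := h.empty_notMem (Finset.mem_filter.1 h').1
  subset_top c hc := by
    obtain ⟨hc, hrc⟩ := Finset.mem_filter.1 hc
    exact Finset.subset_erase.2 ⟨(h.ssubset_top c hc).1, hrc⟩
  laminar a ha b hb := by
    obtain ⟨ha, hra⟩ := Finset.mem_filter.1 ha
    obtain ⟨hb, hrb⟩ := Finset.mem_filter.1 hb
    rcases h.compatible a ha b hb with h' | h' | h' | h'
    · exact Or.inl h'
    · exact Or.inr (Or.inl h')
    · exact Or.inr (Or.inr h')
    · rw [← h', Finset.mem_union] at hr
      tauto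
  splits c hc hn := by
    obtain ⟨hc, hrc⟩ := Finset.mem_filter.1 hc
    obtain ⟨a, ha, b, hb, hab, rfl⟩ := h.splits c hc hn
    rw [Finset.mem_union, not_or] at hrc
    exact ⟨a, Finset.mem_filter.2 ⟨ha, hrc.1⟩, b, Finset.mem_filter.2 ⟨hb, hrc.2⟩, hab, rfl⟩

/-- Root at any leaf outside `c`. -/
theorem hierarchy_below (h : SplitSystem R C) {c : Finset α} (hc : c ∈ C) :
    Hierarchy c (C.filter (· ⊆ c)) := by
  obtain ⟨r, hr, hrc⟩ := Finset.exists_of_ssubset (h.ssubset_top c hc)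
  convert (h.hierarchy_erase hr).restrict (Finset.mem_filter.2 ⟨hc, hrc⟩) using 1
  rw [Finset.filter_filter]
  refine Finset.filter_congr fun d _ => ?_
  exact ⟨fun hd => ⟨fun h' => hrc (hd h'), hd⟩, fun hd => hd.2⟩

theorem split_unique (h : SplitSystem R C) {a b a' b' : Finset α} (ha : a ∈ C) (hb : b ∈ C)
    (ha' : a' ∈ C) (hb' : b' ∈ C) (hd : Disjoint a b) (hd' : Disjoint a' b')
    (hu : a ∪ b = a' ∪ b') (huC : a ∪ b ∈ C) : a = a' ∧ b = b' ∨ a = b' ∧ b = a' := by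
  refine (h.hierarchy_below huC).split_unique ?_ ?_ ?_ ?_ hd hd' hu ?_ <;>
    rw [Finset.mem_filter]
  · exact ⟨ha, Finset.subset_union_left⟩
  · exact ⟨hb, Finset.subset_union_right⟩
  · exact ⟨ha', hu ▸ Finset.subset_union_left⟩
  · exact ⟨hb', hu ▸ Finset.subset_union_right⟩
  · exact ⟨huC, subset_rfl⟩

/-- Each edge has a side without `r`, and the other side is its complement; so the rooted hierarchy
determines the split system. -/
theorem hierarchy_union (h : SplitSystem R C) (r : α) :
    C.filter (r ∉ ·) ∪ (C.filter (r ∉ ·)).image (R \ ·) = C := by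
  ext c
  simp only [Finset.mem_union, Finset.mem_image, Finset.mem_filter]
  constructor
  · rintro (⟨hc, -⟩ | ⟨d, ⟨hd, -⟩, rfl⟩)
    exacts [hc, h.sdiff_mem d hd]
  · intro hc
    by_cases hrc : r ∈ c
    · refine Or.inr ⟨R \ c, ⟨h.sdiff_mem c hc, fun h' => (Finset.mem_sdiff.1 h').2 hrc⟩, ?_⟩
      exact Finset.sdiff_sdiff_eq_self (h.ssubset_top c hc).1
    · exact Or.inl ⟨hc, hrc⟩

theorem card_eq (h : SplitSystem R C) (hR : R.Nonempty) : C.card + 6 = 4 * R.card := by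
  obtain ⟨r, hr⟩ := hR
  have h1 := (h.hierarchy_erase hr).card_eq
  rw [Finset.card_erase_of_mem hr] at h1
  have h2 : ((C.filter (r ∉ ·)).image (R \ ·)).card = (C.filter (r ∉ ·)).card := by
    refine Finset.card_image_of_injOn fun a ha b hb hab => ?_
    rw [← Finset.sdiff_sdiff_eq_self (h.ssubset_top a (Finset.mem_filter.1 ha).1).1,
      ← Finset.sdiff_sdiff_eq_self (h.ssubset_top b (Finset.mem_filter.1 hb).1).1,
      show R \ a = R \ b from hab]
  have h3 : Disjoint (C.filter (r ∉ ·)) ((C.filter (r ∉ ·)).image (R \ ·)) := by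
    rw [Finset.disjoint_left]
    intro c hc hc'
    obtain ⟨d, hd, rfl⟩ := Finset.mem_image.1 hc'
    exact (Finset.mem_filter.1 hc).2 (Finset.mem_sdiff.2 ⟨hr, (Finset.mem_filter.1 hd).2⟩)
  rw [← h.hierarchy_union r, Finset.card_union_of_disjoint h3, h2]
  have h4 := (Finset.card_pos.2 ⟨r, hr⟩)
  have h5 : 0 < (C.filter (r ∉ ·)).card := Finset.card_pos.2 ⟨_, (h.hierarchy_erase hr).top_mem⟩
  omega

end SplitSystem

/-- The inverse of rooting at `r`. Seen from the other side of its edge, the complement of `d`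
splits into the complement of the parent of `d` and the sibling of `d`. -/
theorem Hierarchy.splitSystem {R : Finset α} {H : Finset (Finset α)} {r : α} (hr : r ∈ R)
    (h : Hierarchy (R.erase r) H) : SplitSystem R (H ∪ H.image (R \ ·)) := by
  have hrH : ∀ c ∈ H, r ∉ c := fun c hc h' => Finset.notMem_erase r R (h.subset_top c hc h')
  have hsub : ∀ c ∈ H, c ⊆ R := fun c hc => (h.subset_top c hc).trans (Finset.erase_subset r R)
  refine ⟨⟨?_, ?_, ?_, ?_⟩, ?_, ?_⟩
  · intro c hc
    rcases Finset.mem_union.1 hc with hc | hc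
    · exact Finset.ssubset_iff_of_subset (hsub c hc) |>.2 ⟨r, hr, hrH c hc⟩
    · obtain ⟨d, hd, rfl⟩ := Finset.mem_image.1 hc
      obtain ⟨k, hk⟩ := Finset.nonempty_iff_ne_empty.2 (h.ne_empty hd)
      exact Finset.ssubset_iff_of_subset Finset.sdiff_subset |>.2
        ⟨k, hsub d hd hk, fun h' => (Finset.mem_sdiff.1 h').2 hk⟩
  · intro h0
    rcases Finset.mem_union.1 h0 with hc | hc
    · exact h.empty_notMem hc
    · obtain ⟨d, hd, h0⟩ := Finset.mem_image.1 hc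
      exact Finset.notMem_empty r (h0 ▸ Finset.mem_sdiff.2 ⟨hr, hrH d hd⟩)
  · intro j hj
    rw [Finset.mem_union, Finset.mem_image]
    by_cases hjr : j = r
    · exact Or.inl (hjr ▸ h.top_mem)
    · exact Or.inr ⟨{j}, h.singleton_mem (Finset.mem_erase.2 ⟨hjr, hj⟩),
        Finset.sdiff_singleton_eq_erase j R⟩
  · intro c hc hn
    rcases Finset.mem_union.1 hc with hc | hc
    · obtain ⟨a, ha, b, hb, hab, hu⟩ := h.splits c hc hn
      exact ⟨a, Finset.mem_union_left _ ha, b, Finset.mem_union_left _ hb, hab, hu⟩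
    · obtain ⟨d, hd, rfl⟩ := Finset.mem_image.1 hc
      -- The top cluster has no sibling, but its complement is the singleton `{r}` and needs no
      -- split.
      have hdR : d ≠ R.erase r := by
        rintro rfl
        rw [Finset.sdiff_erase_self hr] at hn
        simp at hn
      obtain ⟨e, he, hde, hu⟩ := h.exists_sibling hd hdR
      refine ⟨R \ (d ∪ e), Finset.mem_union_right _ (Finset.mem_image_of_mem _ hu), e,
        Finset.mem_union_left _ he, ?_, ?_⟩
      · exact Finset.disjoint_left.2 fun k hk hk' =>
          (Finset.mem_sdiff.1 hk).2 (Finset.mem_union_right d hk')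
      · have h1 := hsub e he
        rw [Finset.disjoint_left] at hde
        ext k
        have h2 := @h1 k
        have h3 := @hde k
        simp only [Finset.mem_union, Finset.mem_sdiff]
        tauto
  · intro c hc
    rw [Finset.mem_union, Finset.mem_image]
    rcases Finset.mem_union.1 hc with hc | hc
    · exact Or.inr ⟨c, hc, rfl⟩
    · obtain ⟨d, hd, rfl⟩ := Finset.mem_image.1 hc
      exact Or.inl (by rwa [Finset.sdiff_sdiff_eq_self (hsub d hd)])
  · have hmix : ∀ a ∈ H, ∀ b ∈ H, a ⊆ R \ b ∨ R \ b ⊆ a ∨ Disjoint a (R \ b) ∨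
        a ∪ (R \ b) = R := by
      intro a ha b hb
      rcases h.laminar a ha b hb with h' | h' | h'
      · exact Or.inr (Or.inr (Or.inl (Finset.disjoint_sdiff.mono_left h')))
      · refine Or.inr (Or.inr (Or.inr (Finset.Subset.antisymm
          (Finset.union_subset (hsub a ha) Finset.sdiff_subset) fun k hk => ?_)))
        by_cases hkb : k ∈ b
        · exact Finset.mem_union_left _ (h' hkb)
        · exact Finset.mem_union_right _ (Finset.mem_sdiff.2 ⟨hk, hkb⟩)
      · exact Or.inl fun k hk => Finset.mem_sdiff.2
          ⟨hsub a ha hk, Finset.disjoint_left.1 h' hk⟩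
    intro a ha b hb
    rcases Finset.mem_union.1 ha with ha | ha <;> rcases Finset.mem_union.1 hb with hb | hb
    · have := h.laminar a ha b hb; tauto
    · obtain ⟨d, hd, rfl⟩ := Finset.mem_image.1 hb
      exact hmix a ha d hd
    · obtain ⟨d, hd, rfl⟩ := Finset.mem_image.1 ha
      have := hmix b hb d hd
      rw [disjoint_comm, Finset.union_comm] at this
      tauto
    · obtain ⟨d, hd, rfl⟩ := Finset.mem_image.1 ha
      obtain ⟨e, he, rfl⟩ := Finset.mem_image.1 hb
      rcases h.laminar d hd e he with h' | h' | h'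
      · exact Or.inr (Or.inl (Finset.sdiff_subset_sdiff subset_rfl h'))
      · exact Or.inl (Finset.sdiff_subset_sdiff subset_rfl h')
      · refine Or.inr (Or.inr (Or.inr (Finset.Subset.antisymm
          (Finset.union_subset Finset.sdiff_subset Finset.sdiff_subset) fun k hk => ?_)))
        by_cases hkd : k ∈ d
        · exact Finset.mem_union_right _ (Finset.mem_sdiff.2 ⟨hk, Finset.disjoint_left.1 h' hkd⟩)
        · exact Finset.mem_union_left _ (Finset.mem_sdiff.2 ⟨hk, hkd⟩)

/-- There are `(2n - 5)!!` unrooted binary trees with `n` given leaves. -/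
theorem ncard_splitSystems {R : Finset α} (hR : 2 ≤ R.card) :
    {C | SplitSystem R C}.ncard = (2 * R.card - 5)‼ := by
  obtain ⟨r, hr⟩ : R.Nonempty := Finset.card_pos.1 (by omega)
  have hcard : (R.erase r).card = R.card - 1 := Finset.card_erase_of_mem hr
  have h1 := card_hierarchies (R := R.erase r) (Finset.card_pos.1 (by omega))
  rw [hcard, show 2 * (R.card - 1) - 3 = 2 * R.card - 5 by omega] at h1
  rw [← h1, ← Set.ncard_coe_finset]
  refine Set.ncard_congr (fun C _ => C.filter (r ∉ ·)) ?_ ?_ ?_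
  · intro C hC
    exact mem_hierarchies.2 (SplitSystem.hierarchy_erase hC hr)
  · intro C D hC hD heq
    rw [← SplitSystem.hierarchy_union hC r, ← SplitSystem.hierarchy_union hD r,
      show C.filter (r ∉ ·) = D.filter (r ∉ ·) from heq]
  · intro H hH
    have hH := mem_hierarchies.1 hH
    refine ⟨_, hH.splitSystem hr, ?_⟩
    ext c
    rw [Finset.mem_filter, Finset.mem_union, Finset.mem_image]
    have hrH : ∀ c ∈ H, r ∉ c := fun c hc h' => Finset.notMem_erase r R (hH.subset_top c hc h')
    constructor
    · rintro ⟨hc | ⟨d, hd, rfl⟩, hrc⟩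
      · exact hc
      · exact absurd (Finset.mem_sdiff.2 ⟨hr, hrH d hd⟩) hrc
    · exact fun hc => ⟨Or.inl hc, hrH c hc⟩

end SetSystem

/-! ### Trees given by a parent relation, and parents in a rooted tree. -/

theorem SimpleGraph.isTree_fromRel_of_parent {V : Type*} [Finite V] {R : V → V → Prop} {r : V}
    {dep : V → ℕ} (h0 : dep r = 0) (hdep : ∀ c d, R c d → dep c = dep d + 1)
    (hex : ∀ c, c ≠ r → ∃ d, R c d) (huniq : ∀ c d d', R c d → R c d' → d = d') :
    (SimpleGraph.fromRel R).IsTree ∧ ∀ c d, R c d ↔ (SimpleGraph.fromRel R).Adj c d ∧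
      (SimpleGraph.fromRel R).dist c r = (SimpleGraph.fromRel R).dist d r + 1 := by
  classical
  have hadj : ∀ c d, R c d → (SimpleGraph.fromRel R).Adj c d := by
    intro c d h
    rw [SimpleGraph.fromRel_adj]
    refine ⟨?_, Or.inl h⟩
    rintro rfl
    have := hdep c c h
    omega
  have hw : ∀ k c, dep c = k → ∃ w : (SimpleGraph.fromRel R).Walk c r, w.length = k := by
    intro k
    induction k with
    | zero =>
      intro c hc
      by_cases hcr : c = r
      · subst hcr; exact ⟨.nil, rfl⟩
      · obtain ⟨d, hd⟩ := hex c hcr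
        have := hdep c d hd
        omega
    | succ k ih =>
      intro c hc
      have hcr : c ≠ r := by rintro rfl; omega
      obtain ⟨d, hd⟩ := hex c hcr
      obtain ⟨w, hw⟩ := ih d (by have := hdep c d hd; omega)
      exact ⟨.cons (hadj c d hd) w, by simp [hw]⟩
  have hconn : (SimpleGraph.fromRel R).Connected := by
    have : Nonempty V := ⟨r⟩
    refine SimpleGraph.Connected.mk fun c d => ?_
    obtain ⟨w, -⟩ := hw _ c rfl
    obtain ⟨w', -⟩ := hw _ d rfl
    exact ⟨w.append w'.reverse⟩
  -- Depth changes by one along each edge, so it bounds walks to the root from below; walks through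
  -- successive parents attain the bound.
  have hle : ∀ c d (w : (SimpleGraph.fromRel R).Walk c d), dep c ≤ dep d + w.length := by
    intro c d w
    induction w with
    | nil => simp
    | cons h w ih =>
      rw [SimpleGraph.fromRel_adj] at h
      rw [SimpleGraph.Walk.length_cons]
      rcases h.2 with h | h
      · have := hdep _ _ h; omega
      · have := hdep _ _ h; omega
  have hdist : ∀ c, (SimpleGraph.fromRel R).dist c r = dep c := by
    intro c
    apply le_antisymm
    · obtain ⟨w, hw⟩ := hw _ c rfl
      exact hw ▸ SimpleGraph.dist_le w
    · obtain ⟨w, hw⟩ := hconn.exists_walk_length_eq_dist c r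
      have := hle c r w
      omega
  refine ⟨SimpleGraph.isTree_iff_connected_and_card.2 ⟨hconn, ?_⟩, fun c d => ?_⟩
  · apply le_antisymm
    -- Every edge joins some non-root vertex to its parent, so there are at most |V| - 1 edges.
    · have hsurj : ∃ f : {c : V // c ≠ r} → (SimpleGraph.fromRel R).edgeSet,
          Function.Surjective f := by
        choose p hp using hex
        refine ⟨fun c => ⟨s(c.1, p c.1 c.2), hadj _ _ (hp _ c.2)⟩, ?_⟩
        rintro ⟨e, he⟩
        induction e using Sym2.ind with
        | _ a b =>
          rw [SimpleGraph.mem_edgeSet, SimpleGraph.fromRel_adj] at he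
          have key : ∀ a b, R a b → ∃ h : a ≠ r, p a h = b := by
            intro a b hab
            have har : a ≠ r := by
              rintro rfl
              have := hdep _ _ hab
              omega
            exact ⟨har, huniq a _ _ (hp a har) hab⟩
          rcases he.2 with h | h
          · obtain ⟨h1, h2⟩ := key a b h
            exact ⟨⟨a, h1⟩, Subtype.ext (by simp [h2])⟩
          · obtain ⟨h1, h2⟩ := key b a h
            exact ⟨⟨b, h1⟩, Subtype.ext (by simp [h2, Sym2.eq_swap])⟩
      obtain ⟨f, hf⟩ := hsurj
      have h1 := Nat.card_le_card_of_surjective f hf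
      have h2 : Nat.card {c : V // c ≠ r} + 1 = Nat.card V := by
        have := Fintype.ofFinite V
        rw [Nat.card_eq_fintype_card, Nat.card_eq_fintype_card, Fintype.card_subtype_compl]
        have := Fintype.card_pos_iff.2 ⟨r⟩
        simp
        omega
      omega
    · exact hconn.card_vert_le_card_edgeSet_add_one
  · rw [hdist, hdist]
    refine ⟨fun h => ⟨hadj c d h, hdep c d h⟩, fun ⟨h1, h2⟩ => ?_⟩
    rw [SimpleGraph.fromRel_adj] at h1
    rcases h1.2 with h | h
    · exact h
    · have := hdep d c h
      omega

/-- A step to a closer neighbour followed by a geodesic is a path, and the path from `c` to `b` is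
unique. -/
theorem SimpleGraph.IsTree.existsUnique_closer {V : Type*} {G : SimpleGraph V} (hG : G.IsTree)
    {c b : V} (hcb : c ≠ b) : ∃! d, G.Adj c d ∧ G.dist c b = G.dist d b + 1 := by
  obtain ⟨w, hw⟩ := hG.connected.exists_walk_length_eq_dist c b
  have key : ∀ d, G.Adj c d → G.dist c b = G.dist d b + 1 → ∀ p : G.Walk c b, p.IsPath →
      p.snd = d := by
    intro d hd hdist p hp
    obtain ⟨q, hq⟩ := hG.connected.exists_walk_length_eq_dist d b
    have h1 : (SimpleGraph.Walk.cons hd q).IsPath :=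
      SimpleGraph.Walk.isPath_of_length_eq_dist _ (by simp [hq, hdist])
    rw [(hG.existsUnique_path c b).unique hp h1]
    simp
  have hp := SimpleGraph.Walk.isPath_of_length_eq_dist w hw
  cases w with
  | nil => exact absurd rfl hcb
  | @cons _ d _ h q =>
    have h1 : G.dist c b = G.dist d b + 1 := by
      have h2 := SimpleGraph.dist_le q
      have h3 := hG.dist_eq_dist_add_one_of_adj b h
      rw [SimpleGraph.dist_comm (u := b) (v := c), SimpleGraph.dist_comm (u := b) (v := d)] at h3
      rw [SimpleGraph.Walk.length_cons] at hw
      omega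
    refine ⟨d, ⟨h, h1⟩, fun d' hd' => ?_⟩
    rw [← key d' hd'.1 hd'.2 _ hp]
    simp

/-! ### Clusters of nodes and embeddings of digraphs. -/

namespace LDigraph

variable {n : ℕ}

/-- The indices of the inputs from which the node `a` is reachable. -/
noncomputable def cluster (G : LDigraph n) (a : G.V) : Finset (Fin n) :=
  (Set.toFinite {j | ∃ v, Relation.ReflTransGen G.Adj v a ∧
    G.label v = some (IOLabel.x j)}).toFinset

theorem mem_cluster {G : LDigraph n} {a : G.V} {j : Fin n} :
    j ∈ G.cluster a ↔ ∃ v, Relation.ReflTransGen G.Adj v a ∧ G.label v = some (IOLabel.x j) := by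
  simp [cluster]

theorem cluster_mono {G : LDigraph n} {a b : G.V} (h : Relation.ReflTransGen G.Adj a b) :
    G.cluster a ⊆ G.cluster b := by
  intro j hj
  obtain ⟨v, hv, hl⟩ := mem_cluster.1 hj
  exact mem_cluster.2 ⟨v, hv.trans h, hl⟩

/-- An embedding onto a full subgraph without edges entering it from outside. -/
structure LowerEmbedding (G H : LDigraph n) where
  toFun : G.V → H.V
  injective : Function.Injective toFun
  adj_iff : ∀ a b, H.Adj (toFun a) (toFun b) ↔ G.Adj a b
  label_eq : ∀ a, H.label (toFun a) = G.label a
  closed : ∀ a' b, H.Adj a' (toFun b) → ∃ a, toFun a = a'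

namespace LowerEmbedding

variable {G H : LDigraph n}

theorem reach (f : LowerEmbedding G H) {a b : G.V} (h : Relation.ReflTransGen G.Adj a b) :
    Relation.ReflTransGen H.Adj (f.toFun a) (f.toFun b) :=
  h.lift f.toFun fun c d hcd => (f.adj_iff c d).2 hcd

theorem exists_of_reach (f : LowerEmbedding G H) {x : H.V} {b : G.V}
    (h : Relation.ReflTransGen H.Adj x (f.toFun b)) :
    ∃ a, f.toFun a = x ∧ Relation.ReflTransGen G.Adj a b := by
  induction h using Relation.ReflTransGen.head_induction_on with
  | refl => exact ⟨b, rfl, .refl⟩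
  | head hxy _ ih =>
    obtain ⟨y, rfl, hy⟩ := ih
    obtain ⟨x, rfl⟩ := f.closed _ _ hxy
    exact ⟨x, rfl, .head ((f.adj_iff _ _).1 hxy) hy⟩

theorem cluster_eq (f : LowerEmbedding G H) (a : G.V) : H.cluster (f.toFun a) = G.cluster a := by
  ext j
  rw [mem_cluster, mem_cluster]
  constructor
  · rintro ⟨v, hv, hl⟩
    obtain ⟨u, rfl, hu⟩ := f.exists_of_reach hv
    exact ⟨u, hu, by rw [← hl, f.label_eq]⟩
  · rintro ⟨v, hv, hl⟩
    exact ⟨_, f.reach hv, by rw [f.label_eq, hl]⟩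

theorem sameSubtree (f : LowerEmbedding G H) (a : G.V) : SameSubtree G a H (f.toFun a) := by
  refine ⟨⟨Equiv.ofBijective (fun b => ⟨f.toFun b.1, f.reach b.2⟩) ⟨?_, ?_⟩, ?_, ?_⟩, rfl⟩
  · rintro ⟨b, hb⟩ ⟨c, hc⟩ h
    exact Subtype.ext (f.injective (Subtype.ext_iff.1 h))
  · rintro ⟨x, hx⟩
    obtain ⟨b, rfl, hb⟩ := f.exists_of_reach hx
    exact ⟨⟨b, hb⟩, rfl⟩
  · exact fun b c => f.adj_iff b.1 c.1
  · exact fun b => f.label_eq b.1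

theorem nonempty_iso (f : LowerEmbedding G H) (hf : Function.Surjective f.toFun) :
    Nonempty (Iso G H) :=
  ⟨⟨Equiv.ofBijective f.toFun ⟨f.injective, hf⟩, f.adj_iff, f.label_eq⟩⟩

end LowerEmbedding

/-- The inclusion of `E(a, G)` into `G`. -/
def enteringEmbedding (G : LDigraph n) (a : G.V) : LowerEmbedding (G.entering a) G where
  toFun b := b.1
  injective := Subtype.val_injective
  adj_iff _ _ := Iff.rfl
  label_eq _ := rfl
  closed b c h := ⟨⟨b, .head h c.2⟩, rfl⟩

def Iso.toLowerEmbedding {G H : LDigraph n} (e : Iso G H) : LowerEmbedding G H where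
  toFun := e.toEquiv
  injective := e.toEquiv.injective
  adj_iff := e.adj_iff
  label_eq := e.label_eq
  closed a' _ _ := e.toEquiv.surjective a'

theorem SameSubtree.cluster_eq {G H : LDigraph n} {a : G.V} {b : H.V} (h : SameSubtree G a H b) :
    G.cluster a = H.cluster b := by
  obtain ⟨e, he⟩ := h
  have h1 := (G.enteringEmbedding a).cluster_eq (G.enteringRoot a)
  have h2 := (H.enteringEmbedding b).cluster_eq (H.enteringRoot b)
  have h3 := e.toLowerEmbedding.cluster_eq (G.enteringRoot a)
  have h4 : e.toLowerEmbedding.toFun (G.enteringRoot a) = H.enteringRoot b := he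
  rw [h4] at h3
  exact h1.trans (h3.symm.trans h2.symm)

/-- Embeddings of the `S i` which cover `K` identify `⋁ i, S i` with `K`. -/
theorem nonempty_vee_iso {ι : Type} [Finite ι] (S : ι → LDigraph n) (K : LDigraph n)
    (f : ∀ i, LowerEmbedding (S i) K) (hf : ∀ k, ∃ i a, (f i).toFun a = k)
    (hK : ∀ a b, a ≠ b → ¬ SameSubtree K a K b) : Nonempty (Iso (vee S) K) := by
  -- Embeddings preserve subtrees, and `hK` says that distinct nodes of `K` have distinct subtrees;
  -- so identified nodes have the same image.
  let F : (vee S).V → K.V := Quotient.lift (fun p : Σ i, (S i).V => (f p.1).toFun p.2) <| by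
    rintro ⟨i, a⟩ ⟨k, b⟩ h
    by_contra hne
    exact hK _ _ hne ((((f i).sameSubtree a).symm.trans h).trans ((f k).sameSubtree b))
  refine LowerEmbedding.nonempty_iso ⟨F, ?_, ?_, ?_, ?_⟩ ?_
  · rintro ⟨i, a⟩ ⟨k, b⟩ h
    refine Quotient.sound ?_
    have h1 := (f i).sameSubtree a
    have h2 := (f k).sameSubtree b
    change (f i).toFun a = (f k).toFun b at h
    rw [h] at h1
    exact h1.trans h2.symm
  · rintro P ⟨k, b⟩
    constructor
    · intro h
      change K.Adj (F P) ((f k).toFun b) at h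
      obtain ⟨a, ha⟩ := (f k).closed _ _ h
      refine ⟨k, a, b, ((f k).adj_iff a b).1 (ha ▸ h), ?_, rfl⟩
      obtain ⟨i, c⟩ := P
      refine Quotient.sound ?_
      have h1 := (f i).sameSubtree c
      have h2 := (f k).sameSubtree a
      change (f k).toFun a = (f i).toFun c at ha
      rw [← ha] at h1
      exact h1.trans h2.symm
    · rintro ⟨i, a, c, hac, rfl, hQ⟩
      have h1 : F (Quotient.mk (veeSetoid S) ⟨k, b⟩) = F (Quotient.mk (veeSetoid S) ⟨i, c⟩) :=
        congrArg F hQ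
      have h2 : K.Adj ((f i).toFun a) ((f i).toFun c) := ((f i).adj_iff a c).2 hac
      change F (Quotient.mk (veeSetoid S) ⟨k, b⟩) = (f i).toFun c at h1
      rw [← h1] at h2
      exact h2
  · rintro ⟨i, a⟩
    exact (f i).label_eq a
  · rintro k ⟨i, b⟩ h
    obtain ⟨a, ha⟩ := (f i).closed _ _ h
    exact ⟨Quotient.mk (veeSetoid S) ⟨i, a⟩, ha⟩
  · intro k
    obtain ⟨i, a, ha⟩ := hf k
    exact ⟨Quotient.mk (veeSetoid S) ⟨i, a⟩, ha⟩

theorem isDBT_of_parent {G : LDigraph n} {r : G.V} {dep : G.V → ℕ} (h0 : dep r = 0)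
    (hdep : ∀ c d, G.Adj c d → dep c = dep d + 1) (hex : ∀ c, c ≠ r → ∃ d, G.Adj c d)
    (huniq : ∀ c d d', G.Adj c d → G.Adj c d' → d = d')
    (hcard : ∀ d, {c | G.Adj c d}.ncard = 0 ∨ {c | G.Adj c d}.ncard = 2) : G.IsDBT := by
  have := G.finite_V
  obtain ⟨h1, h2⟩ := SimpleGraph.isTree_fromRel_of_parent h0 hdep hex huniq
  exact ⟨_, r, h1, h2, hcard⟩

theorem IsDBT.adj_unique {G : LDigraph n} (h : G.IsDBT) {c d d' : G.V} (hd : G.Adj c d)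
    (hd' : G.Adj c d') : d = d' := by
  obtain ⟨T, r, hT, hadj, -⟩ := h
  rw [hadj] at hd hd'
  have hcr : c ≠ r := by
    rintro rfl
    have := hd.2
    rw [SimpleGraph.dist_self] at this
    omega
  exact (hT.existsUnique_closer hcr).unique hd hd'

end LDigraph

/-! ### The structure built from a split system. -/

namespace LDigraph

open SetSystem

variable {n : ℕ}

theorem card_eq_complexity_add {G : LDigraph n}
    (hu : ∀ a b l, G.label a = some l → G.label b = some l → a = b)
    (hx : ∀ j, ∃ a, G.label a = some (IOLabel.x j)) : Nat.card G.V = G.complexity + n := by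
  have := G.finite_V
  have h1 : {a : G.V | G.IsInput a}.ncard = n := by
    choose f hf using hx
    have h2 : {a : G.V | G.IsInput a} = Set.range f := by
      ext a
      constructor
      · rintro ⟨j, hj⟩
        exact ⟨j, hu _ _ _ (hf j) hj⟩
      · rintro ⟨j, rfl⟩
        exact ⟨j, hf j⟩
    have hinj : Function.Injective f := by
      intro i j hij
      have h3 := hf i
      rw [hij, hf j] at h3
      simpa using h3.symm
    rw [h2, ← Nat.card_coe_set_eq, Nat.card_range_of_injective hinj, Nat.card_fin]
  have h2 := Set.ncard_add_ncard_compl {a : G.V | G.IsInput a}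
  rw [h1] at h2
  rw [← h2, add_comm]
  rfl

/-- The label of a node with a given cluster: singletons are inputs, and the complements of
singletons are outputs. -/
noncomputable def clusterLabel (c : Finset (Fin n)) : Option (IOLabel n) :=
  open Classical in
  if h : ∃ j, c = {j} then some (IOLabel.x h.choose)
  else if h : ∃ j, c = Finset.univ.erase j then some (IOLabel.y h.choose)
  else none

theorem singleton_ne_erase (hn : 3 ≤ n) (i j : Fin n) : {i} ≠ Finset.univ.erase j := by
  intro h
  have := congrArg Finset.card h
  rw [Finset.card_singleton, Finset.card_erase_of_mem (Finset.mem_univ j), Finset.card_univ,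
    Fintype.card_fin] at this
  omega

theorem erase_injective {i j : Fin n} (h : Finset.univ.erase i = Finset.univ.erase j) : i = j :=
  (Finset.erase_inj _ (Finset.mem_univ i)).1 h

theorem clusterLabel_eq_x {c : Finset (Fin n)} {j : Fin n} :
    clusterLabel c = some (IOLabel.x j) ↔ c = {j} := by
  unfold clusterLabel
  split_ifs with h h'
  · have h1 := h.choose_spec
    rw [Option.some_inj, IOLabel.x.injEq]
    constructor
    · exact fun h2 => h2 ▸ h1
    · intro h2
      exact Finset.singleton_injective (h1.symm.trans h2)
  · simp only [Option.some_inj, reduceCtorEq, false_iff]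
    exact fun h2 => h ⟨j, h2⟩
  · simp only [false_iff]
    exact fun h2 => h ⟨j, h2⟩

theorem clusterLabel_eq_y (hn : 3 ≤ n) {c : Finset (Fin n)} {j : Fin n} :
    clusterLabel c = some (IOLabel.y j) ↔ c = Finset.univ.erase j := by
  unfold clusterLabel
  split_ifs with h h'
  · simp only [Option.some_inj, reduceCtorEq, false_iff]
    obtain ⟨i, rfl⟩ := h
    exact singleton_ne_erase hn i j
  · have h1 := h'.choose_spec
    rw [Option.some_inj, IOLabel.y.injEq]
    constructor
    · exact fun h2 => h2 ▸ h1
    · intro h2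
      exact erase_injective (h1.symm.trans h2)
  · simp only [false_iff]
    exact fun h2 => h' ⟨j, h2⟩

theorem eq_of_label_eq_clusterLabel {c : Finset (Fin n)} {o : Option (IOLabel n)} (hn : 3 ≤ n)
    (hx : ∀ j, o = some (IOLabel.x j) ↔ c = {j})
    (hy : ∀ j, o = some (IOLabel.y j) ↔ c = Finset.univ.erase j) : o = clusterLabel c := by
  rcases h : clusterLabel c with _ | ⟨j | j⟩
  · rcases o with _ | ⟨j | j⟩
    · rfl
    · rw [clusterLabel_eq_x.2 ((hx j).1 rfl)] at h
      exact absurd h (by simp)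
    · rw [(clusterLabel_eq_y hn).2 ((hy j).1 rfl)] at h
      exact absurd h (by simp)
  · exact (hx j).2 (clusterLabel_eq_x.1 h)
  · exact (hy j).2 ((clusterLabel_eq_y hn).1 h)

/-- The digraph of a system of clusters: the children of a cluster are the two clusters into
which it splits. -/
noncomputable def ofClusters (C : Finset (Finset (Fin n))) : LDigraph n where
  V := {c // c ∈ C}
  finite_V := inferInstance
  Adj c d := ∃ e ∈ C, Disjoint c.1 e ∧ c.1 ∪ e = d.1
  label c := clusterLabel c.1

theorem card_univ_fin (n : ℕ) : (Finset.univ : Finset (Fin n)).card = n := by simp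

section

variable {C : Finset (Finset (Fin n))}

theorem ofClusters_label_eq_x {c : (ofClusters C).V} {j : Fin n} :
    (ofClusters C).label c = some (IOLabel.x j) ↔ c.1 = {j} :=
  clusterLabel_eq_x

theorem ofClusters_ssubset (hC : SplitSystem Finset.univ C) {c d : (ofClusters C).V}
    (h : (ofClusters C).Adj c d) : c.1 ⊂ d.1 := by
  obtain ⟨e, he, hd, hu⟩ := h
  rw [← hu]
  exact ssubset_union_of_disjoint hd (hC.nonempty he).ne_empty

theorem ofClusters_exists_parent (hC : SplitSystem Finset.univ C) {c d : (ofClusters C).V}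
    (h : c.1 ⊂ d.1) : ∃ e, (ofClusters C).Adj c e ∧ e.1 ⊆ d.1 := by
  obtain ⟨e, he, hd, hu⟩ := (hC.hierarchy_below d.2).exists_sibling
    (Finset.mem_filter.2 ⟨c.2, h.1⟩) h.ne
  rw [Finset.mem_filter] at he hu
  exact ⟨⟨c.1 ∪ e, hu.1⟩, ⟨e, he.1, hd, rfl⟩, hu.2⟩

/-- A cluster may have several parents, one for each direction in the unrooted tree; the one taken
in the hierarchy below `d` stays inside `d`, so repeated steps reach `d`. -/
theorem ofClusters_reach_iff (hC : SplitSystem Finset.univ C) {c d : (ofClusters C).V} :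
    Relation.ReflTransGen (ofClusters C).Adj c d ↔ c.1 ⊆ d.1 := by
  constructor
  · intro h
    induction h with
    | refl => exact subset_rfl
    | tail _ h ih => exact ih.trans (ofClusters_ssubset hC h).1
  · intro h
    by_cases hcd : c.1 = d.1
    · rw [Subtype.ext hcd]
    obtain ⟨k, hk⟩ : ∃ k, d.1.card - c.1.card = k := ⟨_, rfl⟩
    induction k using Nat.strong_induction_on generalizing c with
    | _ k ih =>
      obtain ⟨e, hce, hed⟩ := ofClusters_exists_parent hC
        (Finset.ssubset_iff_subset_ne.2 ⟨h, hcd⟩)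
      refine .head hce ?_
      by_cases hed' : e.1 = d.1
      · rw [Subtype.ext hed']
      have h1 := Finset.card_lt_card (ofClusters_ssubset hC hce)
      have h2 := Finset.card_le_card hed
      exact ih _ (by omega) hed hed' rfl

theorem ofClusters_cluster (hn : 3 ≤ n) (hC : SplitSystem Finset.univ C) (c : (ofClusters C).V) :
    (ofClusters C).cluster c = c.1 := by
  ext j
  rw [mem_cluster]
  constructor
  · rintro ⟨v, hv, hl⟩
    rw [ofClusters_reach_iff hC, ofClusters_label_eq_x.1 hl] at hv
    simpa using hv
  · intro hj
    refine ⟨⟨{j}, hC.singleton_mem (by rw [card_univ_fin]; omega) (Finset.mem_univ j)⟩,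
      (ofClusters_reach_iff hC).2 ?_, clusterLabel_eq_x.2 rfl⟩
    exact Finset.singleton_subset_iff.2 hj

theorem ofClusters_not_adj {c : (ofClusters C).V} (hC : SplitSystem Finset.univ C) {j : Fin n}
    (hc : c.1 = {j}) (b : (ofClusters C).V) : ¬ (ofClusters C).Adj b c := by
  intro h
  have h1 := ofClusters_ssubset hC h
  rw [hc, Finset.ssubset_singleton_iff] at h1
  exact (hC.nonempty b.2).ne_empty h1

theorem ofClusters_exists_children (hC : SplitSystem Finset.univ C) {d : (ofClusters C).V}
    (hd : d.1.Nontrivial) : ∃ a b, a ≠ b ∧ ∀ x, (ofClusters C).Adj x d ↔ x = a ∨ x = b := by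
  obtain ⟨a, ha, b, hb, hab, hu⟩ := hC.splits d.1 d.2 hd
  refine ⟨⟨a, ha⟩, ⟨b, hb⟩, ?_, fun x => ⟨?_, ?_⟩⟩
  · intro h
    obtain ⟨k, hk⟩ := hC.nonempty ha
    have : a = b := Subtype.ext_iff.1 h
    exact Finset.disjoint_left.1 hab hk (this ▸ hk)
  · rintro ⟨e, he, hxe, hu'⟩
    rcases hC.split_unique x.2 he ha hb hxe hab (hu'.trans hu.symm) (hu' ▸ d.2) with h | h
    · exact Or.inl (Subtype.ext h.1)
    · exact Or.inr (Subtype.ext h.1)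
  · rintro (rfl | rfl)
    · exact ⟨b, hb, hab, hu⟩
    · exact ⟨a, ha, hab.symm, by rw [Finset.union_comm]; exact hu⟩

theorem ofClusters_isDBT (hC : SplitSystem Finset.univ C) (d : (ofClusters C).V) :
    ((ofClusters C).entering d).IsDBT := by
  have hH := hC.hierarchy_below d.2
  have hmem : ∀ x : ((ofClusters C).entering d).V, x.1.1 ∈ C.filter (· ⊆ d.1) := fun x =>
    Finset.mem_filter.2 ⟨x.1.2, (ofClusters_reach_iff hC).1 x.2⟩
  have hsib : ∀ x y : ((ofClusters C).entering d).V, ∀ e ∈ C, x.1.1 ∪ e = y.1.1 →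
      e ∈ C.filter (· ⊆ d.1) := fun x y e he hu => Finset.mem_filter.2 ⟨he,
    Finset.union_subset_right (hu ▸ (Finset.mem_filter.1 (hmem y)).2)⟩
  refine isDBT_of_parent (r := (ofClusters C).enteringRoot d)
    -- Depth counts the strictly larger clusters inside `d`; restricting to these makes parents
    -- unique.
    (dep := fun x => ((C.filter (· ⊆ d.1)).filter (x.1.1 ⊂ ·)).card) ?_ ?_ ?_ ?_ ?_
  · rw [Finset.card_eq_zero, Finset.filter_eq_empty_iff]
    intro y hy hlt
    exact hlt.2 (Finset.mem_filter.1 hy).2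
  · rintro x y ⟨e, he, hd, hu⟩
    have he' := hsib x y e he hu
    have h1 := hH.card_filter_ssubset (hmem x) he' hd (hu ▸ hmem y)
    rwa [hu] at h1
  · intro x hx
    have h1 : x.1.1 ⊂ d.1 := by
      refine Finset.ssubset_iff_subset_ne.2 ⟨(ofClusters_reach_iff hC).1 x.2, fun h => hx ?_⟩
      exact Subtype.ext (Subtype.ext h)
    obtain ⟨e, he, hed⟩ := ofClusters_exists_parent hC h1
    exact ⟨⟨e, (ofClusters_reach_iff hC).2 hed⟩, he⟩
  · rintro x y y' ⟨e, he, hd, hu⟩ ⟨e', he', hd', hu'⟩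
    have h1 := hH.union_unique (hmem x) (hsib x y e he hu) (hsib x y' e' he' hu') hd hd'
      (hu ▸ hmem y) (hu' ▸ hmem y')
    exact Subtype.ext (Subtype.ext (by rw [← hu, ← hu', h1]))
  · intro x
    rcases singleton_or_nontrivial hC.empty_notMem x.1.2 with ⟨j, hj⟩ | hnt
    · left
      have := ((ofClusters C).entering d).finite_V
      rw [Set.ncard_eq_zero, Set.eq_empty_iff_forall_notMem]
      exact fun y hy => ofClusters_not_adj hC hj y.1 hy
    · right
      obtain ⟨a, b, hab, h⟩ := ofClusters_exists_children hC hnt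
      have ha : Relation.ReflTransGen (ofClusters C).Adj a d := .head ((h a).2 (Or.inl rfl)) x.2
      have hb : Relation.ReflTransGen (ofClusters C).Adj b d := .head ((h b).2 (Or.inr rfl)) x.2
      rw [Set.ncard_eq_two]
      refine ⟨⟨a, ha⟩, ⟨b, hb⟩, fun h' => hab (Subtype.ext_iff.1 h'), ?_⟩
      ext y
      refine (h y.1).trans ⟨?_, ?_⟩
      · exact fun h' => h'.imp (fun h1 => Subtype.ext h1) fun h1 => Subtype.ext h1
      · exact fun h' => h'.imp (fun h1 => Subtype.ext_iff.1 h1) fun h1 => Subtype.ext_iff.1 h1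

theorem ofClusters_isInput {c : (ofClusters C).V} :
    (ofClusters C).IsInput c ↔ ∃ j, c.1 = {j} :=
  exists_congr fun _ => clusterLabel_eq_x

theorem ofClusters_label_unique (hn : 3 ≤ n) (a b : (ofClusters C).V) (l : IOLabel n)
    (ha : (ofClusters C).label a = some l) (hb : (ofClusters C).label b = some l) : a = b := by
  rcases l with j | j
  · exact Subtype.ext ((clusterLabel_eq_x.1 ha).trans (clusterLabel_eq_x.1 hb).symm)
  · exact Subtype.ext (((clusterLabel_eq_y hn).1 ha).trans ((clusterLabel_eq_y hn).1 hb).symm)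

theorem ofClusters_input_iff (hC : SplitSystem Finset.univ C) (a : (ofClusters C).V) :
    (ofClusters C).IsInput a ↔ ∀ b, ¬ (ofClusters C).Adj b a := by
  rw [ofClusters_isInput]
  constructor
  · rintro ⟨j, hj⟩
    exact ofClusters_not_adj hC hj
  · intro h
    refine (singleton_or_nontrivial hC.empty_notMem a.2).resolve_right fun hnt => ?_
    obtain ⟨u, w, -, hu⟩ := ofClusters_exists_children hC hnt
    exact h u ((hu u).2 (Or.inl rfl))

theorem ofClusters_subtree_ne (hn : 3 ≤ n) (hC : SplitSystem Finset.univ C)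
    (a b : (ofClusters C).V) (hab : a ≠ b) : ¬ SameSubtree (ofClusters C) a (ofClusters C) b := by
  intro h
  have h1 := h.cluster_eq
  rw [ofClusters_cluster hn hC, ofClusters_cluster hn hC] at h1
  exact hab (Subtype.ext h1)

theorem ofClusters_computesY (hn : 3 ≤ n) (hC : SplitSystem Finset.univ C) :
    (ofClusters C).ComputesY where
  label_unique := ofClusters_label_unique hn
  acyclic a h := by
    have key : ∀ a b, Relation.TransGen (ofClusters C).Adj a b → a.1 ⊂ b.1 := by
      intro a b h
      induction h with
      | single h => exact ofClusters_ssubset hC h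
      | tail _ h ih => exact ih.trans (ofClusters_ssubset hC h)
    exact (key a a h).2 subset_rfl
  input_iff := ofClusters_input_iff hC
  isDBT := ofClusters_isDBT hC
  subtree_ne := ofClusters_subtree_ne hn hC
  output_iff a := by
    have hlab : (∃ j, (ofClusters C).label a = some (IOLabel.y j)) ↔
        ∃ j, a.1 = Finset.univ.erase j := exists_congr fun _ => clusterLabel_eq_y hn
    rw [hlab]
    constructor
    · rintro ⟨-, h2⟩
      -- A cluster missing `j` lies in the complement of `j`; if strictly, it has a parent and is no
      -- sink.
      obtain ⟨j, -, hj⟩ := Finset.exists_of_ssubset (hC.ssubset_top a.1 a.2)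
      refine ⟨j, ?_⟩
      by_contra hne
      have hsub : a.1 ⊂ Finset.univ.erase j := Finset.ssubset_iff_subset_ne.2
        ⟨fun k hk => Finset.mem_erase.2 ⟨fun h => hj (h ▸ hk), Finset.mem_univ k⟩, hne⟩
      obtain ⟨e, he, -⟩ := ofClusters_exists_parent (C := C) hC (c := a)
        (d := ⟨_, hC.erase_mem j (Finset.mem_univ j)⟩) hsub
      exact h2 e he
    · rintro ⟨j, hj⟩
      constructor
      · rw [ofClusters_isInput]
        rintro ⟨i, hi⟩
        exact singleton_ne_erase hn i j (hi.symm.trans hj)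
      · intro b hab
        have h1 := ofClusters_ssubset hC hab
        have h2 := hC.ssubset_top b.1 b.2
        have h3 := Finset.card_lt_card h1
        have h4 := Finset.card_lt_card h2
        rw [hj, Finset.card_erase_of_mem (Finset.mem_univ j)] at h3
        omega
  exists_output j := ⟨⟨_, hC.erase_mem j (Finset.mem_univ j)⟩, (clusterLabel_eq_y hn).2 rfl⟩
  leaves j a ha := by
    have ha : a.1 = Finset.univ.erase j := (clusterLabel_eq_y hn).1 ha
    ext l
    constructor
    · rintro ⟨b, hb, rfl⟩
      have h1 : ∀ c, ¬ (ofClusters C).Adj c b.1 := fun c hc => hb ⟨c, .head hc b.2⟩ hc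
      rw [← ofClusters_input_iff hC] at h1
      obtain ⟨i, hi⟩ := h1
      refine ⟨i, ?_, hi⟩
      have h2 := (ofClusters_reach_iff hC).1 b.2
      rw [ofClusters_label_eq_x.1 hi, ha] at h2
      simpa using h2
    · rintro ⟨i, hi, rfl⟩
      let v : (ofClusters C).V :=
        ⟨{i}, hC.singleton_mem (by rw [card_univ_fin]; omega) (Finset.mem_univ i)⟩
      have hv : Relation.ReflTransGen (ofClusters C).Adj v a := by
        rw [ofClusters_reach_iff hC, ha]
        simpa [v] using hi
      exact ⟨⟨v, hv⟩, fun c hc => ofClusters_not_adj hC rfl c.1 hc, clusterLabel_eq_x.2 rfl⟩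

/-- Of the 4n - 6 clusters, n are inputs. -/
theorem ofClusters_complexity (hn : 3 ≤ n) (hC : SplitSystem Finset.univ C) :
    (ofClusters C).complexity + 6 = 3 * n := by
  have h1 := card_eq_complexity_add (G := ofClusters C) (ofClusters_label_unique hn)
    fun j => ⟨⟨{j}, hC.singleton_mem (by rw [card_univ_fin]; omega) (Finset.mem_univ j)⟩,
      clusterLabel_eq_x.2 rfl⟩
  have h2 : Nat.card (ofClusters C).V = C.card := by
    change Nat.card {c // c ∈ C} = C.card
    simp
  have h3 := hC.card_eq (R := Finset.univ) ⟨⟨0, by omega⟩, Finset.mem_univ _⟩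
  rw [card_univ_fin] at h3
  omega

theorem eq_of_ofClusters_iso (hn : 3 ≤ n) {D : Finset (Finset (Fin n))}
    (hC : SplitSystem Finset.univ C) (hD : SplitSystem Finset.univ D)
    (h : Nonempty (Iso (ofClusters C) (ofClusters D))) : C = D := by
  have key : ∀ {C D : Finset (Finset (Fin n))}, SplitSystem Finset.univ C →
      SplitSystem Finset.univ D → Iso (ofClusters C) (ofClusters D) → C ⊆ D := by
    intro C D hC hD e c hc
    have h1 := e.toLowerEmbedding.cluster_eq (⟨c, hc⟩ : (ofClusters C).V)
    rw [ofClusters_cluster hn hD] at h1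
    have h2 : (ofClusters C).cluster ⟨c, hc⟩ = c := ofClusters_cluster hn hC ⟨c, hc⟩
    rw [h2] at h1
    rw [← h1]
    exact Subtype.prop _
  obtain ⟨e⟩ := h
  exact Finset.Subset.antisymm (key hC hD e) (key hD hC e.symm)

/-- A digraph whose nodes are determined by their clusters, and in which the clusters of the
children of a node split its cluster, embeds into the digraph of the clusters. -/
theorem exists_lowerEmbedding_ofClusters (hC : SplitSystem Finset.univ C) {G : LDigraph n}
    (hmem : ∀ v, G.cluster v ∈ C) (hinj : Function.Injective G.cluster)
    (hchild : ∀ v u, G.Adj u v → ∃ w, G.Adj w v ∧ Disjoint (G.cluster u) (G.cluster w) ∧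
      G.cluster u ∪ G.cluster w = G.cluster v)
    (hleaf : ∀ v, (∀ u, ¬ G.Adj u v) → ∃ j, G.cluster v = {j})
    (hlab : ∀ v, G.label v = clusterLabel (G.cluster v)) :
    ∃ f : LowerEmbedding G (ofClusters C), ∀ v, (f.toFun v).1 = G.cluster v := by
  have hadj : ∀ a b, G.Adj a b →
      (ofClusters C).Adj ⟨G.cluster a, hmem a⟩ ⟨G.cluster b, hmem b⟩ := by
    intro a b h
    obtain ⟨w, -, hd, hu⟩ := hchild b a h
    exact ⟨G.cluster w, hmem w, hd, hu⟩
  have hclosed : ∀ x b, (ofClusters C).Adj x ⟨G.cluster b, hmem b⟩ →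
      ∃ a, G.Adj a b ∧ G.cluster a = x.1 := by
    rintro x b h
    have hex : ∃ u, G.Adj u b := by
      by_contra! hno
      obtain ⟨j, hj⟩ := hleaf b hno
      exact ofClusters_not_adj hC hj x h
    obtain ⟨e, he, hd, hu⟩ := h
    obtain ⟨u, hu'⟩ := hex
    obtain ⟨w, hw, hd', huw⟩ := hchild b u hu'
    -- A cluster splits in only one way within `C`, so `x` is the cluster of one of the two children
    -- already in `G`.
    rcases hC.split_unique x.2 he (hmem u) (hmem w) hd hd' (hu.trans huw.symm) (hu ▸ hmem b)
      with h | h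
    · exact ⟨u, hu', h.1.symm⟩
    · exact ⟨w, hw, h.1.symm⟩
  refine ⟨⟨fun v => ⟨G.cluster v, hmem v⟩, fun a b h => hinj (Subtype.ext_iff.1 h),
    fun a b => ⟨fun h => ?_, hadj a b⟩, fun v => (hlab v).symm, fun x b h => ?_⟩, fun v => rfl⟩
  · obtain ⟨a', h1, h2⟩ := hclosed _ b h
    rwa [← hinj h2]
  · obtain ⟨a, -, ha⟩ := hclosed x b h
    exact ⟨a, Subtype.ext ha⟩

end

end LDigraph

/-! ### Clusters of a structure, the lower bound and the optimal structures. -/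

namespace LDigraph

open SetSystem

variable {n : ℕ}

/-- All clusters of nodes of `G`. -/
noncomputable def clusters (G : LDigraph n) : Finset (Finset (Fin n)) :=
  have := G.finite_V
  (Set.finite_range G.cluster).toFinset

theorem mem_clusters {G : LDigraph n} {c : Finset (Fin n)} :
    c ∈ G.clusters ↔ ∃ v, G.cluster v = c := by
  simp [clusters]

theorem cluster_mem_clusters {G : LDigraph n} (v : G.V) : G.cluster v ∈ G.clusters :=
  mem_clusters.2 ⟨v, rfl⟩

theorem cluster_eq_of_input {G : LDigraph n} {v : G.V} {j : Fin n}
    (hv : G.label v = some (IOLabel.x j)) (hno : ∀ u, ¬ G.Adj u v) : G.cluster v = {j} := by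
  ext i
  rw [mem_cluster, Finset.mem_singleton]
  constructor
  · rintro ⟨u, hu, hl⟩
    rcases Relation.ReflTransGen.cases_tail hu with rfl | ⟨w, -, hw⟩
    · rw [hv] at hl
      simpa using hl.symm
    · exact absurd hw (hno w)
  · rintro rfl
    exact ⟨v, .refl, hv⟩

/-- The cluster of a node which is not an input is the union of those of its children. -/
theorem mem_cluster_of_not_isInput {G : LDigraph n} {v : G.V} (hv : ¬ G.IsInput v) {j : Fin n} :
    j ∈ G.cluster v ↔ ∃ u, G.Adj u v ∧ j ∈ G.cluster u := by
  constructor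
  · intro hj
    obtain ⟨w, hw, hl⟩ := mem_cluster.1 hj
    rcases Relation.ReflTransGen.cases_tail hw with rfl | ⟨u, hu, huv⟩
    · exact absurd ⟨j, hl⟩ hv
    · exact ⟨u, huv, mem_cluster.2 ⟨w, hu, hl⟩⟩
  · rintro ⟨u, hu, hj⟩
    exact cluster_mono (.single hu) hj

namespace IsStructure

variable {S : LDigraph n}

theorem wellFounded (h : S.IsStructure) : WellFounded (Relation.TransGen S.Adj) := by
  have := S.finite_V
  have : Std.Irrefl (Relation.TransGen S.Adj) := ⟨h.acyclic⟩
  exact Finite.wellFounded_of_trans_of_irrefl _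

theorem wellFounded_swap (h : S.IsStructure) :
    WellFounded (Function.swap (Relation.TransGen S.Adj)) := by
  have := S.finite_V
  have : Std.Irrefl (Function.swap (Relation.TransGen S.Adj)) := ⟨h.acyclic⟩
  have : IsTrans _ (Function.swap (Relation.TransGen S.Adj)) := ⟨fun _ _ _ h1 h2 => h2.trans h1⟩
  exact Finite.wellFounded_of_trans_of_irrefl _

theorem cluster_nonempty (h : S.IsStructure) (v : S.V) : (S.cluster v).Nonempty := by
  induction v using h.wellFounded.induction with
  | _ v ih =>
    by_cases hv : ∀ u, ¬ S.Adj u v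
    · obtain ⟨j, hj⟩ := (h.input_iff v).2 hv
      exact ⟨j, mem_cluster.2 ⟨v, .refl, hj⟩⟩
    · push Not at hv
      obtain ⟨u, hu⟩ := hv
      exact (ih u (.single hu)).mono (cluster_mono (.single hu))

theorem exists_sink (h : S.IsStructure) (v : S.V) :
    ∃ s, Relation.ReflTransGen S.Adj v s ∧ ∀ b, ¬ S.Adj s b := by
  induction v using h.wellFounded_swap.induction with
  | _ v ih =>
    by_cases hv : ∀ u, ¬ S.Adj v u
    · exact ⟨v, .refl, hv⟩
    · push Not at hv
      obtain ⟨u, hu⟩ := hv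
      obtain ⟨s, hs, hno⟩ := ih u (.single hu)
      exact ⟨s, .head hu hs, hno⟩

/-- Inside E(v, S) the only edge out of `u` leads to `v`, so a path from `u` to `w` passes through
`v` and the edge from `w` to `v` closes a cycle. -/
theorem not_reach_of_ne (h : S.IsStructure) {u w v : S.V} (hu : S.Adj u v) (hw : S.Adj w v)
    (hne : u ≠ w)
    (hr : Relation.ReflTransGen (S.entering v).Adj ⟨u, .single hu⟩ ⟨w, .single hw⟩) : False := by
  rcases Relation.ReflTransGen.cases_head hr with heq | ⟨t, ht, htw⟩
  · exact hne (Subtype.ext_iff.1 heq)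
  · have h1 : t = S.enteringRoot v := (h.isDBT v).adj_unique ht hu
    subst h1
    have h2 := (S.enteringEmbedding v).reach htw
    exact h.acyclic v (Relation.TransGen.tail' h2 hw)

/-- From a common input two paths lead to `u` and to `w` within E(v, S), where parents are unique;
so one of the children would be reachable from the other. -/
theorem disjoint_cluster (h : S.IsStructure) {u w v : S.V} (hu : S.Adj u v) (hw : S.Adj w v)
    (hne : u ≠ w) : Disjoint (S.cluster u) (S.cluster w) := by
  rw [Finset.disjoint_left]
  intro j hju hjw
  obtain ⟨s, hs, hl⟩ := mem_cluster.1 hju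
  obtain ⟨s', hs', hl'⟩ := mem_cluster.1 hjw
  obtain rfl := h.label_unique s s' _ hl hl'
  obtain ⟨a, ha, hau⟩ := (S.enteringEmbedding v).exists_of_reach (b := ⟨u, .single hu⟩) hs
  obtain ⟨b, hb, hbw⟩ := (S.enteringEmbedding v).exists_of_reach (b := ⟨w, .single hw⟩) hs'
  obtain rfl : a = b := Subtype.ext (ha.trans hb.symm)
  have hU : Relator.RightUnique (S.entering v).Adj := fun _ _ _ h1 h2 =>
    (h.isDBT v).adj_unique h1 h2
  rcases Relation.ReflTransGen.total_of_right_unique hU hau hbw with h1 | h1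
  · exact h.not_reach_of_ne hu hw hne h1
  · exact h.not_reach_of_ne hw hu hne.symm h1

theorem exists_sibling (h : S.IsStructure) {u v : S.V} (hu : S.Adj u v) :
    ∃ w, S.Adj w v ∧ Disjoint (S.cluster u) (S.cluster w) ∧
      S.cluster u ∪ S.cluster w = S.cluster v := by
  have hin : ¬ S.IsInput v := fun h' => (h.input_iff v).1 h' u hu
  obtain ⟨T, r, -, -, hcard⟩ := h.isDBT v
  have hfin := (S.entering v).finite_V
  have hu' : (⟨u, .single hu⟩ : (S.entering v).V) ∈
      {c | (S.entering v).Adj c (S.enteringRoot v)} := hu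
  have h2 : {c | (S.entering v).Adj c (S.enteringRoot v)}.ncard = 2 := by
    refine (hcard (S.enteringRoot v)).resolve_left fun h0 => ?_
    rw [Set.ncard_eq_zero] at h0
    rw [h0] at hu'
    exact hu'
  obtain ⟨a, b, hab, heq⟩ := Set.ncard_eq_two.1 h2
  have hadj : ∀ x, S.Adj x v ↔ x = a.1 ∨ x = b.1 := by
    intro x
    constructor
    · intro hx
      have : (⟨x, .single hx⟩ : (S.entering v).V) ∈
        {c | (S.entering v).Adj c (S.enteringRoot v)} := hx
      rw [heq] at this
      exact this.imp (fun h1 => Subtype.ext_iff.1 h1) fun h1 => Subtype.ext_iff.1 h1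
    · intro hx
      have ha : a ∈ {c | (S.entering v).Adj c (S.enteringRoot v)} := heq ▸ Or.inl rfl
      have hb : b ∈ {c | (S.entering v).Adj c (S.enteringRoot v)} := heq ▸ Or.inr rfl
      rcases hx with rfl | rfl
      exacts [ha, hb]
  have hne : a.1 ≠ b.1 := fun h' => hab (Subtype.ext h')
  have hd := h.disjoint_cluster ((hadj a.1).2 (Or.inl rfl)) ((hadj b.1).2 (Or.inr rfl)) hne
  have hun : S.cluster a.1 ∪ S.cluster b.1 = S.cluster v := by
    ext j
    rw [Finset.mem_union, mem_cluster_of_not_isInput hin]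
    simp only [hadj, or_and_right, exists_or, exists_eq_left]
  rcases (hadj u).1 hu with rfl | rfl
  · exact ⟨b.1, (hadj _).2 (Or.inr rfl), hd, hun⟩
  · exact ⟨a.1, (hadj _).2 (Or.inl rfl), hd.symm, by rw [Finset.union_comm, hun]⟩

theorem exists_cluster_eq_singleton (h : S.IsStructure) {v : S.V} (hno : ∀ u, ¬ S.Adj u v) :
    ∃ j, S.cluster v = {j} := by
  obtain ⟨j, hj⟩ := (h.input_iff v).2 hno
  exact ⟨j, cluster_eq_of_input hj hno⟩

end IsStructure

namespace ComputesY

variable {S : LDigraph n}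

theorem cluster_output (h : S.ComputesY) {a : S.V} {j : Fin n}
    (ha : S.label a = some (IOLabel.y j)) : S.cluster a = Finset.univ.erase j := by
  have hl := h.leaves j a ha
  ext i
  rw [mem_cluster, Finset.mem_erase]
  have hi : some (IOLabel.x i) ∈ (S.entering a).leafLabels ↔ i ≠ j := by
    rw [hl]
    constructor
    · rintro ⟨k, hk, h'⟩
      simp only [Option.some_inj, IOLabel.x.injEq] at h'
      exact h' ▸ hk
    · exact fun h' => ⟨i, h', rfl⟩
  simp only [Finset.mem_univ, and_true]
  rw [← hi]
  constructor
  · rintro ⟨v, hv, hlv⟩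
    exact ⟨⟨v, hv⟩, fun b hb => (h.input_iff v).1 ⟨i, hlv⟩ b.1 hb, hlv⟩
  · rintro ⟨v, -, hlv⟩
    exact ⟨v.1, v.2, hlv⟩

theorem exists_input (h : S.ComputesY) (hn : 3 ≤ n) (j : Fin n) :
    ∃ a, S.label a = some (IOLabel.x j) := by
  have : Nontrivial (Fin n) := Fin.nontrivial_iff_two_le.2 (by omega)
  obtain ⟨i, hij⟩ := exists_ne j
  obtain ⟨a, ha⟩ := h.exists_output i
  have hj : j ∈ S.cluster a := by
    rw [h.cluster_output ha]
    simpa using hij.symm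
  obtain ⟨v, -, hl⟩ := mem_cluster.1 hj
  exact ⟨v, hl⟩

theorem leaveOneOut (h : S.ComputesY) (hn : 3 ≤ n) : LeaveOneOut Finset.univ S.clusters where
  ssubset_top c hc := by
    obtain ⟨v, rfl⟩ := mem_clusters.1 hc
    -- The cluster grows along a path to a sink, which is either an input, with a singleton cluster,
    -- or an output y_j, whose cluster misses j.
    obtain ⟨s, hs, hno⟩ := h.exists_sink v
    refine Finset.ssubset_of_subset_of_ssubset (cluster_mono hs) ?_
    rw [Finset.ssubset_univ_iff]
    intro hu
    by_cases hin : S.IsInput s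
    · obtain ⟨j, hj⟩ := hin
      rw [cluster_eq_of_input hj ((h.input_iff s).1 ⟨j, hj⟩)] at hu
      have := congrArg Finset.card hu
      rw [Finset.card_singleton, card_univ_fin] at this
      omega
    · obtain ⟨j, hj⟩ := (h.output_iff s).1 ⟨hin, hno⟩
      rw [h.cluster_output hj] at hu
      simpa using Finset.eq_univ_iff_forall.1 hu j
  empty_notMem h0 := by
    obtain ⟨v, hv⟩ := mem_clusters.1 h0
    exact (h.cluster_nonempty v).ne_empty hv
  erase_mem j _ := by
    obtain ⟨a, ha⟩ := h.exists_output j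
    exact mem_clusters.2 ⟨a, h.cluster_output ha⟩
  splits c hc hn := by
    obtain ⟨v, rfl⟩ := mem_clusters.1 hc
    have hex : ∃ u, S.Adj u v := by
      by_contra! hno
      obtain ⟨j, hj⟩ := h.exists_cluster_eq_singleton hno
      rw [hj] at hn
      simp at hn
    obtain ⟨u, hu⟩ := hex
    obtain ⟨w, -, hd, huw⟩ := h.exists_sibling hu
    exact ⟨_, cluster_mem_clusters u, _, cluster_mem_clusters w, hd, huw⟩

theorem card_clusters_le (S : LDigraph n) : S.clusters.card ≤ Nat.card S.V := by
  have := S.finite_V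
  have h1 : S.clusters.card = (Set.range S.cluster).ncard := by
    rw [← Set.ncard_coe_finset]
    congr 1
    ext c
    exact mem_clusters
  rw [h1, ← Set.image_univ, ← Set.ncard_univ]
  exact Set.ncard_image_le

theorem cluster_injective_of_card_le (hle : Nat.card S.V ≤ S.clusters.card) :
    Function.Injective S.cluster := by
  have := S.finite_V
  have h1 : S.clusters.card = (Set.range S.cluster).ncard := by
    rw [← Set.ncard_coe_finset]
    congr 1
    ext c
    exact mem_clusters
  rw [← Set.injOn_univ]
  refine Set.injOn_of_ncard_image_eq (le_antisymm Set.ncard_image_le ?_)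
  rwa [Set.image_univ, ← h1, Set.ncard_univ]

/-- There are at least as many nodes as clusters, hence at least 4n - 6, and n of them are inputs.
-/
theorem le_complexity (h : S.ComputesY) (hn : 3 ≤ n) : 3 * n ≤ S.complexity + 6 := by
  have h1 := card_eq_complexity_add h.label_unique (h.exists_input hn)
  have h2 := ((h.leaveOneOut hn).card_le_and_splitSystem (by rw [card_univ_fin]; omega)).1
  rw [card_univ_fin] at h2
  have := card_clusters_le S
  omega

/-- Equality holds in both estimates behind the bound: distinct nodes have distinct clusters, and
the clusters form an extremal system, which is a split system. -/
theorem nonempty_iso_ofClusters (h : S.ComputesY) (hn : 3 ≤ n) (hc : S.complexity + 6 = 3 * n) :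
    SplitSystem Finset.univ S.clusters ∧ Nonempty (Iso S (ofClusters S.clusters)) := by
  have h1 := card_eq_complexity_add h.label_unique (h.exists_input hn)
  have h2 := (h.leaveOneOut hn).card_le_and_splitSystem (by rw [card_univ_fin]; omega)
  rw [card_univ_fin] at h2
  have h3 := card_clusters_le S
  have hinj : Function.Injective S.cluster := cluster_injective_of_card_le (by omega)
  have hC := h2.2 (by omega)
  refine ⟨hC, ?_⟩
  have hlab : ∀ v, S.label v = clusterLabel (S.cluster v) := by
    intro v
    have hx : ∀ a j, S.label a = some (IOLabel.x j) → S.cluster a = {j} := fun a j ha =>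
      cluster_eq_of_input ha ((h.input_iff a).1 ⟨j, ha⟩)
    refine eq_of_label_eq_clusterLabel hn (fun j => ⟨hx v j, fun hv => ?_⟩)
      (fun j => ⟨h.cluster_output, fun hv => ?_⟩)
    -- The node x_j has the same cluster as `v`, so by injectivity it is `v`.
    · obtain ⟨a, ha⟩ := h.exists_input hn j
      rwa [hinj (hv.trans (hx a j ha).symm)]
    · obtain ⟨a, ha⟩ := h.exists_output j
      rwa [hinj (hv.trans (h.cluster_output ha).symm)]
  obtain ⟨f, hf⟩ := exists_lowerEmbedding_ofClusters hC cluster_mem_clusters hinj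
    (fun v u hu => h.exists_sibling hu) (fun v hv => h.exists_cluster_eq_singleton hv) hlab
  refine f.nonempty_iso fun c => ?_
  obtain ⟨v, hv⟩ := mem_clusters.1 c.2
  exact ⟨v, Subtype.ext ((hf v).trans hv)⟩

end ComputesY

/-- Existence is read off from the positive count. It ensures that the infimum in `minComplexity` is
over a nonempty set, as that of the empty set would be 0. -/
theorem exists_splitSystem (hn : 3 ≤ n) :
    ∃ C : Finset (Finset (Fin n)), SplitSystem Finset.univ C := by
  have h1 := ncard_splitSystems (R := (Finset.univ : Finset (Fin n)))
    (by rw [card_univ_fin]; omega)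
  have h2 : {C : Finset (Finset (Fin n)) | SplitSystem Finset.univ C}.ncard ≠ 0 := by
    rw [h1]
    exact (Nat.doubleFactorial_pos _).ne'
  exact Set.nonempty_of_ncard_ne_zero h2

theorem minComplexity_add (hn : 3 ≤ n) : minComplexity n + 6 = 3 * n := by
  obtain ⟨C, hC⟩ := exists_splitSystem hn
  have h1 := ofClusters_complexity hn hC
  have hmem : (ofClusters C).complexity ∈
      {c | ∃ S : LDigraph n, S.ComputesY ∧ S.complexity = c} :=
    ⟨_, ofClusters_computesY hn hC, rfl⟩
  have h2 := Nat.sInf_le hmem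
  obtain ⟨S, hS, hc⟩ := Nat.sInf_mem ⟨_, hmem⟩
  have h3 := hS.le_complexity hn
  change S.complexity = minComplexity n at hc
  change minComplexity n ≤ _ at h2
  omega

theorem ofClusters_isComplexityOptimal (hn : 3 ≤ n) {C : Finset (Finset (Fin n))}
    (hC : SplitSystem Finset.univ C) : (ofClusters C).IsComplexityOptimal := by
  have h1 := ofClusters_complexity hn hC
  have h2 := minComplexity_add hn
  exact ⟨ofClusters_computesY hn hC, by omega⟩

end LDigraph

theorem mem_optimalStructures {n : ℕ} (hn : 3 ≤ n) {q : Quotient (LDigraph.isoSetoid n)} :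
    q ∈ optimalStructures n ↔
      ∃ C, SetSystem.SplitSystem Finset.univ C ∧ Quotient.mk _ (LDigraph.ofClusters C) = q := by
  constructor
  · rintro ⟨S, ⟨hS, hc⟩, rfl⟩
    have h1 := LDigraph.minComplexity_add hn
    obtain ⟨hC, hiso⟩ := hS.nonempty_iso_ofClusters hn (by omega)
    exact ⟨_, hC, (Quotient.sound hiso).symm⟩
  · rintro ⟨C, hC, rfl⟩
    exact ⟨_, LDigraph.ofClusters_isComplexityOptimal hn hC, rfl⟩

theorem ncard_optimalStructures {n : ℕ} (hn : 3 ≤ n) :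
    (optimalStructures n).ncard = (2 * n - 5)‼ := by
  have h1 := SetSystem.ncard_splitSystems (R := (Finset.univ : Finset (Fin n)))
    (by rw [LDigraph.card_univ_fin]; omega)
  rw [LDigraph.card_univ_fin] at h1
  rw [← h1]
  symm
  refine Set.ncard_congr (fun C _ => Quotient.mk _ (LDigraph.ofClusters C)) ?_ ?_ ?_
  · exact fun C hC => (mem_optimalStructures hn).2 ⟨C, hC, rfl⟩
  · exact fun C D hC hD h => LDigraph.eq_of_ofClusters_iso hn hC hD (Quotient.exact h)
  · intro q hq
    obtain ⟨C, hC, rfl⟩ := (mem_optimalStructures hn).1 hq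
    exact ⟨C, hC, rfl⟩

/-! ### The split system of a T-tree. -/

section TreeDist

variable {V : Type*} {G : SimpleGraph V}

theorem SimpleGraph.IsTree.dist_eq_or_of_adj (hG : G.IsTree) (u : V) {a b : V} (h : G.Adj a b) :
    G.dist u a = G.dist u b + 1 ∨ G.dist u b = G.dist u a + 1 :=
  hG.dist_eq_dist_add_one_of_adj u h

/-- In a tree, only the edge `{c, d}` connects the nodes closer to `c` with those closer to `d`. -/
theorem SimpleGraph.IsTree.eq_of_adj_of_dist (hG : G.IsTree) {c d u u' : V} (hcd : G.Adj c d)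
    (huu : G.Adj u u') (hu : G.dist u c = G.dist u d + 1) (hu' : G.dist u' d = G.dist u' c + 1) :
    u = d ∧ u' = c := by
  have e1 := hG.dist_eq_or_of_adj c huu
  have e2 := hG.dist_eq_or_of_adj d huu
  rw [dist_comm (u := c), dist_comm (u := c)] at e1
  rw [dist_comm (u := d), dist_comm (u := d)] at e2
  have hk : G.dist u' c = G.dist u d := by omega
  have hud : u = d := by
    by_contra hne
    -- The step `p` from `u` towards `d` also approaches `c`, as does `u'`; so `p = u'`, although
    -- `u'` is farther from `d` than `u` is.
    obtain ⟨p, ⟨hp, hpd⟩, -⟩ := hG.existsUnique_closer hne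
    have huc : u ≠ c := by
      rintro rfl
      rw [dist_self] at hu
      omega
    have e3 := hG.dist_eq_or_of_adj c hp
    rw [dist_comm (u := c), dist_comm (u := c)] at e3
    have e4 : G.dist p c ≤ G.dist p d + G.dist d c := hG.connected.dist_triangle
    have e5 : G.dist d c = 1 := dist_eq_one_iff_adj.2 hcd.symm
    have h1 : p = u' := (hG.existsUnique_closer huc).unique ⟨hp, by omega⟩ ⟨huu, by omega⟩
    subst h1
    omega
  refine ⟨hud, ?_⟩
  subst hud
  rw [dist_self] at hk
  exact hG.connected.dist_eq_zero_iff.1 hk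

end TreeDist

namespace LGraph

open SetSystem LDigraph

variable {n : ℕ} {T : LGraph n}

theorem rootedAt_label_eq_x {b c : T.V} {j : Fin n} :
    (T.rootedAt b).label c = some (IOLabel.x j) ↔ T.label c = some j := by
  change (T.label c).map IOLabel.x = _ ↔ _
  rw [Option.map_eq_some_iff]
  simp

namespace IsTTree

theorem adj_unique (hT : T.IsTTree) {b c d d' : T.V} (hd : (T.rootedAt b).Adj c d)
    (hd' : (T.rootedAt b).Adj c d') : d = d' := by
  have hcb : c ≠ b := by
    rintro rfl
    have := hd.2
    rw [SimpleGraph.dist_self] at this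
    omega
  exact (hT.isTree.existsUnique_closer hcb).unique hd hd'

theorem exists_parent (hT : T.IsTTree) {b c : T.V} (h : c ≠ b) :
    ∃ d, (T.rootedAt b).Adj c d :=
  (hT.isTree.existsUnique_closer h).exists

theorem adj_rootedAt_or (hT : T.IsTTree) (b : T.V) {c d : T.V} (h : T.graph.Adj c d) :
    (T.rootedAt b).Adj c d ∨ (T.rootedAt b).Adj d c := by
  have h1 := hT.isTree.dist_eq_or_of_adj b h
  rw [SimpleGraph.dist_comm (u := b), SimpleGraph.dist_comm (u := b)] at h1
  exact h1.imp (fun h2 => ⟨h, h2⟩) fun h2 => ⟨h.symm, h2⟩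

theorem ne_root {b c d : T.V} (h : (T.rootedAt b).Adj c d) : c ≠ b := by
  rintro rfl
  have := h.2
  rw [SimpleGraph.dist_self] at this
  omega

theorem dist_le_of_reach {b u v : T.V} (h : Relation.ReflTransGen (T.rootedAt b).Adj u v) :
    T.graph.dist v b ≤ T.graph.dist u b := by
  induction h with
  | refl => exact le_rfl
  | tail _ h ih => have := h.2; omega

theorem eq_of_reach_of_dist_le {b u v : T.V} (h : Relation.ReflTransGen (T.rootedAt b).Adj u v)
    (hle : T.graph.dist u b ≤ T.graph.dist v b) : u = v := by
  rcases Relation.ReflTransGen.cases_head h with rfl | ⟨w, hw, hwv⟩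
  · rfl
  · have h1 := hw.2
    have h2 := dist_le_of_reach hwv
    omega

/-- If `d` is the parent of `c`, the descendants of `c` are the nodes closer to `c` than to `d`. -/
theorem reach_iff (hT : T.IsTTree) {b c d : T.V} (hcd : (T.rootedAt b).Adj c d) {u : T.V} :
    Relation.ReflTransGen (T.rootedAt b).Adj u c ↔ T.graph.dist u d = T.graph.dist u c + 1 := by
  constructor
  · intro h
    induction h using Relation.ReflTransGen.head_induction_on with
    | refl => rw [SimpleGraph.dist_self, SimpleGraph.dist_eq_one_iff_adj.2 hcd.1]
    | head h _ ih =>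
      rename_i u u' _
      rcases hT.isTree.dist_eq_or_of_adj u hcd.1 with h1 | h1
      -- An edge crossing to the side of `c` can only be the one from `d` to `c`, which is directed
      -- the other way.
      · obtain ⟨rfl, rfl⟩ := hT.isTree.eq_of_adj_of_dist hcd.1 h.1 h1 ih
        have h2 := h.2
        have h3 := hcd.2
        omega
      · exact h1
  · intro h
    obtain ⟨k, hk⟩ : ∃ k, T.graph.dist u c = k := ⟨_, rfl⟩
    induction k generalizing u with
    | zero =>
      rw [hT.isTree.connected.dist_eq_zero_iff.1 hk]
      exact .refl
    | succ k ih =>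
      have huc : u ≠ c := by
        rintro rfl
        rw [SimpleGraph.dist_self] at hk
        omega
      obtain ⟨u', ⟨huu, hu'⟩, -⟩ := hT.isTree.existsUnique_closer huc
      have h1 : T.graph.dist u' d = T.graph.dist u' c + 1 := by
        rcases hT.isTree.dist_eq_or_of_adj u' hcd.1 with h1 | h1
        · have h2 := hT.isTree.eq_of_adj_of_dist hcd.1.symm huu h h1
          exact absurd h2.1 huc
        · exact h1
      have h2 := ih h1 (by omega)
      rcases hT.adj_rootedAt_or b huu with h3 | h3
      · exact .head h3 h2
      · rcases Relation.ReflTransGen.cases_head h2 with rfl | ⟨w, hw, hwc⟩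
        · obtain rfl := hT.adj_unique h3 hcd
          rw [SimpleGraph.dist_self] at h
          omega
        · rwa [hT.adj_unique h3 hw]

theorem mem_cluster_iff (hT : T.IsTTree) {b c d : T.V} (hcd : (T.rootedAt b).Adj c d)
    {j : Fin n} : j ∈ (T.rootedAt b).cluster c ↔
      ∃ u, T.graph.dist u d = T.graph.dist u c + 1 ∧ T.label u = some j := by
  exact mem_cluster.trans
    (exists_congr fun u => and_congr (hT.reach_iff hcd) rootedAt_label_eq_x)

/-- The cluster of a node depends only on its parent. -/
theorem cluster_eq_cluster (hT : T.IsTTree) {b b' c d : T.V} (h : (T.rootedAt b).Adj c d)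
    (h' : (T.rootedAt b').Adj c d) : (T.rootedAt b).cluster c = (T.rootedAt b').cluster c := by
  ext j
  rw [hT.mem_cluster_iff h, hT.mem_cluster_iff h']

/-- Every leaf is closer to exactly one end of the edge. -/
theorem cluster_compl (hT : T.IsTTree) {b b' c d : T.V} (h : (T.rootedAt b).Adj c d)
    (h' : (T.rootedAt b').Adj d c) :
    (T.rootedAt b').cluster d = Finset.univ \ (T.rootedAt b).cluster c := by
  ext j
  rw [Finset.mem_sdiff, hT.mem_cluster_iff h', hT.mem_cluster_iff h]
  constructor
  · rintro ⟨u, hu, hl⟩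
    refine ⟨Finset.mem_univ j, ?_⟩
    rintro ⟨v, hv, hl'⟩
    obtain rfl := hT.label_unique u v j hl hl'
    omega
  · rintro ⟨-, hno⟩
    obtain ⟨u, hu⟩ := hT.exists_label j
    refine ⟨u, ?_, hu⟩
    exact (hT.isTree.dist_eq_or_of_adj u h.1).resolve_right fun h1 => hno ⟨u, h1, hu⟩

theorem adj_rootedAt_self {c d : T.V} (h : T.graph.Adj c d) : (T.rootedAt d).Adj c d := by
  refine ⟨h, ?_⟩
  rw [SimpleGraph.dist_self, SimpleGraph.dist_eq_one_iff_adj.2 h]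

theorem neighborSet_eq (hT : T.IsTTree) {b v d : T.V} (hd : (T.rootedAt b).Adj v d) :
    T.graph.neighborSet v = insert d {u | (T.rootedAt b).Adj u v} := by
  ext u
  constructor
  · intro hu
    rcases hT.adj_rootedAt_or b hu with h | h
    · exact Or.inl (hT.adj_unique h hd)
    · exact Or.inr h
  · rintro (rfl | hu)
    · exact hd.1
    · exact hu.1.symm

theorem ncard_neighborSet (hT : T.IsTTree) {b v d : T.V} (hd : (T.rootedAt b).Adj v d) :
    (T.graph.neighborSet v).ncard = {u | (T.rootedAt b).Adj u v}.ncard + 1 := by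
  have := T.finite_V
  rw [hT.neighborSet_eq hd]
  refine Set.ncard_insert_of_notMem (fun h => ?_) (Set.toFinite (α := T.V) _)
  have h1 := h.2
  have h2 := hd.2
  omega

/-- A node without children is labelled. -/
theorem exists_label_of_not_adj (hT : T.IsTTree) {b v : T.V} (hv : v ≠ b)
    (hno : ∀ u, ¬ (T.rootedAt b).Adj u v) :
    ∃ j, T.label v = some j ∧ (T.rootedAt b).cluster v = {j} := by
  obtain ⟨d, hd⟩ := hT.exists_parent hv
  have h1 := hT.ncard_neighborSet hd
  have h2 : {u | (T.rootedAt b).Adj u v} = ∅ := Set.eq_empty_iff_forall_notMem.2 hno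
  rw [h2, Set.ncard_empty] at h1
  obtain ⟨j, hj⟩ := (hT.leaf_iff v).1 h1
  exact ⟨j, hj, cluster_eq_of_input (rootedAt_label_eq_x.2 hj) hno⟩

theorem not_adj_of_label (hT : T.IsTTree) {b v : T.V} (hv : v ≠ b) {j : Fin n}
    (hj : T.label v = some j) (u : T.V) : ¬ (T.rootedAt b).Adj u v := by
  intro hu
  have := T.finite_V
  obtain ⟨d, hd⟩ := hT.exists_parent hv
  have h1 := hT.ncard_neighborSet hd
  rw [(hT.leaf_iff v).2 ⟨j, hj⟩] at h1
  have h2 : {u | (T.rootedAt b).Adj u v}.ncard = 0 := by omega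
  have h3 : u ∈ (∅ : Set T.V) := (Set.ncard_eq_zero (Set.toFinite (α := T.V) _)).1 h2 ▸ hu
  exact h3

theorem cluster_of_label (hT : T.IsTTree) {b v : T.V} (hv : v ≠ b) {j : Fin n}
    (hj : T.label v = some j) : (T.rootedAt b).cluster v = {j} :=
  cluster_eq_of_input (rootedAt_label_eq_x.2 hj) (hT.not_adj_of_label hv hj)

theorem cluster_nonempty (hT : T.IsTTree) {b v : T.V} (hv : v ≠ b) :
    ((T.rootedAt b).cluster v).Nonempty := by
  have := T.finite_V
  -- A descendant of maximal depth has no children, so it is a labelled leaf.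
  obtain ⟨u, hu, hmax⟩ := Set.exists_max_image
    {u | Relation.ReflTransGen (T.rootedAt b).Adj u v} (fun u => T.graph.dist u b)
    (Set.toFinite (α := T.V) _) ⟨v, .refl⟩
  have hub : u ≠ b := by
    intro hub
    have h1 := dist_le_of_reach hu
    rw [hub, SimpleGraph.dist_self] at h1
    exact hv (hT.isTree.connected.dist_eq_zero_iff.1 (Nat.le_zero.1 h1))
  obtain ⟨j, -, hj⟩ := hT.exists_label_of_not_adj hub fun w hw => by
    have h1 := hmax w (Relation.ReflTransGen.head hw hu)
    have h2 := hw.2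
    omega
  exact ⟨j, cluster_mono hu (hj ▸ Finset.mem_singleton_self j)⟩

theorem reach_or_reach (hT : T.IsTTree) {b u w s : T.V}
    (hu : Relation.ReflTransGen (T.rootedAt b).Adj s u)
    (hw : Relation.ReflTransGen (T.rootedAt b).Adj s w) :
    Relation.ReflTransGen (T.rootedAt b).Adj u w ∨
      Relation.ReflTransGen (T.rootedAt b).Adj w u := by
  have hU : Relator.RightUnique (T.rootedAt b).Adj := fun _ _ _ h1 h2 => hT.adj_unique h1 h2
  exact Relation.ReflTransGen.total_of_right_unique hU hu hw

theorem reach_or_reach_of_mem (hT : T.IsTTree) {b u w : T.V} {j : Fin n}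
    (hu : j ∈ (T.rootedAt b).cluster u) (hw : j ∈ (T.rootedAt b).cluster w) :
    Relation.ReflTransGen (T.rootedAt b).Adj u w ∨
      Relation.ReflTransGen (T.rootedAt b).Adj w u := by
  obtain ⟨s, hs, hl⟩ := mem_cluster.1 hu
  obtain ⟨s', hs', hl'⟩ := mem_cluster.1 hw
  obtain rfl : s = s' := hT.label_unique s s' j (rootedAt_label_eq_x.1 hl)
    (rootedAt_label_eq_x.1 hl')
  exact hT.reach_or_reach hs hs'

theorem laminar (hT : T.IsTTree) (b u w : T.V) :
    (T.rootedAt b).cluster u ⊆ (T.rootedAt b).cluster w ∨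
      (T.rootedAt b).cluster w ⊆ (T.rootedAt b).cluster u ∨
        Disjoint ((T.rootedAt b).cluster u) ((T.rootedAt b).cluster w) := by
  by_cases h : Disjoint ((T.rootedAt b).cluster u) ((T.rootedAt b).cluster w)
  · exact Or.inr (Or.inr h)
  · obtain ⟨j, hj, hj'⟩ := Finset.not_disjoint_iff.1 h
    rcases hT.reach_or_reach_of_mem hj hj' with h1 | h1
    · exact Or.inl (cluster_mono h1)
    · exact Or.inr (Or.inl (cluster_mono h1))

theorem exists_sibling (hT : T.IsTTree) {b u v : T.V} (hv : v ≠ b)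
    (hu : (T.rootedAt b).Adj u v) : ∃ w, (T.rootedAt b).Adj w v ∧
      Disjoint ((T.rootedAt b).cluster u) ((T.rootedAt b).cluster w) ∧
      (T.rootedAt b).cluster u ∪ (T.rootedAt b).cluster w = (T.rootedAt b).cluster v := by
  have := T.finite_V
  obtain ⟨d, hd⟩ := hT.exists_parent hv
  have h1 := hT.ncard_neighborSet hd
  have h0 : 0 < {u | (T.rootedAt b).Adj u v}.ncard :=
    (Set.ncard_pos (Set.toFinite (α := T.V) _)).2 ⟨u, hu⟩
  -- With a parent and a child, `v` has degree at least 2, hence 3, which leaves exactly two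
  -- children.
  have h2 := hT.internal v (by omega)
  obtain ⟨x, y, hxy, heq⟩ := Set.ncard_eq_two.1
    (show {u | (T.rootedAt b).Adj u v}.ncard = 2 by omega)
  have hadj : ∀ z, (T.rootedAt b).Adj z v ↔ z = x ∨ z = y := fun z => by
    change z ∈ {u | (T.rootedAt b).Adj u v} ↔ _
    rw [heq]
    exact Iff.rfl
  have hx := (hadj x).2 (Or.inl rfl)
  have hy := (hadj y).2 (Or.inr rfl)
  have hdis : Disjoint ((T.rootedAt b).cluster x) ((T.rootedAt b).cluster y) := by
    by_contra h
    obtain ⟨j, hj, hj'⟩ := Finset.not_disjoint_iff.1 h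
    have h3 := hx.2
    have h4 := hy.2
    rcases hT.reach_or_reach_of_mem hj hj' with h5 | h5
    · exact hxy (eq_of_reach_of_dist_le h5 (by omega))
    · exact hxy (eq_of_reach_of_dist_le h5 (by omega)).symm
  have hin : ¬ (T.rootedAt b).IsInput v := by
    rintro ⟨j, hj⟩
    exact hT.not_adj_of_label hv (rootedAt_label_eq_x.1 hj) u hu
  have hun : (T.rootedAt b).cluster x ∪ (T.rootedAt b).cluster y = (T.rootedAt b).cluster v := by
    ext j
    rw [Finset.mem_union, mem_cluster_of_not_isInput hin]
    constructor
    · rintro (h | h)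
      exacts [⟨x, hx, h⟩, ⟨y, hy, h⟩]
    · rintro ⟨z, hz, h⟩
      rcases (hadj z).1 hz with rfl | rfl
      exacts [Or.inl h, Or.inr h]
  rcases (hadj u).1 hu with rfl | rfl
  · exact ⟨y, hy, hdis, hun⟩
  · exact ⟨x, hx, hdis.symm, by rw [Finset.union_comm, hun]⟩

theorem eq_of_reach_of_cluster_eq (hT : T.IsTTree) {b v v' : T.V} (hv' : v' ≠ b)
    (h : Relation.ReflTransGen (T.rootedAt b).Adj v v')
    (heq : (T.rootedAt b).cluster v = (T.rootedAt b).cluster v') : v = v' := by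
  rcases Relation.ReflTransGen.cases_tail h with h1 | ⟨u, hvu, huv⟩
  · exact h1.symm
  · obtain ⟨w, hw, hd, hun⟩ := hT.exists_sibling hv' huv
    obtain ⟨k, hk⟩ := hT.cluster_nonempty (ne_root hw)
    have h2 : k ∈ (T.rootedAt b).cluster v := by
      rw [heq, ← hun]
      exact Finset.mem_union_right _ hk
    exact absurd hk (Finset.disjoint_left.1 hd (cluster_mono hvu h2))

theorem cluster_injective (hT : T.IsTTree) {b v v' : T.V} (hv : v ≠ b) (hv' : v' ≠ b)
    (heq : (T.rootedAt b).cluster v = (T.rootedAt b).cluster v') : v = v' := by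
  obtain ⟨k, hk⟩ := hT.cluster_nonempty hv
  rcases hT.reach_or_reach_of_mem hk (heq ▸ hk) with h | h
  · exact hT.eq_of_reach_of_cluster_eq hv' h heq
  · exact (hT.eq_of_reach_of_cluster_eq hv h heq.symm).symm

theorem label_iff_cluster (hT : T.IsTTree) {b v : T.V} (hv : v ≠ b) {j : Fin n} :
    T.label v = some j ↔ (T.rootedAt b).cluster v = {j} := by
  refine ⟨hT.cluster_of_label hv, fun h => ?_⟩
  by_cases hno : ∀ u, ¬ (T.rootedAt b).Adj u v
  · obtain ⟨i, hi, hc⟩ := hT.exists_label_of_not_adj hv hno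
    rw [hi, Finset.singleton_injective (hc.symm.trans h)]
  · push Not at hno
    obtain ⟨u, hu⟩ := hno
    obtain ⟨w, hw, hd, hun⟩ := hT.exists_sibling hv hu
    obtain ⟨k, hk⟩ := hT.cluster_nonempty (ne_root hu)
    obtain ⟨l, hl⟩ := hT.cluster_nonempty (ne_root hw)
    have h1 : k ∈ ({j} : Finset (Fin n)) := h ▸ hun ▸ Finset.mem_union_left _ hk
    have h2 : l ∈ ({j} : Finset (Fin n)) := h ▸ hun ▸ Finset.mem_union_right _ hl
    rw [Finset.mem_singleton] at h1 h2
    subst h1 h2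
    exact absurd hl (Finset.disjoint_left.1 hd hk)

theorem exists_neighbor (hT : T.IsTTree) {b : T.V} {j : Fin n} (hb : T.label b = some j) :
    ∃ a, T.graph.Adj a b ∧ ∀ c, T.graph.Adj c b → c = a := by
  obtain ⟨a, ha⟩ := Set.ncard_eq_one.1 ((hT.leaf_iff b).2 ⟨j, hb⟩)
  refine ⟨a, ?_, fun c hc => ?_⟩
  · have : a ∈ T.graph.neighborSet b := ha ▸ rfl
    exact SimpleGraph.Adj.symm this
  · have : c ∈ T.graph.neighborSet b := hc.symm
    rw [ha] at this
    exact this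

/-- The cluster of the neighbour of the leaf `x_j` in the tree rooted at this leaf. -/
theorem cluster_neighbor (hT : T.IsTTree) {a b : T.V} {j : Fin n} (hb : T.label b = some j)
    (hab : T.graph.Adj a b) : (T.rootedAt b).cluster a = Finset.univ.erase j := by
  rw [hT.cluster_compl (adj_rootedAt_self hab.symm) (adj_rootedAt_self hab),
    hT.cluster_of_label hab.ne' hb, Finset.sdiff_singleton_eq_erase]

end IsTTree

/-- The clusters on both sides of all edges of `T`. -/
noncomputable def splits (T : LGraph n) : Finset (Finset (Fin n)) :=
  (Set.toFinite {c | ∃ b v, v ≠ b ∧ (T.rootedAt b).cluster v = c}).toFinset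

theorem mem_splits {c : Finset (Fin n)} :
    c ∈ T.splits ↔ ∃ b v, v ≠ b ∧ (T.rootedAt b).cluster v = c := by
  simp [splits]

namespace IsTTree

theorem splitSystem (hT : T.IsTTree) : SplitSystem Finset.univ T.splits := by
  have hsdiff : ∀ c ∈ T.splits, Finset.univ \ c ∈ T.splits := by
    intro c hc
    obtain ⟨b, v, hv, rfl⟩ := mem_splits.1 hc
    obtain ⟨d, hd⟩ := hT.exists_parent hv
    rw [← hT.cluster_compl hd (adj_rootedAt_self hd.1.symm)]
    exact mem_splits.2 ⟨v, d, hd.1.ne', rfl⟩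
  have hne : ∀ c ∈ T.splits, c.Nonempty := by
    intro c hc
    obtain ⟨b, v, hv, rfl⟩ := mem_splits.1 hc
    exact hT.cluster_nonempty hv
  refine ⟨⟨?_, fun h => by simpa using hne _ h, ?_, ?_⟩, hsdiff, ?_⟩
  · intro c hc
    rw [Finset.ssubset_univ_iff]
    rintro rfl
    simpa using hne _ (hsdiff _ hc)
  · intro j _
    obtain ⟨b, hb⟩ := hT.exists_label j
    obtain ⟨a, hab, -⟩ := hT.exists_neighbor hb
    exact mem_splits.2 ⟨b, a, hab.ne, hT.cluster_neighbor hb hab⟩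
  · intro c hc hn
    obtain ⟨b, v, hv, rfl⟩ := mem_splits.1 hc
    have hex : ∃ u, (T.rootedAt b).Adj u v := by
      by_contra! hno
      obtain ⟨j, -, hj⟩ := hT.exists_label_of_not_adj hv hno
      rw [hj] at hn
      simp at hn
    obtain ⟨u, hu⟩ := hex
    obtain ⟨w, hw, hd, hun⟩ := hT.exists_sibling hv hu
    exact ⟨_, mem_splits.2 ⟨b, u, ne_root hu, rfl⟩, _, mem_splits.2 ⟨b, w, ne_root hw, rfl⟩,
      hd, hun⟩
  · intro x hx y hy
    obtain ⟨b, v, hv, rfl⟩ := mem_splits.1 hx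
    obtain ⟨b', v', hv', rfl⟩ := mem_splits.1 hy
    obtain ⟨d', hd'⟩ := hT.exists_parent hv'
    -- Both clusters are compared in the tree rooted at `b`: there the second edge keeps its
    -- direction, or it is reversed and the second cluster is a complement.
    rcases hT.adj_rootedAt_or b hd'.1 with h | h
    · rw [hT.cluster_eq_cluster hd' h]
      have := hT.laminar b v v'
      tauto
    · rw [hT.cluster_compl h hd']
      rcases hT.laminar b v d' with h1 | h1 | h1
      · exact Or.inr (Or.inr (Or.inl (Finset.disjoint_sdiff.mono_left h1)))
      · right; right; right
        refine Finset.eq_univ_of_forall fun k => Finset.mem_union.2 ?_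
        by_cases hk : k ∈ (T.rootedAt b).cluster d'
        · exact Or.inl (h1 hk)
        · exact Or.inr (Finset.mem_sdiff.2 ⟨Finset.mem_univ k, hk⟩)
      · exact Or.inl fun k hk =>
          Finset.mem_sdiff.2 ⟨Finset.mem_univ k, Finset.disjoint_left.1 h1 hk⟩

/-- Every cluster which does not contain `j` is one of the tree rooted at `x_j`. -/
theorem exists_cluster_eq (hT : T.IsTTree) {b : T.V} {j : Fin n} (hb : T.label b = some j)
    {c : Finset (Fin n)} (hc : c ∈ T.splits) (hj : j ∉ c) :
    ∃ v, v ≠ b ∧ (T.rootedAt b).cluster v = c := by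
  obtain ⟨b', v, hv, rfl⟩ := mem_splits.1 hc
  obtain ⟨d, hd⟩ := hT.exists_parent hv
  rcases hT.adj_rootedAt_or b hd.1 with h | h
  · exact ⟨v, ne_root h, hT.cluster_eq_cluster h hd⟩
  · exfalso
    apply hj
    rw [hT.mem_cluster_iff hd]
    refine ⟨b, ?_, hb⟩
    have h1 : T.graph.dist d b = T.graph.dist v b + 1 := h.2
    exact (SimpleGraph.dist_comm.trans h1).trans (congrArg (· + 1) SimpleGraph.dist_comm)

end IsTTree

end LGraph

/-! ### The union of the trees D(a, x_j, T) is the structure of the splits of T. -/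

namespace LDigraph

variable {n : ℕ}

theorem setLabel_label_self {G : LDigraph n} {a : G.V} {l : IOLabel n} :
    (G.setLabel a l).label a = some l :=
  if_pos rfl

theorem setLabel_label_of_ne {G : LDigraph n} {a v : G.V} (h : v ≠ a) {l : IOLabel n} :
    (G.setLabel a l).label v = G.label v :=
  if_neg h

theorem setLabel_cluster {G : LDigraph n} {a : G.V} (ha : ¬ G.IsInput a) (j : Fin n) (v : G.V) :
    (G.setLabel a (IOLabel.y j)).cluster v = G.cluster v := by
  ext i
  have key : ∀ u : G.V, (G.setLabel a (IOLabel.y j)).label u = some (IOLabel.x i) ↔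
      G.label u = some (IOLabel.x i) := by
    intro u
    by_cases hu : u = a
    · subst hu
      rw [setLabel_label_self]
      simp only [Option.some_inj, reduceCtorEq, false_iff]
      exact fun h => ha ⟨i, h⟩
    · rw [setLabel_label_of_ne hu]
  exact mem_cluster.trans ((exists_congr fun u => and_congr Iff.rfl (key u)).trans
    mem_cluster.symm)

end LDigraph

namespace LGraph

open SetSystem LDigraph

variable {n : ℕ} {T : LGraph n}

namespace IsTTree

/-- The neighbour of a leaf is not labelled. -/
theorem not_isInput_neighbor (hT : T.IsTTree) (hn : 3 ≤ n) {a b : T.V} {j : Fin n}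
    (hb : T.label b = some j) (hab : T.graph.Adj a b) : ¬ (T.rootedAt b).IsInput a := by
  rintro ⟨i, hi⟩
  have h1 := hT.cluster_of_label hab.ne (rootedAt_label_eq_x.1 hi)
  rw [hT.cluster_neighbor hb hab] at h1
  exact singleton_ne_erase hn i j h1.symm

theorem outputTree_cluster (hT : T.IsTTree) (hn : 3 ≤ n) {a b : T.V} {j : Fin n}
    (hb : T.label b = some j) (hab : T.graph.Adj a b) (v : (T.outputTree j a b).V) :
    (T.outputTree j a b).cluster v = (T.rootedAt b).cluster v.1 :=
  (setLabel_cluster (G := T.subtreeD a b) (hT.not_isInput_neighbor hn hb hab) j v).trans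
    (((T.rootedAt b).enteringEmbedding a).cluster_eq v).symm

theorem ne_root_of_reach (hT : T.IsTTree) {a b v : T.V} (hab : a ≠ b)
    (h : Relation.ReflTransGen (T.rootedAt b).Adj v a) : v ≠ b := by
  intro hv
  have h1 := dist_le_of_reach h
  rw [hv, SimpleGraph.dist_self] at h1
  exact hab (hT.isTree.connected.dist_eq_zero_iff.1 (Nat.le_zero.1 h1))

theorem reach_root (hT : T.IsTTree) (b v : T.V) :
    Relation.ReflTransGen (T.rootedAt b).Adj v b := by
  obtain ⟨k, hk⟩ : ∃ k, T.graph.dist v b = k := ⟨_, rfl⟩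
  induction k generalizing v with
  | zero =>
    rw [hT.isTree.connected.dist_eq_zero_iff.1 hk]
    exact .refl
  | succ k ih =>
    have hvb : v ≠ b := by
      rintro rfl
      rw [SimpleGraph.dist_self] at hk
      omega
    obtain ⟨d, hd⟩ := hT.exists_parent hvb
    exact .head hd (ih d (by have := hd.2; omega))

/-- The tree hanging from x_j is a lower part of the digraph of splits; its root has the complement
of `j` as cluster, which is why the label y_j fits. -/
theorem exists_lowerEmbedding (hT : T.IsTTree) (hn : 3 ≤ n) {a b : T.V} {j : Fin n}
    (hb : T.label b = some j) (hab : T.graph.Adj a b) :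
    ∃ f : LowerEmbedding (T.outputTree j a b) (ofClusters T.splits),
      ∀ v, (f.toFun v).1 = (T.rootedAt b).cluster v.1 := by
  have hcl := hT.outputTree_cluster hn hb hab
  have hroot : ∀ v : (T.outputTree j a b).V, v.1 ≠ b := fun v =>
    hT.ne_root_of_reach hab.ne v.2
  have hinj : ∀ v w : (T.outputTree j a b).V,
      (T.rootedAt b).cluster v.1 = (T.rootedAt b).cluster w.1 → v = w := fun v w h =>
    Subtype.ext (hT.cluster_injective (hroot v) (hroot w) h)
  have hmem : ∀ v : (T.outputTree j a b).V, (T.rootedAt b).cluster v.1 ∈ T.splits := fun v =>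
    mem_splits.2 ⟨b, v.1, hroot v, rfl⟩
  have hchild : ∀ v u : (T.outputTree j a b).V, (T.outputTree j a b).Adj u v →
      ∃ w, (T.outputTree j a b).Adj w v ∧
        Disjoint ((T.outputTree j a b).cluster u) ((T.outputTree j a b).cluster w) ∧
        (T.outputTree j a b).cluster u ∪ (T.outputTree j a b).cluster w =
          (T.outputTree j a b).cluster v := by
    intro v u hu
    obtain ⟨w, hw, hd, hun⟩ := hT.exists_sibling (hroot v) (show (T.rootedAt b).Adj u.1 v.1 from hu)
    obtain ⟨w, rfl⟩ : ∃ w' : (T.outputTree j a b).V, w'.1 = w := ⟨⟨w, .head hw v.2⟩, rfl⟩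
    refine ⟨w, hw, ?_, ?_⟩
    · rw [hcl, hcl]
      exact hd
    · rw [hcl, hcl, hcl]
      exact hun
  have hleaf : ∀ v : (T.outputTree j a b).V, (∀ u, ¬ (T.outputTree j a b).Adj u v) →
      ∃ i, (T.outputTree j a b).cluster v = {i} := by
    intro v hno
    obtain ⟨i, -, hi⟩ := hT.exists_label_of_not_adj (hroot v)
      fun u hu => hno ⟨u, .head hu v.2⟩ hu
    exact ⟨i, (hcl v).trans hi⟩
  have hlab : ∀ v : (T.outputTree j a b).V, (T.outputTree j a b).label v =
      clusterLabel ((T.outputTree j a b).cluster v) := by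
    intro v
    rw [hcl]
    have ha : (T.rootedAt b).cluster a = Finset.univ.erase j := hT.cluster_neighbor hb hab
    by_cases hv : v = (T.rootedAt b).enteringRoot a
    · subst hv
      exact (setLabel_label_self (G := T.subtreeD a b)).trans ((clusterLabel_eq_y hn).2 ha).symm
    · have h1 : (T.outputTree j a b).label v = (T.rootedAt b).label v.1 :=
        setLabel_label_of_ne (G := T.subtreeD a b) hv
      rw [h1]
      refine eq_of_label_eq_clusterLabel hn
        (fun i => rootedAt_label_eq_x.trans (hT.label_iff_cluster (hroot v))) fun i => ?_
      constructor
      · intro h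
        obtain ⟨k, -, hk⟩ := Option.map_eq_some_iff.1 h
        exact absurd hk (by simp)
      · intro h
        exfalso
        -- A cluster that is the complement of `i` and is contained in the complement of `j` forces
        -- `i = j`, so `v` would be the root.
        have h2 := cluster_mono v.2
        rw [h, ha] at h2
        have hij : i = j := by
          by_contra hne
          have h3 := h2 (Finset.mem_erase.2 ⟨fun h' => hne h'.symm, Finset.mem_univ j⟩)
          simp at h3
        subst hij
        exact hv (hinj v ((T.rootedAt b).enteringRoot a) (h.trans ha.symm))
  obtain ⟨f, hf⟩ := exists_lowerEmbedding_ofClusters (G := T.outputTree j a b) hT.splitSystem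
    (fun v => by rw [hcl]; exact hmem v)
    (fun v w h => by rw [hcl, hcl] at h; exact hinj v w h) hchild hleaf hlab
  exact ⟨f, fun v => (hf v).trans (hcl v)⟩

/-- The union of the trees `D(a, x_j, T)` is the digraph of the clusters of `T`. -/
theorem nonempty_unionD_iso (hT : T.IsTTree) (hn : 3 ≤ n) :
    Nonempty (LDigraph.Iso T.unionD (ofClusters T.splits)) := by
  choose f hf using fun p : T.LeafEdge => hT.exists_lowerEmbedding hn p.2.1 p.2.2
  refine nonempty_vee_iso _ _ f (fun c => ?_) (ofClusters_subtree_ne hn hT.splitSystem)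
  -- Every cluster misses some `j` and therefore occurs in the tree hanging from x_j; so the
  -- embeddings cover all nodes.
  obtain ⟨j, -, hj⟩ := Finset.exists_of_ssubset (hT.splitSystem.ssubset_top c.1 c.2)
  obtain ⟨b, hb⟩ := hT.exists_label j
  obtain ⟨a, hab, huniq⟩ := hT.exists_neighbor hb
  obtain ⟨v, hv, hvc⟩ := hT.exists_cluster_eq hb c.2 hj
  have hva : Relation.ReflTransGen (T.rootedAt b).Adj v a := by
    rcases Relation.ReflTransGen.cases_tail (hT.reach_root b v) with h | ⟨t, hvt, htb⟩
    · exact absurd h.symm hv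
    · rwa [huniq t htb.1] at hvt
  exact ⟨⟨(j, a, b), hb, hab⟩, ⟨v, hva⟩, Subtype.ext ((hf ⟨(j, a, b), hb, hab⟩ ⟨v, hva⟩).trans hvc)⟩

end IsTTree

end LGraph

/-- The degree of a node other than the root in the tree given by a parent relation. -/
theorem SimpleGraph.ncard_neighborSet_fromRel {V : Type*} [Finite V] {R : V → V → Prop}
    {dep : V → ℕ} (hdep : ∀ c d, R c d → dep c = dep d + 1)
    (huniq : ∀ c d d', R c d → R c d' → d = d') {v p : V} (hp : R v p) :
    ((SimpleGraph.fromRel R).neighborSet v).ncard = {u | R u v}.ncard + 1 := by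
  have h1 : (SimpleGraph.fromRel R).neighborSet v = insert p {u | R u v} := by
    ext u
    rw [SimpleGraph.mem_neighborSet, SimpleGraph.fromRel_adj, Set.mem_insert_iff]
    constructor
    · rintro ⟨-, h | h⟩
      · exact Or.inl (huniq v u p h hp)
      · exact Or.inr h
    · rintro (rfl | h)
      · refine ⟨?_, Or.inl hp⟩
        rintro rfl
        have := hdep _ _ hp
        omega
      · refine ⟨?_, Or.inr h⟩
        rintro rfl
        have := hdep _ _ h
        omega
  rw [h1, Set.ncard_insert_of_notMem]
  intro h
  have h2 := hdep _ _ h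
  have h3 := hdep _ _ hp
  omega

/-! ### Reconstruction of a T-tree from its splits. -/

namespace LGraph

open SetSystem LDigraph

variable {n : ℕ} {C : Finset (Finset (Fin n))} {r : Fin n}

/-- The parent relation of the tree with a given system of splits: the nodes are the splits that
do not contain `r`, and the leaf `r` as root. -/
def ParentRel (C : Finset (Finset (Fin n))) (r : Fin n) :
    Option {c // c ∈ C ∧ r ∉ c} → Option {c // c ∈ C ∧ r ∉ c} → Prop
  | some c, some d => ∃ e ∈ C, Disjoint c.1 e ∧ c.1 ∪ e = d.1
  | some c, none => c.1 = Finset.univ.erase r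
  | none, _ => False

open Classical in
/-- The tree with a given system of splits. -/
noncomputable def ofSplits (C : Finset (Finset (Fin n))) (r : Fin n) : LGraph n where
  V := Option {c // c ∈ C ∧ r ∉ c}
  finite_V := inferInstance
  graph := SimpleGraph.fromRel (ParentRel C r)
  label v := v.elim (some r) fun c => if h : ∃ j, c.1 = {j} then some h.choose else none

theorem ofSplits_label_some {c : {c // c ∈ C ∧ r ∉ c}} {j : Fin n} :
    (ofSplits C r).label (some c) = some j ↔ c.1 = {j} := by
  change (if h : ∃ j, c.1 = {j} then some h.choose else none) = some j ↔ _
  split_ifs with h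
  · rw [Option.some_inj]
    constructor
    · exact fun h' => h' ▸ h.choose_spec
    · exact fun h' => Finset.singleton_injective (h.choose_spec.symm.trans h')
  · simp only [false_iff]
    exact fun h' => h ⟨j, h'⟩

theorem ofSplits_label_none {j : Fin n} : (ofSplits C r).label none = some j ↔ r = j :=
  Option.some_inj

/-- The depth of a node of the tree with a given system of splits. -/
def splitDepth (C : Finset (Finset (Fin n))) (r : Fin n) : Option {c // c ∈ C ∧ r ∉ c} → ℕ
  -- The summand 1 accounts for the root `none`, which lies above the largest cluster.
  | some c => ((C.filter (r ∉ ·)).filter (c.1 ⊂ ·)).card + 1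
  | none => 0

theorem mem_filter_of_union_eq {c d : {c // c ∈ C ∧ r ∉ c}} {e : Finset (Fin n)} (he : e ∈ C)
    (hu : c.1 ∪ e = d.1) : e ∈ C.filter (r ∉ ·) :=
  Finset.mem_filter.2 ⟨he, fun h => d.2.2 (hu ▸ Finset.mem_union_right _ h)⟩

theorem splitDepth_of_parentRel (hC : SplitSystem Finset.univ C)
    (c d : Option {c // c ∈ C ∧ r ∉ c}) (h : ParentRel C r c d) :
    splitDepth C r c = splitDepth C r d + 1 := by
  have hH := hC.hierarchy_erase (Finset.mem_univ r)
  rcases c with _ | c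
  · exact h.elim
  rcases d with _ | d
  · have h : c.1 = Finset.univ.erase r := h
    change ((C.filter (r ∉ ·)).filter (c.1 ⊂ ·)).card + 1 = 0 + 1
    rw [Nat.add_right_cancel_iff, Finset.card_eq_zero, Finset.filter_eq_empty_iff, h]
    exact fun y hy hlt => hlt.2 (hH.subset_top y hy)
  · obtain ⟨e, he, hd, hu⟩ := h
    have h1 := hH.card_filter_ssubset (Finset.mem_filter.2 c.2) (mem_filter_of_union_eq he hu) hd
      (hu ▸ Finset.mem_filter.2 d.2)
    rw [hu] at h1
    exact congrArg (· + 1) h1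

theorem exists_parentRel (hC : SplitSystem Finset.univ C) (c : Option {c // c ∈ C ∧ r ∉ c})
    (hc : c ≠ none) : ∃ d, ParentRel C r c d := by
  rcases c with _ | c
  · exact absurd rfl hc
  by_cases h : c.1 = Finset.univ.erase r
  · exact ⟨none, h⟩
  · obtain ⟨e, he, hd, hu⟩ := (hC.hierarchy_erase (Finset.mem_univ r)).exists_sibling
      (Finset.mem_filter.2 c.2) h
    exact ⟨some ⟨_, Finset.mem_filter.1 hu⟩, e, (Finset.mem_filter.1 he).1, hd, rfl⟩

theorem parentRel_unique (hC : SplitSystem Finset.univ C)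
    (c d d' : Option {c // c ∈ C ∧ r ∉ c}) (h : ParentRel C r c d) (h' : ParentRel C r c d') :
    d = d' := by
  have hH := hC.hierarchy_erase (Finset.mem_univ r)
  rcases c with _ | c
  · exact h.elim
  have key : ∀ d : {c // c ∈ C ∧ r ∉ c}, c.1 = Finset.univ.erase r →
      ¬ ParentRel C r (some c) (some d) := by
    rintro d hc ⟨e, he, hd, hu⟩
    have h1 := hH.subset_top _ (Finset.mem_filter.2 d.2)
    rw [← hu, ← hc] at h1
    exact (ssubset_union_of_disjoint hd (hC.nonempty he).ne_empty).2 h1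
  rcases d with _ | d <;> rcases d' with _ | d'
  · rfl
  · exact absurd h' (key d' h)
  · exact absurd h (key d h')
  · obtain ⟨e, he, hd, hu⟩ := h
    obtain ⟨e', he', hd', hu'⟩ := h'
    have h1 := hH.union_unique (Finset.mem_filter.2 c.2) (mem_filter_of_union_eq he hu)
      (mem_filter_of_union_eq he' hu') hd hd' (hu ▸ Finset.mem_filter.2 d.2)
      (hu' ▸ Finset.mem_filter.2 d'.2)
    exact congrArg some (Subtype.ext (by rw [← hu, ← hu', h1]))

theorem not_parentRel_of_singleton (hC : SplitSystem Finset.univ C) {c : {c // c ∈ C ∧ r ∉ c}}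
    {j : Fin n} (hc : c.1 = {j}) (u : Option {c // c ∈ C ∧ r ∉ c}) :
    ¬ ParentRel C r u (some c) := by
  rcases u with _ | u
  · exact id
  · rintro ⟨e, he, hd, hu⟩
    have h1 := ssubset_union_of_disjoint hd (hC.nonempty he).ne_empty
    rw [hu, hc, Finset.ssubset_singleton_iff] at h1
    exact (hC.nonempty u.2.1).ne_empty h1

theorem exists_parentRel_iff (hC : SplitSystem Finset.univ C) {d : {c // c ∈ C ∧ r ∉ c}}
    (hd : d.1.Nontrivial) : ∃ a b : {c // c ∈ C ∧ r ∉ c}, a ≠ b ∧ a.1 ∪ b.1 = d.1 ∧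
      ∀ x, ParentRel C r x (some d) ↔ x = some a ∨ x = some b := by
  obtain ⟨a, ha, b, hb, hab, hu⟩ := hC.splits d.1 d.2.1 hd
  have hr := d.2.2
  rw [← hu, Finset.mem_union, not_or] at hr
  refine ⟨⟨a, ha, hr.1⟩, ⟨b, hb, hr.2⟩, ?_, hu, fun x => ⟨?_, ?_⟩⟩
  · intro h
    obtain ⟨k, hk⟩ := hC.nonempty ha
    have : a = b := Subtype.ext_iff.1 h
    exact Finset.disjoint_left.1 hab hk (this ▸ hk)
  · rcases x with _ | x
    · exact False.elim
    rintro ⟨e, he, hxe, hu'⟩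
    rcases hC.split_unique x.2.1 he ha hb hxe hab (hu'.trans hu.symm) (hu' ▸ d.2.1) with h | h
    · exact Or.inl (congrArg some (Subtype.ext h.1))
    · exact Or.inr (congrArg some (Subtype.ext h.1))
  · rintro (rfl | rfl)
    · exact ⟨b, hb, hab, hu⟩
    · exact ⟨a, ha, hab.symm, by rw [Finset.union_comm]; exact hu⟩

theorem ofSplits_isTree (hC : SplitSystem Finset.univ C) :
    (ofSplits C r).graph.IsTree ∧ ∀ c d : (ofSplits C r).V,
      ParentRel C r c d ↔ ((ofSplits C r).rootedAt none).Adj c d :=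
  SimpleGraph.isTree_fromRel_of_parent (V := Option {c // c ∈ C ∧ r ∉ c}) (dep := splitDepth C r) rfl (splitDepth_of_parentRel hC)
    (exists_parentRel hC) (parentRel_unique hC)

theorem ofSplits_ncard_none (hC : SplitSystem Finset.univ C) :
    ((ofSplits C r).graph.neighborSet none).ncard = 1 := by
  rw [Set.ncard_eq_one]
  refine ⟨some ⟨_, hC.erase_mem r (Finset.mem_univ r), Finset.notMem_erase r _⟩, ?_⟩
  ext u
  refine (SimpleGraph.fromRel_adj (ParentRel C r) none u).trans ⟨?_, ?_⟩
  · rintro ⟨-, h | h⟩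
    · exact h.elim
    · rcases u with _ | u
      · exact h.elim
      · exact congrArg some (Subtype.ext h)
  · rintro rfl
    exact ⟨by simp, Or.inr rfl⟩

theorem ofSplits_ncard_some (hC : SplitSystem Finset.univ C) (c : {c // c ∈ C ∧ r ∉ c}) :
    ((ofSplits C r).graph.neighborSet (some c)).ncard =
      {u | ParentRel C r u (some c)}.ncard + 1 := by
  obtain ⟨p, hp⟩ := exists_parentRel hC (some c) (by simp)
  exact SimpleGraph.ncard_neighborSet_fromRel (splitDepth_of_parentRel hC) (parentRel_unique hC) hp

theorem ofSplits_ncard_singleton (hC : SplitSystem Finset.univ C) {c : {c // c ∈ C ∧ r ∉ c}}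
    {j : Fin n} (hc : c.1 = {j}) : ((ofSplits C r).graph.neighborSet (some c)).ncard = 1 := by
  have h1 : {u | ParentRel C r u (some c)} = ∅ :=
    Set.eq_empty_iff_forall_notMem.2 (not_parentRel_of_singleton hC hc)
  rw [ofSplits_ncard_some hC, h1, Set.ncard_empty]

theorem ofSplits_ncard_nontrivial (hC : SplitSystem Finset.univ C) {c : {c // c ∈ C ∧ r ∉ c}}
    (hc : c.1.Nontrivial) : ((ofSplits C r).graph.neighborSet (some c)).ncard = 3 := by
  obtain ⟨a, b, hab, -, h⟩ := exists_parentRel_iff hC hc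
  have h1 : {u | ParentRel C r u (some c)} = {some a, some b} := Set.ext h
  rw [ofSplits_ncard_some hC, h1, Set.ncard_pair fun h => hab (Option.some_injective _ h)]

theorem ofSplits_isTTree (hn : 3 ≤ n) (hC : SplitSystem Finset.univ C) :
    (ofSplits C r).IsTTree where
  isTree := (ofSplits_isTree hC).1
  label_unique a b j ha hb := by
    rcases a with _ | a <;> rcases b with _ | b
    · rfl
    · rw [ofSplits_label_none] at ha
      exact absurd (by simp [ofSplits_label_some.1 hb, ha]) b.2.2
    · rw [ofSplits_label_none] at hb
      exact absurd (by simp [ofSplits_label_some.1 ha, hb]) a.2.2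
    · exact congrArg some (Subtype.ext
        ((ofSplits_label_some.1 ha).trans (ofSplits_label_some.1 hb).symm))
  exists_label j := by
    by_cases h : r = j
    · exact ⟨none, ofSplits_label_none.2 h⟩
    · exact ⟨some ⟨{j}, hC.singleton_mem (by rw [card_univ_fin]; omega) (Finset.mem_univ j),
        fun h' => h (Finset.mem_singleton.1 h')⟩, ofSplits_label_some.2 rfl⟩
  leaf_iff a := by
    rcases a with _ | a
    · exact ⟨fun _ => ⟨r, rfl⟩, fun _ => ofSplits_ncard_none hC⟩
    · constructor
      · intro h
        rcases singleton_or_nontrivial hC.empty_notMem a.2.1 with ⟨j, hj⟩ | hnt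
        · exact ⟨j, ofSplits_label_some.2 hj⟩
        · have := (ofSplits_ncard_nontrivial hC hnt).symm.trans h
          omega
      · rintro ⟨j, hj⟩
        exact ofSplits_ncard_singleton hC (ofSplits_label_some.1 hj)
  internal a ha := by
    rcases a with _ | a
    · have := ha.trans_eq (ofSplits_ncard_none hC)
      omega
    · rcases singleton_or_nontrivial hC.empty_notMem a.2.1 with ⟨j, hj⟩ | hnt
      · have := ha.trans_eq (ofSplits_ncard_singleton hC hj)
        omega
      · exact ofSplits_ncard_nontrivial hC hnt

theorem ofSplits_cluster (hC : SplitSystem Finset.univ C) (c : {c // c ∈ C ∧ r ∉ c}) :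
    ((ofSplits C r).rootedAt none).cluster (some c) = c.1 := by
  obtain ⟨c, hc⟩ := c
  induction c using Finset.strongInduction with
  | H c ih =>
    have hadj := (ofSplits_isTree (r := r) hC).2
    rcases singleton_or_nontrivial hC.empty_notMem hc.1 with ⟨j, hj⟩ | hnt
    · refine (cluster_eq_of_input (G := (ofSplits C r).rootedAt none)
        (rootedAt_label_eq_x.2 (ofSplits_label_some.2 hj)) fun u hu => ?_).trans hj.symm
      exact not_parentRel_of_singleton (c := ⟨c, hc⟩) hC hj u ((hadj u _).2 hu)
    · obtain ⟨a, b, hab, hu, h⟩ := exists_parentRel_iff (d := ⟨c, hc⟩) hC hnt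
      have hu : a.1 ∪ b.1 = c := hu
      have hin : ¬ ((ofSplits C r).rootedAt none).IsInput (some ⟨c, hc⟩) := by
        rintro ⟨j, hj⟩
        have h1 : c = {j} := ofSplits_label_some.1 (rootedAt_label_eq_x.1 hj)
        rw [h1] at hnt
        exact Finset.not_nontrivial_singleton hnt
      have hlt : ∀ x, ParentRel C r (some x) (some ⟨c, hc⟩) → x.1 ⊂ c := by
        rintro x ⟨e, he, hd, hu⟩
        have h1 := ssubset_union_of_disjoint hd (hC.nonempty he).ne_empty
        rwa [hu] at h1
      have ha := ih a.1 (hlt a ((h _).2 (Or.inl rfl))) a.2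
      have hb := ih b.1 (hlt b ((h _).2 (Or.inr rfl))) b.2
      ext i
      refine (mem_cluster_of_not_isInput hin).trans ?_
      refine Iff.trans ?_ (show i ∈ a.1 ∪ b.1 ↔ i ∈ c by rw [hu])
      rw [Finset.mem_union]
      constructor
      · rintro ⟨u, hu, hi⟩
        rcases (h u).1 ((hadj u _).2 hu) with rfl | rfl
        · exact Or.inl (ha ▸ hi)
        · exact Or.inr (hb ▸ hi)
      · rintro (hi | hi)
        · exact ⟨some a, (hadj _ _).1 ((h _).2 (Or.inl rfl)), ha.symm ▸ hi⟩
        · exact ⟨some b, (hadj _ _).1 ((h _).2 (Or.inr rfl)), hb.symm ▸ hi⟩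

/-- Only one inclusion needs an argument, since all split systems on n leaves have 4n - 6 members.
-/
theorem ofSplits_splits (hn : 3 ≤ n) (hC : SplitSystem Finset.univ C) :
    (ofSplits C r).splits = C := by
  have hS := (ofSplits_isTTree (r := r) hn hC).splitSystem
  have hsub : ∀ c ∈ C, r ∉ c → c ∈ (ofSplits C r).splits := fun c hc hr =>
    mem_splits.2 ⟨none, some ⟨c, hc, hr⟩, Option.some_ne_none _, ofSplits_cluster hC ⟨c, hc, hr⟩⟩
  symm
  refine Finset.eq_of_subset_of_card_le (fun c hc => ?_) ?_
  -- Nodes of the tree give only the clusters without `r`; the others are their complements.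
  · by_cases hr : r ∈ c
    · have h1 := hS.sdiff_mem _ (hsub _ (hC.sdiff_mem c hc) fun h => (Finset.mem_sdiff.1 h).2 hr)
      rwa [Finset.sdiff_sdiff_eq_self (Finset.subset_univ c)] at h1
    · exact hsub c hc hr
  · have h1 := hC.card_eq ⟨r, Finset.mem_univ r⟩
    have h2 := hS.card_eq ⟨r, Finset.mem_univ r⟩
    omega

namespace IsTTree

variable {T U : LGraph n}

open Classical in
/-- A T-tree is determined by its splits. -/
theorem nonempty_iso_ofSplits (hT : T.IsTTree) (r : Fin n) :
    Nonempty (Iso T (ofSplits T.splits r)) := by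
  obtain ⟨b, hb⟩ := hT.exists_label r
  have hmem : ∀ v, v ≠ b → (T.rootedAt b).cluster v ∈ T.splits ∧ r ∉ (T.rootedAt b).cluster v := by
    intro v hv
    refine ⟨mem_splits.2 ⟨b, v, hv, rfl⟩, fun h => ?_⟩
    obtain ⟨u, hu, hl⟩ := mem_cluster.1 h
    exact hT.ne_root_of_reach hv hu (hT.label_unique _ _ _ (rootedAt_label_eq_x.1 hl) hb)
  let f : T.V → (ofSplits T.splits r).V := fun v =>
    if h : v = b then none else some ⟨(T.rootedAt b).cluster v, hmem v h⟩
  have hfb : f b = none := dif_pos rfl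
  have hfv : ∀ v (h : v ≠ b), f v = some ⟨(T.rootedAt b).cluster v, hmem v h⟩ :=
    fun v h => dif_neg h
  have hinj : Function.Injective f := by
    intro u v huv
    by_cases hu : u = b <;> by_cases hv : v = b
    · exact hu.trans hv.symm
    · rw [hu, hfb, hfv v hv] at huv
      exact absurd huv (by simp)
    · rw [hv, hfb, hfv u hu] at huv
      exact absurd huv (by simp)
    · rw [hfv u hu, hfv v hv] at huv
      exact hT.cluster_injective hu hv (Subtype.ext_iff.1 (Option.some_injective _ huv))
  have hsurj : Function.Surjective f := by
    rintro (_ | c)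
    · exact ⟨b, hfb⟩
    · obtain ⟨v, hv, hvc⟩ := hT.exists_cluster_eq hb c.2.1 c.2.2
      exact ⟨v, (hfv v hv).trans (congrArg some (Subtype.ext hvc))⟩
  have hrel : ∀ u v, ParentRel T.splits r (f u) (f v) ↔ (T.rootedAt b).Adj u v := by
    intro u v
    by_cases hu : u = b
    · subst hu
      rw [hfb]
      exact ⟨False.elim, fun h => ne_root h rfl⟩
    rw [hfv u hu]
    by_cases hv : v = b
    · subst hv
      rw [hfb]
      constructor
      · intro h
        have h : (T.rootedAt v).cluster u = Finset.univ.erase r := h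
        obtain ⟨a, hab, -⟩ := hT.exists_neighbor hb
        obtain rfl := hT.cluster_injective hu hab.ne (h.trans (hT.cluster_neighbor hb hab).symm)
        exact adj_rootedAt_self hab
      · exact fun h => hT.cluster_neighbor hb h.1
    rw [hfv v hv]
    constructor
    · rintro ⟨e, he, hd, hun⟩
      have hd : Disjoint ((T.rootedAt b).cluster u) e := hd
      have hun : (T.rootedAt b).cluster u ∪ e = (T.rootedAt b).cluster v := hun
      have hex : ∃ w, (T.rootedAt b).Adj w v := by
        by_contra! hno
        obtain ⟨j, -, hj⟩ := hT.exists_label_of_not_adj hv hno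
        have h1 := ssubset_union_of_disjoint hd (hT.splitSystem.nonempty he).ne_empty
        rw [hun, hj, Finset.ssubset_singleton_iff] at h1
        exact (hT.cluster_nonempty hu).ne_empty h1
      obtain ⟨w, hw⟩ := hex
      obtain ⟨w', hw', hd', hun'⟩ := hT.exists_sibling hv hw
      -- The split of the cluster of `v` is unique, so the cluster of `u` is that of a child of `v`,
      -- and clusters determine nodes.
      rcases hT.splitSystem.split_unique (hmem u hu).1 he (hmem w (ne_root hw)).1
        (hmem w' (ne_root hw')).1 hd hd' (hun.trans hun'.symm) (hun ▸ (hmem v hv).1) with h | h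
      · rwa [hT.cluster_injective hu (ne_root hw) h.1]
      · rwa [hT.cluster_injective hu (ne_root hw') h.1]
    · intro h
      obtain ⟨w, hw, hd, hun⟩ := hT.exists_sibling hv h
      exact ⟨_, (hmem w (ne_root hw)).1, hd, hun⟩
  refine ⟨⟨⟨Equiv.ofBijective f ⟨hinj, hsurj⟩, ?_⟩, ?_⟩⟩
  · intro u v
    change (SimpleGraph.fromRel (ParentRel T.splits r)).Adj (f u) (f v) ↔ _
    refine (SimpleGraph.fromRel_adj _ _ _).trans
      ((and_congr Iff.rfl (or_congr (hrel u v) (hrel v u))).trans ?_)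
    constructor
    · rintro ⟨-, h | h⟩
      · exact h.1
      · exact h.1.symm
    · exact fun h => ⟨fun h' => h.ne (hinj h'), hT.adj_rootedAt_or b h⟩
  · intro v
    change (ofSplits T.splits r).label (f v) = T.label v
    refine Option.ext fun j => ?_
    by_cases hv : v = b
    · subst hv
      rw [hfb, hb]
      rfl
    · rw [hfv v hv]
      exact ofSplits_label_some.trans (hT.label_iff_cluster hv).symm

theorem equiv_of_splits_eq (hT : T.IsTTree) (hU : U.IsTTree) (r : Fin n)
    (h : T.splits = U.splits) : T ≈ U := by
  have h1 : T ≈ ofSplits T.splits r := hT.nonempty_iso_ofSplits r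
  have h2 : U ≈ ofSplits U.splits r := hU.nonempty_iso_ofSplits r
  rw [h] at h1
  exact Setoid.trans h1 (Setoid.symm h2)

end IsTTree

end LGraph

theorem mainTheorem5 (n : ℕ) (hn : 3 ≤ n) :
    Set.BijOn (hMap n) (tTrees n) (optimalStructures n) ∧
      (tTrees n).ncard = (2 * n - 5)‼ ∧ (optimalStructures n).ncard = (2 * n - 5)‼ := by
  have hmap : ∀ T : LGraph n, T.IsTTree →
      hMap n (Quotient.mk _ T) = Quotient.mk _ (LDigraph.ofClusters T.splits) :=
    fun T hT => Quotient.sound (hT.nonempty_unionD_iso hn)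
  have hbij : Set.BijOn (hMap n) (tTrees n) (optimalStructures n) := by
    refine ⟨?_, ?_, ?_⟩
    · rintro _ ⟨T, hT, rfl⟩
      exact (mem_optimalStructures hn).2 ⟨T.splits, hT.splitSystem, (hmap T hT).symm⟩
    · rintro _ ⟨T, hT, rfl⟩ _ ⟨U, hU, rfl⟩ h
      rw [hmap T hT, hmap U hU] at h
      -- The leaf used as root for comparing the two trees is arbitrary; the index 0 exists because
      -- `n` is positive.
      exact Quotient.sound (hT.equiv_of_splits_eq hU ⟨0, by omega⟩
        (LDigraph.eq_of_ofClusters_iso hn hT.splitSystem hU.splitSystem (Quotient.exact h)))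
    · intro q hq
      obtain ⟨C, hC, rfl⟩ := (mem_optimalStructures hn).1 hq
      have hT := LGraph.ofSplits_isTTree (r := ⟨0, by omega⟩) hn hC
      exact ⟨_, ⟨_, hT, rfl⟩, by rw [hmap _ hT, LGraph.ofSplits_splits hn hC]⟩
  refine ⟨hbij, ?_, ncard_optimalStructures hn⟩
  rw [← ncard_optimalStructures hn, ← hbij.image_eq, hbij.injOn.ncard_image]
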